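/- Let $M$ be a compact two-dimensional smooth manifold (without boundary) and let $1\le r\le\infty$. Let $\Sigma=\Sigma_1\sqcup\dots\sqcup\Sigma_n\subset M$ be a finite disjoint union of simple (connected) curves $\Sigma_k=\gamma_k^{-1}(0)$, where $\gamma_k:M\to\mathbb R$ is smooth and has $0$ as a regular value, such that $M\setminus\Sigma$ has exactly $n+1$ connected components $R_1,\dots,R_{n+1}$. A piecewise-smooth vector field (PSVF) with switching manifold $\Sigma$ is a tuple $Z=(X_1,\dots,X_{n+1})$ of $C^r$ vector fields on $M$, where $X_i$ is used on $\overline{R_i}$; the set of these PSVFs carries the product of the $C^r$ topologies. If $\Sigma_k$ is the common boundary of $R_i\subset\{\gamma_k>0\}$ and $R_j\subset\{\gamma_k<0\}$, a point $p\in\Sigma_k$ is *sliding* if $d\gamma_k(X_i)(p)<0<d\gamma_k(X_j)(p)$, *escaping* if $d\gamma_k(X_j)(p)<0<d\gamma_k(X_i)(p)$, and a *tangency point* if $d\gamma_k(X_i)(p)=0$ or $d\gamma_k(X_j)(p)=0$. At a sliding or escaping point $p$ the sliding vector field $Z^\Sigma(p)$ is the vector on the segment joining $X_i(p)$ and $X_j(p)$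 that is tangent to $\Sigma_k$. A Filippov trajectory is a continuous curve in $M$ that is an oriented concatenation (finite on each compact time interval) of arcs of trajectories of the fields $X_i$ inside $\overline{R_i}$ and of $Z^\Sigma$, and that cannot be extended as such. $Z$ is topologically transitive if for any two nonempty open sets $U,V\subset M$ some Filippov trajectory meets both $U$ and $V$; it is robustly transitive if it is topologically transitive and every PSVF with the same $\Sigma$ that is sufficiently $C^r$-close to $Z$ is topologically transitive. **Theorem.** If $Z$ is a PSVF on $M$ whose sliding region and escaping region are both nonempty and whose set of tangency points is finite, then $Z$ is not robustly transitive. -/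

import Mathlib

open Set Filter Topology
open scoped Manifold ContDiff

/-- The Euclidean plane, on which surfaces are modelled. -/
abbrev Plane : Type := EuclideanSpace ℝ (Fin 2)

section Surface

variable (M : Type*) [TopologicalSpace M] [ChartedSpace Plane M]

/-- A switching manifold on the surface `M`: finitely many pairwise disjoint connected curves
`γ k = 0`, each the zero set of a smooth function on `M` that has `0` as a regular value (so that,
on a compact surface, each of them is a simple closed curve), splitting `M` into `n + 1` connected
regions. -/
structure SwitchingManifold (n : ℕ) where
  /-- the functions that define the curves -/
  γ : Fin n → M → ℝ
  contMDiff_γ : ∀ k, ContMDiff (𝓡 2) 𝓘(ℝ, ℝ) ∞ (γ k)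
  regular_γ : ∀ k p, γ k p = 0 → Function.Surjective (mfderiv (𝓡 2) 𝓘(ℝ, ℝ) (γ k) p)
  connected_γ : ∀ k, IsConnected {p | γ k p = 0}
  disjoint_γ : ∀ k l, k ≠ l → Disjoint {p | γ k p = 0} {p | γ l p = 0}
  /-- the regions into which `M` is split -/
  region : Fin (n + 1) → Set M
  region_injective : Function.Injective region
  /-- the regions are exactly the connected components of the complement of the curves -/
  range_region : range region =
    {C | ∃ x ∈ {p | ∀ k, γ k p ≠ 0}, C = connectedComponentIn {p | ∀ k, γ k p ≠ 0} x}

variable [IsManifold (𝓡 2) ∞ M]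

/-- Vector fields of class `C^r` on the surface `M`. -/
abbrev VField (r : ℕ∞) : Type _ :=
  ContMDiffSection (𝓡 2) Plane (r : WithTop ℕ∞) (TangentSpace (𝓡 2) : M → Type _)

end Surface

namespace VField

variable {M : Type*} [TopologicalSpace M] [ChartedSpace Plane M] [IsManifold (𝓡 2) ∞ M] {r : ℕ∞}

/-- The expression of the vector field `X` in the chart `e`: the push-forward of `X` by `e`, a
planar vector field that is meaningful on the open set `e.target`. -/
noncomputable def inChart (X : VField M r) (e : OpenPartialHomeomorph M Plane) (y : Plane) :
    Plane :=
  mfderiv (𝓡 2) (𝓡 2) e (e.symm y) (X (e.symm y))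

/-- The `C^r` fields whose expression in the chart `e` has, on the compact set `K`, an `m`-th
derivative that is `ε`-close to that of `X`. -/
def basicNhd (X : VField M r) (e : OpenPartialHomeomorph M Plane) (K : Set M) (m : ℕ) (ε : ℝ) :
    Set (VField M r) :=
  {Y | ∀ p ∈ K, ‖iteratedFDeriv ℝ m (Y.inChart e) (e p) -
    iteratedFDeriv ℝ m (X.inChart e) (e p)‖ < ε}

variable (M r) in
/-- The `C^r` topology on `C^r` vector fields: uniform convergence on compact subsets of smooth
charts of all derivatives of order at most `r` (of all orders if `r = ∞`). -/
@[reducible] def crTopology : TopologicalSpace (VField M r) :=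
  TopologicalSpace.generateFrom
    {N | ∃ (X : VField M r) (e : OpenPartialHomeomorph M Plane) (K : Set M) (m : ℕ) (ε : ℝ),
      e ∈ IsManifold.maximalAtlas (𝓡 2) ∞ M ∧ IsCompact K ∧ K ⊆ e.source ∧ (m : ℕ∞) ≤ r ∧
      0 < ε ∧ N = basicNhd X e K m ε}

end VField

namespace SwitchingManifold

variable {M : Type*} [TopologicalSpace M] [ChartedSpace Plane M] {n : ℕ}

/-- The `k`-th curve of the switching manifold. -/
def curve (S : SwitchingManifold M n) (k : Fin n) : Set M := {p | S.γ k p = 0}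

/-- The region `i` is adjacent to the `k`-th curve, and the gradient of `γ k` points into it. -/
def IsPosSide (S : SwitchingManifold M n) (k : Fin n) (i : Fin (n + 1)) : Prop :=
  S.curve k ⊆ closure (S.region i) ∧ ∀ p ∈ S.region i, 0 < S.γ k p

/-- The region `j` is adjacent to the `k`-th curve, and the gradient of `γ k` points out of it. -/
def IsNegSide (S : SwitchingManifold M n) (k : Fin n) (j : Fin (n + 1)) : Prop :=
  S.curve k ⊆ closure (S.region j) ∧ ∀ p ∈ S.region j, S.γ k p < 0

end SwitchingManifold

/-- A piecewise-smooth vector field of class `C^r` with switching manifold `S`: one `C^r` vector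
field for each region. -/
@[ext]
structure PSVF {M : Type*} [TopologicalSpace M] [ChartedSpace Plane M] [IsManifold (𝓡 2) ∞ M]
    {n : ℕ} (S : SwitchingManifold M n) (r : ℕ∞) where
  /-- the field used on the closure of the region `i` -/
  field : Fin (n + 1) → VField M r

namespace PSVF

variable {M : Type*} [TopologicalSpace M] [ChartedSpace Plane M] [IsManifold (𝓡 2) ∞ M]
  {n : ℕ} {S : SwitchingManifold M n} {r : ℕ∞}

/-- Piecewise-smooth vector fields are close when all their components are `C^r`-close. -/
instance : TopologicalSpace (PSVF S r) :=
  TopologicalSpace.induced PSVF.field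
    (@Pi.topologicalSpace (Fin (n + 1)) (fun _ => VField M r) (fun _ => VField.crTopology M r))

/-- The Lie derivative of `γ k` in the direction of the `i`-th field, at the point `p`. -/
noncomputable def lieDeriv (Z : PSVF S r) (i : Fin (n + 1)) (k : Fin n) (p : M) : ℝ :=
  mfderiv (𝓡 2) 𝓘(ℝ, ℝ) (S.γ k) p (Z.field i p)

/-- The sliding region: both adjacent fields point towards the switching manifold. -/
def slidingRegion (Z : PSVF S r) : Set M :=
  {p | ∃ k i j, p ∈ S.curve k ∧ S.IsPosSide k i ∧ S.IsNegSide k j ∧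
    Z.lieDeriv i k p < 0 ∧ 0 < Z.lieDeriv j k p}

/-- The escaping region: both adjacent fields point away from the switching manifold. -/
def escapingRegion (Z : PSVF S r) : Set M :=
  {p | ∃ k i j, p ∈ S.curve k ∧ S.IsPosSide k i ∧ S.IsNegSide k j ∧
    0 < Z.lieDeriv i k p ∧ Z.lieDeriv j k p < 0}

/-- The set of tangency points: the points of the switching manifold at which one of the two
adjacent fields is tangent to it (or vanishes). -/
def tangencySet (Z : PSVF S r) : Set M :=
  {p | ∃ k i, p ∈ S.curve k ∧ (S.IsPosSide k i ∨ S.IsNegSide k i) ∧ Z.lieDeriv i k p = 0}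

/-- `v` is the value at `p` of the sliding vector field, which lives on the sliding and escaping
regions: the vector on the segment joining the values of the two adjacent fields that is tangent to
the switching manifold. -/
def IsSlidingVector (Z : PSVF S r) (p : M) (v : TangentSpace (𝓡 2) p) : Prop :=
  p ∈ Z.slidingRegion ∪ Z.escapingRegion ∧
    ∃ k i j, p ∈ S.curve k ∧ S.IsPosSide k i ∧ S.IsNegSide k j ∧
      v ∈ segment ℝ (Z.field i p) (Z.field j p) ∧ mfderiv (𝓡 2) 𝓘(ℝ, ℝ) (S.γ k) p v = 0

/-- On `[a, b]`, `c` is an arc of trajectory of the field of some region, run inside the closure of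
that region. -/
def IsRegionArc (Z : PSVF S r) (c : ℝ → M) (a b : ℝ) : Prop :=
  ContinuousOn c (Icc a b) ∧ ∃ i, (∀ t ∈ Icc a b, c t ∈ closure (S.region i)) ∧
    IsMIntegralCurveOn c (fun p => Z.field i p) (Ioo a b)

/-- On `[a, b]`, `c` is an arc of trajectory of the sliding vector field, whose end points may be
boundary points of the sliding and escaping regions. -/
def IsSlidingArc (Z : PSVF S r) (c : ℝ → M) (a b : ℝ) : Prop :=
  ContinuousOn c (Icc a b) ∧ ∀ t ∈ Ioo a b, ∃ v : TangentSpace (𝓡 2) (c t),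
    Z.IsSlidingVector (c t) v ∧
      HasMFDerivAt 𝓘(ℝ, ℝ) (𝓡 2) c t ((1 : ℝ →L[ℝ] ℝ).smulRight v)

/-- On `[a, b]`, `c` is a finite oriented concatenation of arcs of trajectories of the fields of the
regions and of the sliding vector field. -/
def IsConcatenation (Z : PSVF S r) (c : ℝ → M) (a b : ℝ) : Prop :=
  ∃ (N : ℕ) (τ : ℕ → ℝ), τ 0 = a ∧ τ N = b ∧ ∀ l < N, τ l < τ (l + 1) ∧
    (Z.IsRegionArc c (τ l) (τ (l + 1)) ∨ Z.IsSlidingArc c (τ l) (τ (l + 1)))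

/-- `c`, with time interval `J`, is a global trajectory of `Z`. -/
def IsGlobalTrajectory (Z : PSVF S r) (J : Set ℝ) (c : ℝ → M) : Prop :=
  J.Nonempty ∧ J.OrdConnected ∧ ∀ a ∈ J, ∀ b ∈ J, a ≤ b → Z.IsConcatenation c a b

/-- `c`, with time interval `J`, is a Filippov trajectory of `Z`: a global trajectory that cannot be
extended. -/
def IsFilippovTrajectory (Z : PSVF S r) (J : Set ℝ) (c : ℝ → M) : Prop :=
  Z.IsGlobalTrajectory J c ∧
    ∀ J' c', Z.IsGlobalTrajectory J' c' → J ⊆ J' → EqOn c c' J → J' = J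

/-- `Z` is topologically transitive: any two nonempty open sets are connected by a Filippov
trajectory. -/
def IsTransitive (Z : PSVF S r) : Prop :=
  ∀ U V : Set M, IsOpen U → U.Nonempty → IsOpen V → V.Nonempty →
    ∃ J c, Z.IsFilippovTrajectory J c ∧ (∃ t ∈ J, c t ∈ U) ∧ ∃ t ∈ J, c t ∈ V

/-- `Z` is robustly transitive: it is transitive, and so are all the piecewise-smooth vector fields
that are sufficiently close to it. -/
def IsRobustlyTransitive (Z : PSVF S r) : Prop :=
  Z.IsTransitive ∧ ∀ᶠ Z' in 𝓝 Z, Z'.IsTransitive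

end PSVF

/-!
A Filippov trajectory that meets the sliding region slides until it reaches a tangency point: this
is what prevents transitivity. For a field `Z` let the stable set (resp. the unstable set) be the
set of the points of the switching manifold towards (resp. from) which both adjacent fields point in
the wide sense. Suppose that `Z` is regular, that is, the two adjacent fields are never tangent to
the switching manifold at the same point. Then the stable and the unstable set are disjoint, and
outside the unstable set trajectories can be continued in only one way as long as they avoid the
stable set. A trajectory leaves the stable set along a *free path*, which starts at one of the
finitely many tangency points and is determined by this point. A *connection* is a free path that
arrives at the unstable set.

If there are no connections, a trajectory that has met the stable set is, since it last left it, on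
one of finitely many free paths. Near a sliding point a trajectory that enters a half-disc on one
side of the curve reaches the stable set shortly after, along an arc transverse to the curve, so
that each free path visits the half-disc along a single short arc. Hence the two half-discs on the
sides of the sliding point contain open sets `U` and `V` that no free path reaches
(`PSVF.IsTrap.exists_isOpen`). A trajectory from one of them to the other has to meet the stable set
first, and then arrives along a free path, which is impossible: `Z` is not transitive
(`PSVF.not_isTransitive`).

It remains to reach this situation by arbitrarily small perturbations that keep the sliding point
and the finiteness of the set of tangency points. Double tangencies are removed by adding, in a
chart, a small constant field to one of the fields near the tangency; a one-dimensional Sard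
argument keeps the tangencies finite in number (`PSVF.frequently_isRegular`).

Connections end at finitely many points of the unstable set, with one of finitely many arcs `β j`
(`PSVF.BreakData`). The fields are modified in small discs on these arcs, by nonnegative multiples
of a vector transverse to the arc: this pushes trajectories to one side of the arc only, so that a
trajectory that enters a disc on the arc and is pushed does not come back to the arc before it has
left the disc (`eq_of_pushed_curve`). Such a modification breaks a connection, but it may create
others, whose free paths visit the modified disc before their end. Those arrive at the unstable set
at least a unit of time later: the number of time units during which there is no connection is
increased by one at each stage, with smaller and smaller increments that are supported closer and
closer to the base points `β j (-α)` (`PSVF.BreakData.IsStage.exists_succ`). An increment does not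
meet the free paths that are too short to be continued to a connection, so that the free paths of
bounded duration are eventually the same for all stages, and the limit of the modifications has no
connection at all (`PSVF.BreakData.not_isConnection_limit`).
-/

set_option linter.unusedSectionVars false

/-! ### Vector fields in charts and the topology -/

namespace VField

variable {M : Type*} [TopologicalSpace M] [ChartedSpace Plane M] [IsManifold (𝓡 2) ∞ M] {r : ℕ∞}

/-- The expression in the chart `e` of a `C^r` field is `C^r` on the target of the chart. -/
lemma contDiffOn_inChart (X : VField M r) {e : OpenPartialHomeomorph M Plane}
    (he : e ∈ IsManifold.maximalAtlas (𝓡 2) ∞ M) :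
    ContDiffOn ℝ (r : WithTop ℕ∞) (X.inChart e) e.target := by
  have h1 : ContMDiffOn (𝓡 2) (𝓡 2) ∞ e e.source := contMDiffOn_of_mem_maximalAtlas he
  have h2 : ContMDiffOn (𝓡 2) (𝓡 2) ∞ e.symm e.target := contMDiffOn_symm_of_mem_maximalAtlas he
  have h3 := h1.contMDiffOn_tangentMapWithin (m := ∞) le_rfl e.open_source.uniqueMDiffOn
  have h4 : ContMDiffOn (𝓡 2) ((𝓡 2).prod 𝓘(ℝ, Plane)) (r : WithTop ℕ∞)
      (fun y : Plane => (⟨e.symm y, X (e.symm y)⟩ : TangentBundle (𝓡 2) M)) e.target :=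
    X.contMDiff.comp_contMDiffOn (h2.of_le (by exact_mod_cast le_top))
  have h5 : ContMDiffOn (𝓡 2) ((𝓡 2).prod 𝓘(ℝ, Plane)) (r : WithTop ℕ∞)
      (fun y : Plane => tangentMapWithin (𝓡 2) (𝓡 2) e e.source
        (⟨e.symm y, X (e.symm y)⟩ : TangentBundle (𝓡 2) M)) e.target :=
    (h3.of_le (by exact_mod_cast le_top)).comp h4 (fun y hy => e.map_target hy)
  have h6 := ((contMDiff_snd_tangentBundle_modelSpace (n := (r : WithTop ℕ∞)) Plane
    (𝓡 2)).comp_contMDiffOn h5).contDiffOn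
  refine h6.congr fun y hy => ?_
  simp only [inChart, tangentMapWithin, Function.comp]
  rw [mfderivWithin_of_isOpen e.open_source (e.map_target hy)]

lemma inChart_add (X Y : VField M r) (e : OpenPartialHomeomorph M Plane) :
    (X + Y).inChart e = X.inChart e + Y.inChart e := by
  ext1 y
  simp only [inChart, Pi.add_apply]
  rw [ContMDiffSection.coe_add, Pi.add_apply, map_add]
  rfl

lemma inChart_sub (X Y : VField M r) (e : OpenPartialHomeomorph M Plane) :
    (X - Y).inChart e = X.inChart e - Y.inChart e := by
  ext1 y
  simp only [inChart, Pi.sub_apply]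
  rw [ContMDiffSection.coe_sub, Pi.sub_apply, map_sub]
  rfl

lemma inChart_smul (c : ℝ) (X : VField M r) (e : OpenPartialHomeomorph M Plane) :
    (c • X).inChart e = c • X.inChart e := by
  ext1 y
  simp only [inChart, Pi.smul_apply]
  rw [ContMDiffSection.coe_smul, Pi.smul_apply, map_smul]
  rfl

lemma contDiffAt_inChart (X : VField M r) {e : OpenPartialHomeomorph M Plane}
    (he : e ∈ IsManifold.maximalAtlas (𝓡 2) ∞ M) {y : Plane} (hy : y ∈ e.target) {m : ℕ}
    (hm : (m : ℕ∞) ≤ r) : ContDiffAt ℝ m (X.inChart e) y :=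
  ((X.contDiffOn_inChart he).of_le (by exact_mod_cast hm)).contDiffAt (e.open_target.mem_nhds hy)

lemma continuousOn_iteratedFDeriv_inChart (X : VField M r) {e : OpenPartialHomeomorph M Plane}
    (he : e ∈ IsManifold.maximalAtlas (𝓡 2) ∞ M) {m : ℕ} (hm : (m : ℕ∞) ≤ r) :
    ContinuousOn (iteratedFDeriv ℝ m (X.inChart e)) e.target := by
  have := (X.contDiffOn_inChart he).continuousOn_iteratedFDerivWithin (m := m)
    (by exact_mod_cast hm) e.open_target.uniqueDiffOn
  exact this.congr fun y hy => (iteratedFDerivWithin_of_isOpen m e.open_target hy).symm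

lemma iteratedFDeriv_inChart_sub (X Y : VField M r) {e : OpenPartialHomeomorph M Plane}
    (he : e ∈ IsManifold.maximalAtlas (𝓡 2) ∞ M) {y : Plane} (hy : y ∈ e.target) {m : ℕ}
    (hm : (m : ℕ∞) ≤ r) :
    iteratedFDeriv ℝ m ((X - Y).inChart e) y =
      iteratedFDeriv ℝ m (X.inChart e) y - iteratedFDeriv ℝ m (Y.inChart e) y := by
  rw [inChart_sub]
  exact iteratedFDeriv_sub_apply (X.contDiffAt_inChart he hy hm) (Y.contDiffAt_inChart he hy hm)

end VField

namespace PSVF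

variable {M : Type*} [TopologicalSpace M] [ChartedSpace Plane M] [IsManifold (𝓡 2) ∞ M]
  {n : ℕ} {S : SwitchingManifold M n} {r : ℕ∞}

/-- Convergence of piecewise-smooth vector fields: it is enough that all derivatives of order at
most `r` of the differences of the components tend to `0`, uniformly on compact subsets of
charts. -/
lemma tendsto_nhds_of_inChart {α : Type*} {l : Filter α} {F : α → PSVF S r} {Z : PSVF S r}
    (h : ∀ (i : Fin (n + 1)) (e : OpenPartialHomeomorph M Plane) (K : Set M) (m : ℕ),
      e ∈ IsManifold.maximalAtlas (𝓡 2) ∞ M → IsCompact K → K ⊆ e.source → (m : ℕ∞) ≤ r →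
      ∀ ε : ℝ, 0 < ε → ∀ᶠ a in l, ∀ p ∈ K,
        ‖iteratedFDeriv ℝ m (((F a).field i - Z.field i).inChart e) (e p)‖ < ε) :
    Tendsto F l (𝓝 Z) := by
  let _ : TopologicalSpace (VField M r) := VField.crTopology M r
  rw [nhds_induced, tendsto_comap_iff, tendsto_pi_nhds]
  intro i
  refine TopologicalSpace.tendsto_nhds_generateFrom_iff.2 ?_
  rintro N ⟨X, e, K, m, ε, he, hK, hKe, hm, hε, rfl⟩ hZ
  obtain ⟨δ, hδ, hδK⟩ : ∃ δ > 0, ∀ p ∈ K,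
      ‖iteratedFDeriv ℝ m ((Z.field i).inChart e) (e p) -
        iteratedFDeriv ℝ m (X.inChart e) (e p)‖ ≤ ε - δ := by
    rcases K.eq_empty_or_nonempty with rfl | hne
    · exact ⟨1, one_pos, by simp⟩
    have hc : ContinuousOn (fun p => ‖iteratedFDeriv ℝ m ((Z.field i).inChart e) (e p) -
        iteratedFDeriv ℝ m (X.inChart e) (e p)‖) K := by
      have hmaps : MapsTo e K e.target := fun p hp => e.map_source (hKe hp)
      have hce : ContinuousOn e K := e.continuousOn.mono hKe
      exact ((((Z.field i).continuousOn_iteratedFDeriv_inChart he hm).comp hce hmaps).sub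
        ((X.continuousOn_iteratedFDeriv_inChart he hm).comp hce hmaps)).norm
    obtain ⟨q, hq, hqmax⟩ := hK.exists_isMaxOn hne hc
    refine ⟨ε - ‖iteratedFDeriv ℝ m ((Z.field i).inChart e) (e q) -
        iteratedFDeriv ℝ m (X.inChart e) (e q)‖, sub_pos.2 (hZ q hq), fun p hp => ?_⟩
    have := hqmax hp
    simp only [mem_ofPred_eq] at this
    linarith
  filter_upwards [h i e K m he hK hKe hm δ hδ] with a ha p hp
  have h1 := ha p hp
  rw [VField.iteratedFDeriv_inChart_sub _ _ he (e.map_source (hKe hp)) hm] at h1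
  have h2 := hδK p hp
  calc _ = ‖(iteratedFDeriv ℝ m (((F a).field i).inChart e) (e p) -
        iteratedFDeriv ℝ m ((Z.field i).inChart e) (e p)) +
        (iteratedFDeriv ℝ m ((Z.field i).inChart e) (e p) -
        iteratedFDeriv ℝ m (X.inChart e) (e p))‖ := by simp [Function.comp]
    _ < ε := by
      refine (norm_add_le _ _).trans_lt ?_
      linarith

end PSVF

/-! ### Vector fields supported in a chart -/

namespace VField

variable {M : Type*} [TopologicalSpace M] [ChartedSpace Plane M] [IsManifold (𝓡 2) ∞ M] {r : ℕ∞}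

lemma mdifferentiableAt_chart {e : OpenPartialHomeomorph M Plane}
    (he : e ∈ IsManifold.maximalAtlas (𝓡 2) ∞ M) {p : M} (hp : p ∈ e.source) :
    MDifferentiableAt (𝓡 2) (𝓡 2) e p :=
  ((contMDiffOn_of_mem_maximalAtlas he).contMDiffAt (e.open_source.mem_nhds hp)).mdifferentiableAt
    (by simp)

lemma mdifferentiableAt_chart_symm {e : OpenPartialHomeomorph M Plane}
    (he : e ∈ IsManifold.maximalAtlas (𝓡 2) ∞ M) {y : Plane} (hy : y ∈ e.target) :
    MDifferentiableAt (𝓡 2) (𝓡 2) e.symm y :=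
  ((contMDiffOn_symm_of_mem_maximalAtlas he).contMDiffAt
    (e.open_target.mem_nhds hy)).mdifferentiableAt (by simp)

/-- `Y` is the vector field that vanishes outside the domain of the chart `e` and is expressed by
the planar vector field `G` in that chart. -/
def IsChartField (Y : VField M r) (e : OpenPartialHomeomorph M Plane) (G : Plane → Plane) : Prop :=
  (∀ p ∈ e.source, mfderiv (𝓡 2) (𝓡 2) e p (Y p) = G (e p)) ∧ ∀ p ∉ e.source, Y p = 0

lemma mfderiv_chart_comp_symm {e : OpenPartialHomeomorph M Plane}
    (he : e ∈ IsManifold.maximalAtlas (𝓡 2) ∞ M) {p : M} (hp : p ∈ e.source) (w : Plane) :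
    mfderiv (𝓡 2) (𝓡 2) e p (mfderiv (𝓡 2) (𝓡 2) e.symm (e p) w) = w := by
  have h1 := mdifferentiableAt_chart_symm he (e.map_source hp)
  have h2 : MDifferentiableAt (𝓡 2) (𝓡 2) e (e.symm (e p)) := by
    rw [e.left_inv hp]; exact mdifferentiableAt_chart he hp
  have h3 := mfderiv_comp_apply (e p) h2 h1 w
  have h4 : (e ∘ e.symm : Plane → Plane) =ᶠ[𝓝 (e p)] id := by
    filter_upwards [e.open_target.mem_nhds (e.map_source hp)] with y hy using e.right_inv hy
  rw [h4.mfderiv_eq, mfderiv_id] at h3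
  have key : ∀ q (hq : q = p), mfderiv (𝓡 2) (𝓡 2) e q (mfderiv (𝓡 2) (𝓡 2) e.symm (e p) w) =
      mfderiv (𝓡 2) (𝓡 2) e p (mfderiv (𝓡 2) (𝓡 2) e.symm (e p) w) := by
    rintro q rfl; rfl
  rw [← key _ (e.left_inv hp)]
  exact h3.symm

lemma mfderiv_symm_comp_chart {e : OpenPartialHomeomorph M Plane}
    (he : e ∈ IsManifold.maximalAtlas (𝓡 2) ∞ M) {p : M} (hp : p ∈ e.source)
    (v : TangentSpace (𝓡 2) p) :
    mfderiv (𝓡 2) (𝓡 2) e.symm (e p) (mfderiv (𝓡 2) (𝓡 2) e p v) = v := by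
  have h1 := mdifferentiableAt_chart_symm he (e.map_source hp)
  have h3 := mfderiv_comp_apply p h1 (mdifferentiableAt_chart he hp) v
  have h4 : (e.symm ∘ e : M → M) =ᶠ[𝓝 p] id := by
    filter_upwards [e.open_source.mem_nhds hp] with y hy using e.left_inv hy
  rw [h4.mfderiv_eq, mfderiv_id] at h3
  exact h3.symm

/-- A smooth compactly supported multiple of a constant planar field, supported in the target of a
chart, comes from a vector field on the surface. -/
lemma exists_isChartField [T2Space M] {e : OpenPartialHomeomorph M Plane}
    (he : e ∈ IsManifold.maximalAtlas (𝓡 2) ∞ M) {g : Plane → ℝ} (hg : ContDiff ℝ ∞ g)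
    {B : Set Plane} (hB : IsCompact B) (hgB : ∀ x ∉ B, g x = 0) (hBe : B ⊆ e.target) (w : Plane) :
    ∃ Y : VField M r, IsChartField Y e (fun x => g x • w) := by
  classical
  let ψ : M → ℝ := fun p => if p ∈ e.source then g (e p) else 0
  let s : (p : M) → TangentSpace (𝓡 2) p := fun p => mfderiv (𝓡 2) (𝓡 2) e.symm (e p) w
  have hψ : ContMDiffOn (𝓡 2) 𝓘(ℝ, ℝ) (r : WithTop ℕ∞) ψ e.source := by
    have h1 : ContMDiffOn (𝓡 2) 𝓘(ℝ, ℝ) ∞ (g ∘ e) e.source :=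
      hg.contMDiff.comp_contMDiffOn (contMDiffOn_of_mem_maximalAtlas he)
    refine (h1.of_le (by exact_mod_cast le_top)).congr fun p hp => ?_
    simp [ψ, hp]
  have hcl : IsClosed (e.symm '' B) :=
    (hB.image_of_continuousOn (e.continuousOn_symm.mono hBe)).isClosed
  have hts : tsupport ψ ⊆ e.source := by
    refine (closure_minimal (t := e.symm '' B) (fun p hp => ?_) hcl).trans ?_
    · have hps : p ∈ e.source := by
        by_contra h; simp [ψ, h] at hp
      have : e p ∈ B := by
        by_contra h; simp [ψ, hps, hgB _ h] at hp
      exact ⟨e p, this, e.left_inv hps⟩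
    · rintro _ ⟨y, hy, rfl⟩; exact e.map_target (hBe hy)
  have hs : ContMDiffOn (𝓡 2) ((𝓡 2).prod 𝓘(ℝ, Plane)) (r : WithTop ℕ∞)
      (fun p => (⟨p, s p⟩ : TangentBundle (𝓡 2) M)) e.source := by
    have h2 : ContMDiffOn (𝓡 2) (𝓡 2) ∞ e.symm e.target := contMDiffOn_symm_of_mem_maximalAtlas he
    have h3 := h2.contMDiffOn_tangentMapWithin (m := ∞) le_rfl e.open_target.uniqueMDiffOn
    have h4 : ContMDiff (𝓡 2) ((𝓡 2).prod 𝓘(ℝ, Plane)) ∞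
        (fun y : Plane => (⟨y, w⟩ : TangentBundle (𝓡 2) Plane)) := by
      have := (contMDiff_vectorSpace_iff_contDiff (𝕜 := ℝ) (E := Plane) (n := ∞)
        (V := fun _ => w)).2 contDiff_const
      exact this
    have h5 := (h3.comp h4.contMDiffOn (s := e.target) (fun y hy => hy)).comp
      (contMDiffOn_of_mem_maximalAtlas he) (fun p hp => e.map_source hp)
    refine (h5.of_le (by exact_mod_cast le_top)).congr fun p hp => ?_
    simp only [Function.comp, tangentMapWithin, s]
    rw [mfderivWithin_of_isOpen e.open_target (e.map_source hp)]
    have key : ∀ q (hq : q = p) (v : Plane), (⟨p, v⟩ : TangentBundle (𝓡 2) M) = ⟨q, v⟩ := by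
      rintro q rfl v; rfl
    exact key _ (e.left_inv hp) _
  refine ⟨⟨fun p => ψ p • s p, ContMDiffOn.smul_section_of_tsupport hψ e.open_source hts hs⟩,
    ?_, ?_⟩
  · intro p hp
    change mfderiv (𝓡 2) (𝓡 2) e p (ψ p • s p) = g (e p) • w
    rw [map_smul]
    have := mfderiv_chart_comp_symm he hp w
    simp only [ψ, hp, if_true, s]
    exact congrArg _ this
  · intro p hp
    change ψ p • s p = 0
    simp [ψ, hp]

/-- In any chart, the derivatives of a chart field `g • w` are controlled by those of `g`. -/
lemma exists_bound_inChart [T2Space M] {φ e : OpenPartialHomeomorph M Plane}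
    (hφ : φ ∈ IsManifold.maximalAtlas (𝓡 2) ∞ M) (he : e ∈ IsManifold.maximalAtlas (𝓡 2) ∞ M)
    {B : Set Plane} (hB : IsCompact B) (hBφ : B ⊆ φ.target) {K : Set M} (hK : IsCompact K)
    (hKe : K ⊆ e.source) (w : Plane) (m : ℕ) :
    ∃ C : ℝ, 0 ≤ C ∧ ∀ (g : Plane → ℝ) (Y : VField M r) (δ : ℝ), ContDiff ℝ ∞ g →
      (∀ x ∉ B, g x = 0) → IsChartField Y φ (fun x => g x • w) →
      (∀ l ≤ m, ∀ x, ‖iteratedFDeriv ℝ l g x‖ ≤ δ) →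
      ∀ p ∈ K, ‖iteratedFDeriv ℝ m (Y.inChart e) (e p)‖ ≤ C * δ := by
  have hcl : IsClosed (φ.symm '' B) :=
    (hB.image_of_continuousOn (φ.continuousOn_symm.mono hBφ)).isClosed
  have hBs : φ.symm '' B ⊆ φ.source := by
    rintro _ ⟨y, hy, rfl⟩; exact φ.map_target (hBφ hy)
  set O : Set Plane := (e.symm.trans φ).source with hOdef
  have hO : IsOpen O := (e.symm.trans φ).open_source
  have hOe : ∀ y ∈ O, y ∈ e.target ∧ e.symm y ∈ φ.source := fun y hy => by
    simpa [hOdef] using hy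
  set θ : Plane → Plane := φ ∘ e.symm
  have hθ : ContDiffOn ℝ ∞ θ O := by
    have h1 : ContMDiffOn (𝓡 2) (𝓡 2) ∞ θ O :=
      (contMDiffOn_of_mem_maximalAtlas hφ).comp ((contMDiffOn_symm_of_mem_maximalAtlas he).mono
        fun y hy => (hOe y hy).1) (fun y hy => (hOe y hy).2)
    exact h1.contDiffOn
  set O' : Set Plane := (φ.symm.trans e).source with hO'def
  have hO' : IsOpen O' := (φ.symm.trans e).open_source
  have hO'e : ∀ y, y ∈ O' ↔ y ∈ φ.target ∧ φ.symm y ∈ e.source := fun y => by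
    simp [hO'def]
  set η : Plane → Plane := e ∘ φ.symm
  have hη : ContDiffOn ℝ ∞ η O' := by
    have h1 : ContMDiffOn (𝓡 2) (𝓡 2) ∞ η O' :=
      (contMDiffOn_of_mem_maximalAtlas he).comp ((contMDiffOn_symm_of_mem_maximalAtlas hφ).mono
        fun y hy => ((hO'e y).1 hy).1) (fun y hy => ((hO'e y).1 hy).2)
    exact h1.contDiffOn
  have hmaps : MapsTo θ O O' := fun y hy => by
    obtain ⟨h1, h2⟩ := hOe y hy
    rw [hO'e]
    refine ⟨φ.map_source h2, ?_⟩
    simp only [θ, Function.comp, φ.left_inv h2]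
    exact e.map_target h1
  -- on `O` the field reads `g (θ y) • A y`, with `θ` and `A` depending only on the charts
  set A : Plane → Plane := fun y => fderiv ℝ η (θ y) w
  have hA : ContDiffOn ℝ ∞ A O := by
    have h1 : ContDiffOn ℝ ∞ (fun y => fderiv ℝ η (θ y)) O :=
      (hη.fderiv_of_isOpen (m := ∞) hO' le_rfl).comp hθ hmaps
    exact h1.clm_apply contDiffOn_const
  -- only the compact part `K0` of `O` matters, because the field vanishes elsewhere on `K`
  set K0 : Set Plane := e '' (K ∩ φ.symm '' B)
  have hK0 : IsCompact K0 := (hK.inter_right hcl).image_of_continuousOn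
    (e.continuousOn.mono (inter_subset_left.trans hKe))
  have hK0O : K0 ⊆ O := by
    rintro _ ⟨p, ⟨hpK, hpB⟩, rfl⟩
    have h1 := hKe hpK
    simp only [hOdef, OpenPartialHomeomorph.trans_source, OpenPartialHomeomorph.symm_source,
      mem_inter_iff, mem_preimage]
    exact ⟨e.map_source h1, by rw [e.left_inv h1]; exact hBs hpB⟩
  have hbd : ∀ f : Plane → Plane, ContDiffOn ℝ ∞ f O →
      ∃ D : ℝ, 1 ≤ D ∧ ∀ i ≤ m, ∀ y ∈ K0, ‖iteratedFDerivWithin ℝ i f O y‖ ≤ D := by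
    intro f hf
    have : ∀ i, ∃ D : ℝ, ∀ y ∈ K0, ‖iteratedFDerivWithin ℝ i f O y‖ ≤ D := fun i =>
      hK0.exists_bound_of_continuousOn ((hf.continuousOn_iteratedFDerivWithin
        (by exact_mod_cast le_top) hO.uniqueDiffOn).mono hK0O)
    choose D hD using this
    refine ⟨1 + ∑ i ∈ Finset.range (m + 1), |D i|, ?_, fun i hi y hy => ?_⟩
    · have : 0 ≤ ∑ i ∈ Finset.range (m + 1), |D i| := Finset.sum_nonneg fun _ _ => abs_nonneg _
      linarith
    · have h1 := Finset.single_le_sum (f := fun i => |D i|) (fun _ _ => abs_nonneg _)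
        (Finset.mem_range.2 (Nat.lt_succ_of_le hi))
      have h2 := hD i y hy
      have h3 := le_abs_self (D i)
      linarith
  obtain ⟨D, hD1, hD⟩ := hbd θ hθ
  obtain ⟨D', hD'1, hD'⟩ := hbd A hA
  refine ⟨∑ i ∈ Finset.range (m + 1), (m.choose i : ℝ) * ((i.factorial : ℝ) * D ^ i) * D',
    Finset.sum_nonneg fun i _ => by positivity, ?_⟩
  intro g Y δ hg hgB hY hgδ p hp
  have hδ : 0 ≤ δ := (norm_nonneg _).trans (hgδ 0 (Nat.zero_le _) 0)
  have hpe := hKe hp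
  by_cases hpB : p ∈ φ.symm '' B
  · have hyK0 : e p ∈ K0 := ⟨p, ⟨hp, hpB⟩, rfl⟩
    have hyO : e p ∈ O := hK0O hyK0
    have heq : EqOn (Y.inChart e) (fun y => (g ∘ θ) y • A y) O := by
      intro y hy
      obtain ⟨h1, h2⟩ := hOe y hy
      set q := e.symm y with hq
      have hηq : DifferentiableAt ℝ η (φ q) :=
        ((hη.contDiffAt (hO'.mem_nhds (hmaps hy))).differentiableAt (by simp))
      have hcomp := mfderiv_comp_apply (I := 𝓡 2) (I' := 𝓡 2) (I'' := 𝓡 2) q (g := η) (f := φ)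
        hηq.mdifferentiableAt (mdifferentiableAt_chart hφ h2) (Y q)
      have hev : (η ∘ φ : M → Plane) =ᶠ[𝓝 q] e := by
        filter_upwards [φ.open_source.mem_nhds h2] with z hz
        simp [η, φ.left_inv hz]
      rw [hev.mfderiv_eq] at hcomp
      change mfderiv (𝓡 2) (𝓡 2) e q (Y q) = _
      refine hcomp.trans ?_
      have h3 := hY.1 q h2
      refine (congrArg (mfderiv (𝓡 2) (𝓡 2) η (φ q)) h3).trans ?_
      rw [mfderiv_eq_fderiv]
      exact map_smul _ _ _
    have h1 : iteratedFDeriv ℝ m (Y.inChart e) (e p) =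
        iteratedFDerivWithin ℝ m (fun y => (g ∘ θ) y • A y) O (e p) := by
      rw [← iteratedFDerivWithin_of_isOpen m hO hyO]
      exact iteratedFDerivWithin_congr heq hyO m
    rw [h1]
    have hgθ : ContDiffOn ℝ ∞ (g ∘ θ) O := hg.comp_contDiffOn hθ
    refine (norm_iteratedFDerivWithin_smul_le hgθ hA hO.uniqueDiffOn hyO
      (n := m) (by exact_mod_cast le_top)).trans ?_
    rw [Finset.sum_mul]
    refine Finset.sum_le_sum fun i hi => ?_
    have him : i ≤ m := Nat.lt_succ_iff.1 (Finset.mem_range.1 hi)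
    have hc : ‖iteratedFDerivWithin ℝ i (g ∘ θ) O (e p)‖ ≤ i.factorial * δ * D ^ i := by
      refine norm_iteratedFDerivWithin_comp_le (t := univ) hg.contDiffOn hθ
        (N := ∞) (by exact_mod_cast le_top) uniqueDiffOn_univ hO.uniqueDiffOn (mapsTo_univ _ _) hyO
        (fun j hj => ?_) (fun j hj1 hj => ?_)
      · rw [iteratedFDerivWithin_univ]
        exact hgδ j (hj.trans him) _
      · exact (hD j (hj.trans him) _ hyK0).trans (le_self_pow₀ hD1 (by omega))
    have hc' := hD' (m - i) (Nat.sub_le _ _) _ hyK0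
    calc _ ≤ (m.choose i : ℝ) * (i.factorial * δ * D ^ i) * D' := by gcongr
      _ = _ := by ring
  · have hz : Y.inChart e =ᶠ[𝓝 (e p)] fun _ => 0 := by
      have hop : IsOpen (e.target ∩ e.symm ⁻¹' (φ.symm '' B)ᶜ) :=
        e.isOpen_inter_preimage_symm hcl.isOpen_compl
      filter_upwards [hop.mem_nhds ⟨e.map_source hpe, by simpa [e.left_inv hpe] using hpB⟩]
        with y hy
      have hY0 : Y (e.symm y) = 0 := by
        by_cases hs : e.symm y ∈ φ.source
        · have h1 := hY.1 _ hs
          have h2 : g (φ (e.symm y)) = 0 := hgB _ fun h => hy.2 ⟨_, h, φ.left_inv hs⟩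
          have h3 := mfderiv_symm_comp_chart hφ hs (Y (e.symm y))
          rw [h1] at h3
          rw [← h3]
          simp only [h2, zero_smul]
          exact map_zero _
        · exact hY.2 _ hs
      change mfderiv (𝓡 2) (𝓡 2) e (e.symm y) (Y (e.symm y)) = 0
      rw [hY0, map_zero]
    rw [(Filter.EventuallyEq.iteratedFDeriv ℝ hz m).eq_of_nhds, iteratedFDeriv_fun_zero]
    simp only [Pi.zero_apply, norm_zero]
    exact mul_nonneg (Finset.sum_nonneg fun i _ => by positivity) hδ

end VField

/-! ### Integral curves: velocity in a chart and uniqueness -/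

section Real

lemma norm_sub_le_of_hasDerivAt_Ioo {E : Type*} [NormedAddCommGroup E] [NormedSpace ℝ E]
    {f f' : ℝ → E} {a b C : ℝ} (hab : a ≤ b) (hf : ContinuousOn f (Icc a b))
    (hd : ∀ t ∈ Ioo a b, HasDerivAt f (f' t) t) (hC : ∀ t ∈ Ioo a b, ‖f' t‖ ≤ C) :
    ‖f b - f a‖ ≤ C * (b - a) := by
  rcases hab.eq_or_lt with rfl | hab
  · simp
  have h1 : ∀ s ∈ Ioo a b, ‖f b - f s‖ ≤ C * (b - s) := by
    intro s hs
    refine norm_image_sub_le_of_norm_deriv_right_le_segment (f' := f') (a := s) (b := b)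
      (hf.mono (Icc_subset_Icc_left hs.1.le)) (fun x hx => ?_) (fun x hx => ?_) b
      (right_mem_Icc.2 hs.2.le)
    · exact (hd x ⟨hs.1.trans_le hx.1, hx.2⟩).hasDerivWithinAt
    · exact hC x ⟨hs.1.trans_le hx.1, hx.2⟩
  have hcl : a ∈ closure (Ioo a b) := by rw [closure_Ioo hab.ne]; exact left_mem_Icc.2 hab.le
  refine ContinuousWithinAt.closure_le (s := Ioo a b) hcl ?_ ?_ h1
  · exact (continuousWithinAt_const.sub
      ((hf a (left_mem_Icc.2 hab.le)).mono Ioo_subset_Icc_self)).norm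
  · exact (by fun_prop : Continuous fun s => C * (b - s)).continuousWithinAt

/-- A curve that starts in an open set and cannot be at the boundary of it when it first leaves it
stays in it. -/
lemma mem_of_forall_not_exit {M : Type*} [TopologicalSpace M] {O : Set M} (hO : IsOpen O)
    {c : ℝ → M}
    {a b : ℝ} (hc : ContinuousOn c (Icc a b)) (ha : c a ∈ O)
    (h : ∀ t ∈ Ioc a b, (∀ s ∈ Ico a t, c s ∈ O) → c t ∈ O) : ∀ t ∈ Icc a b, c t ∈ O := by
  by_contra! hne
  obtain ⟨t0, ht0, hct0⟩ := hne
  have hcl : IsClosed (Icc a b ∩ c ⁻¹' Oᶜ) := hc.preimage_isClosed_of_isClosed isClosed_Icc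
    hO.isClosed_compl
  have hcomp : IsCompact (Icc a b ∩ c ⁻¹' Oᶜ) := isCompact_Icc.of_isClosed_subset hcl
    inter_subset_left
  obtain ⟨t, ⟨htI, htO⟩, htmin⟩ := hcomp.exists_isLeast ⟨t0, ht0, hct0⟩
  have hat : a < t := htI.1.lt_of_ne (by rintro rfl; exact htO ha)
  refine htO (h t ⟨hat, htI.2⟩ fun s hs => ?_)
  by_contra hsO
  exact (htmin ⟨⟨hs.1, hs.2.le.trans htI.2⟩, hsO⟩).not_gt hs.2

lemma comp_smulRight_one {E F : Type*} [NormedAddCommGroup E] [NormedSpace ℝ E]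
    [NormedAddCommGroup F] [NormedSpace ℝ F] (L : E →L[ℝ] F) (v : E) :
    L.comp ((1 : ℝ →L[ℝ] ℝ).smulRight v) = (1 : ℝ →L[ℝ] ℝ).smulRight (L v) := by
  ext; simp

lemma hasDerivAt_of_hasFDerivAt_comp_smulRight {E F : Type*} [NormedAddCommGroup E]
    [NormedSpace ℝ E] [NormedAddCommGroup F] [NormedSpace ℝ F] {L : E →L[ℝ] F} {v : E}
    {f : ℝ → F} {t : ℝ} (h : HasFDerivAt f (L.comp ((1 : ℝ →L[ℝ] ℝ).smulRight v)) t) :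
    HasDerivAt f (L v) t := by
  rw [comp_smulRight_one] at h
  simpa using h.hasDerivAt

end Real

namespace VField

variable {M : Type*} [TopologicalSpace M] [ChartedSpace Plane M] [IsManifold (𝓡 2) ∞ M] {r : ℕ∞}

lemma inChart_apply (X : VField M r) {e : OpenPartialHomeomorph M Plane} {p : M}
    (hp : p ∈ e.source) : X.inChart e (e p) = mfderiv (𝓡 2) (𝓡 2) e p (X p) := by
  simp only [inChart]
  have key : ∀ q (hq : q = p), (mfderiv (𝓡 2) (𝓡 2) e q (X q) : Plane) =
      mfderiv (𝓡 2) (𝓡 2) e p (X p) := by rintro q rfl; rfl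
  exact key _ (e.left_inv hp)

lemma IsChartField.inChart_eq {Y : VField M r} {e : OpenPartialHomeomorph M Plane}
    {G : Plane → Plane} (h : IsChartField Y e G) {y : Plane} (hy : y ∈ e.target) :
    Y.inChart e y = G y := by
  have := h.1 _ (e.map_target hy)
  rw [e.right_inv hy] at this
  exact this

lemma contMDiff_one (X : VField M r) (hr : 1 ≤ r) :
    ContMDiff (𝓡 2) (𝓡 2).tangent 1 (fun p => (⟨p, X p⟩ : TangentBundle (𝓡 2) M)) :=
  X.contMDiff.of_le (by exact_mod_cast hr)

/-- The velocity of a curve, seen in a chart. -/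
lemma hasDerivAt_chart {e : OpenPartialHomeomorph M Plane}
    (he : e ∈ IsManifold.maximalAtlas (𝓡 2) ∞ M) {c : ℝ → M} {t : ℝ} {X : VField M r}
    (hc : HasMFDerivAt 𝓘(ℝ, ℝ) (𝓡 2) c t ((1 : ℝ →L[ℝ] ℝ).smulRight (X (c t))))
    (ht : c t ∈ e.source) : HasDerivAt (e ∘ c) (X.inChart e (e (c t))) t := by
  have h1 := (mdifferentiableAt_chart he ht).hasMFDerivAt.comp t hc
  rw [inChart_apply X ht]
  exact hasDerivAt_of_hasFDerivAt_comp_smulRight (E := Plane) (F := Plane)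
    (L := mfderiv (𝓡 2) (𝓡 2) e (c t)) (v := X (c t)) h1.hasFDerivAt

lemma hasMFDerivAt_of_chart {e : OpenPartialHomeomorph M Plane}
    (he : e ∈ IsManifold.maximalAtlas (𝓡 2) ∞ M) {c : ℝ → M} {t : ℝ} {X : VField M r}
    (hct : ContinuousAt c t) (ht : c t ∈ e.source)
    (hd : HasDerivAt (e ∘ c) (X.inChart e (e (c t))) t) :
    HasMFDerivAt 𝓘(ℝ, ℝ) (𝓡 2) c t ((1 : ℝ →L[ℝ] ℝ).smulRight (X (c t))) := by
  have h1 : HasMFDerivAt 𝓘(ℝ, ℝ) (𝓡 2) (e ∘ c) t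
      ((1 : ℝ →L[ℝ] ℝ).smulRight (X.inChart e (e (c t)))) := hd.hasFDerivAt.hasMFDerivAt
  have h2 := (mdifferentiableAt_chart_symm he (e.map_source ht)).hasMFDerivAt.comp t h1
  have hev : (e.symm ∘ (e ∘ c)) =ᶠ[𝓝 t] c := by
    filter_upwards [hct.preimage_mem_nhds (e.open_source.mem_nhds ht)] with s hs
    exact e.left_inv hs
  have h3 := h2.congr_of_eventuallyEq hev.symm
  refine h3.congr_mfderiv ?_
  have h4 : (mfderiv (𝓡 2) (𝓡 2) e.symm (e (c t)) : Plane →L[ℝ] Plane)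
      (X.inChart e (e (c t))) = (X (c t) : Plane) := by
    rw [inChart_apply X ht]
    exact mfderiv_symm_comp_chart he ht _
  exact (comp_smulRight_one (E := Plane) (F := Plane)
    (mfderiv (𝓡 2) (𝓡 2) e.symm (e (c t))) _).trans
    (congrArg (fun v : Plane => (1 : ℝ →L[ℝ] ℝ).smulRight v) h4)

/-- A continuous curve that is an integral curve on both sides of a time is one at that time. -/
lemma hasMFDerivAt_of_punctured (X : VField M r) {c : ℝ → M} {a : ℝ}
    (hca : ContinuousAt c a) (hd : ∀ᶠ t in 𝓝[≠] a,
      HasMFDerivAt 𝓘(ℝ, ℝ) (𝓡 2) c t ((1 : ℝ →L[ℝ] ℝ).smulRight (X (c t)))) :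
    HasMFDerivAt 𝓘(ℝ, ℝ) (𝓡 2) c a ((1 : ℝ →L[ℝ] ℝ).smulRight (X (c a))) := by
  set e := chartAt Plane (c a)
  have he : e ∈ IsManifold.maximalAtlas (𝓡 2) ∞ M := IsManifold.chart_mem_maximalAtlas _
  have hs : c a ∈ e.source := mem_chart_source _ _
  refine hasMFDerivAt_of_chart he hca hs ?_
  have hsrc : ∀ᶠ t in 𝓝 a, c t ∈ e.source := hca.preimage_mem_nhds (e.open_source.mem_nhds hs)
  have hcont : ContinuousAt (fun t => X.inChart e (e (c t))) a := by
    have h1 : ContinuousAt (X.inChart e) (e (c a)) :=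
      (X.contDiffOn_inChart he).continuousOn.continuousAt
        (e.open_target.mem_nhds (e.map_source hs))
    exact h1.comp (f := fun t => e (c t)) ((e.continuousAt hs).comp hca)
  have hd' : ∀ᶠ t in 𝓝[≠] a, HasDerivAt (e ∘ c) (X.inChart e (e (c t))) t := by
    filter_upwards [hd, hsrc.filter_mono nhdsWithin_le_nhds] with t h1 h2
    exact hasDerivAt_chart he h1 h2
  obtain ⟨δ, hδ, hδd⟩ := Metric.mem_nhdsWithin_iff.1 hd'
  have hIoo : Ioo (a - δ) (a + δ) = Metric.ball a δ := (Real.ball_eq_Ioo a δ).symm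
  rw [hasDerivAt_iff_hasFDerivAt, ← hasFDerivWithinAt_univ]
  have hl : HasDerivWithinAt (e ∘ c) (X.inChart e (e (c a))) (Iic a) a := by
    refine hasDerivWithinAt_Iic_of_tendsto_deriv (s := Ioo (a - δ) a) (fun t ht => ?_)
      ((e.continuousAt hs).comp hca).continuousWithinAt (Ioo_mem_nhdsLT (by linarith)) ?_
    · exact (hδd ⟨by rw [← hIoo]; exact ⟨ht.1, by linarith [ht.2]⟩,
        ht.2.ne⟩).differentiableAt.differentiableWithinAt
    · refine (hcont.tendsto.mono_left nhdsWithin_le_nhds).congr' ?_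
      filter_upwards [Ioo_mem_nhdsLT (show a - δ < a by linarith)] with t ht
      exact (hδd ⟨by rw [← hIoo]; exact ⟨ht.1, by linarith [ht.2]⟩, ht.2.ne⟩).deriv.symm
  have hr : HasDerivWithinAt (e ∘ c) (X.inChart e (e (c a))) (Ici a) a := by
    refine hasDerivWithinAt_Ici_of_tendsto_deriv (s := Ioo a (a + δ)) (fun t ht => ?_)
      ((e.continuousAt hs).comp hca).continuousWithinAt (Ioo_mem_nhdsGT (by linarith)) ?_
    · exact (hδd ⟨by rw [← hIoo]; exact ⟨by linarith [ht.1], ht.2⟩,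
        ht.1.ne'⟩).differentiableAt.differentiableWithinAt
    · refine (hcont.tendsto.mono_left nhdsWithin_le_nhds).congr' ?_
      filter_upwards [Ioo_mem_nhdsGT (show a < a + δ by linarith)] with t ht
      exact (hδd ⟨by rw [← hIoo]; exact ⟨by linarith [ht.1], ht.2⟩, ht.1.ne'⟩).deriv.symm
  have := hl.union hr
  rw [Iic_union_Ici] at this
  exact this

lemma hasMFDerivAt_of_isMIntegralCurveOn {X : VField M r} {c : ℝ → M} {a b t : ℝ}
    (hc : IsMIntegralCurveOn c (fun p => X p) (Ioo a b)) (ht : t ∈ Ioo a b) :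
    HasMFDerivAt 𝓘(ℝ, ℝ) (𝓡 2) c t ((1 : ℝ →L[ℝ] ℝ).smulRight (X (c t))) :=
  (hc t ht).hasMFDerivAt (Ioo_mem_nhds ht.1 ht.2)

lemma isMIntegralCurveOn_Ioo_iff {X : VField M r} {c : ℝ → M} {a b : ℝ} :
    IsMIntegralCurveOn c (fun p => X p) (Ioo a b) ↔ ∀ t ∈ Ioo a b,
      HasMFDerivAt 𝓘(ℝ, ℝ) (𝓡 2) c t ((1 : ℝ →L[ℝ] ℝ).smulRight (X (c t))) :=
  ⟨fun h _ ht => hasMFDerivAt_of_isMIntegralCurveOn h ht,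
    fun h t ht => (h t ht).hasMFDerivWithinAt⟩

/-- Two integral curves that agree at the initial time agree. -/
lemma eqOn_Icc_of_left [T2Space M] (hr : 1 ≤ r) {X : VField M r} {c d : ℝ → M} {a b : ℝ}
    (hcc : ContinuousOn c (Icc a b)) (hdc : ContinuousOn d (Icc a b))
    (hc : IsMIntegralCurveOn c (fun p => X p) (Ioo a b))
    (hd : IsMIntegralCurveOn d (fun p => X p) (Ioo a b)) (h : c a = d a) :
    EqOn c d (Icc a b) := by
  rcases lt_or_ge a b with hab | hab
  swap
  · intro t ht
    have : t = a := le_antisymm (ht.2.trans hab) ht.1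
    rw [this, h]
  obtain ⟨g, hga, hg⟩ := exists_isMIntegralCurveAt_of_contMDiffAt_boundaryless (t₀ := a)
    (X.contMDiff_one hr (c a))
  obtain ⟨ε, hε, hg⟩ := isMIntegralCurveAt_iff'.1 hg
  rw [Real.ball_eq_Ioo] at hg
  -- extend both curves to the left of `a` by the same integral curve
  have ext : ∀ f : ℝ → M, ContinuousOn f (Icc a b) → IsMIntegralCurveOn f (fun p => X p) (Ioo a b) →
      f a = c a → IsMIntegralCurveOn (fun t => if t ≤ a then g t else f t) (fun p => X p)
        (Ioo (a - ε) b) := by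
    intro f hfc hf hfa
    have hleft : ∀ t, t ≤ a → (fun t => if t ≤ a then g t else f t) t = g t := fun t ht => by
      simp [ht]
    have hright : ∀ t, a ≤ t → (fun t => if t ≤ a then g t else f t) t = f t := fun t ht => by
      rcases ht.eq_or_lt with rfl | h'
      · simp [hga, hfa]
      · simp [h'.not_ge]
    rw [isMIntegralCurveOn_Ioo_iff]
    have hne : ∀ t ∈ Ioo (a - ε) b, t ≠ a → HasMFDerivAt 𝓘(ℝ, ℝ) (𝓡 2)
        (fun t => if t ≤ a then g t else f t) t ((1 : ℝ →L[ℝ] ℝ).smulRight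
        (X ((fun t => if t ≤ a then g t else f t) t))) := by
      intro t ht hta
      rcases lt_or_gt_of_ne hta with h1 | h1
      · have h2 := hasMFDerivAt_of_isMIntegralCurveOn hg (t := t) ⟨ht.1, by linarith⟩
        have hev : (fun t => if t ≤ a then g t else f t) =ᶠ[𝓝 t] g := by
          filter_upwards [Iio_mem_nhds h1] with s hs using hleft s (le_of_lt hs)
        rw [hleft t h1.le]
        exact h2.congr_of_eventuallyEq hev
      · have h2 := hasMFDerivAt_of_isMIntegralCurveOn hf (t := t) ⟨h1, ht.2⟩
        have hev : (fun t => if t ≤ a then g t else f t) =ᶠ[𝓝 t] f := by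
          filter_upwards [Ioi_mem_nhds h1] with s hs using hright s (le_of_lt hs)
        rw [hright t h1.le]
        exact h2.congr_of_eventuallyEq hev
    intro t ht
    rcases eq_or_ne t a with rfl | hta
    swap
    · exact hne t ht hta
    refine hasMFDerivAt_of_punctured X ?_ ?_
    · rw [continuousAt_iff_continuous_left_right]
      constructor
      · refine ContinuousWithinAt.congr (f := g) ?_ (fun s hs => hleft s hs) (hleft t le_rfl)
        exact (hasMFDerivAt_of_isMIntegralCurveOn hg (t := t)
          ⟨by linarith, by linarith⟩).continuousAt.continuousWithinAt
      · refine ContinuousWithinAt.congr (f := f) ?_ (fun s hs => hright s hs) (hright t le_rfl)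
        exact (hfc t ⟨le_rfl, hab.le⟩).mono_of_mem_nhdsWithin (Icc_mem_nhdsGE hab)
    · filter_upwards [nhdsWithin_le_nhds (Ioo_mem_nhds ht.1 ht.2), self_mem_nhdsWithin]
      with s hs hs'
      exact hne s hs hs'
  have h1 := isMIntegralCurveOn_Ioo_eqOn_of_contMDiff_boundaryless (t₀ := a)
    ⟨by linarith, hab⟩ (X.contMDiff_one hr) (ext c hcc hc rfl) (ext d hdc hd h.symm) (by simp)
  have h2 : EqOn c d (Ioo a b) := by
    intro t ht
    have := h1 ⟨by linarith [ht.1], ht.2⟩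
    simpa [ht.1.not_ge] using this
  have h3 := h2.of_subset_closure hcc hdc Ioo_subset_Icc_self (by rw [closure_Ioo hab.ne])
  exact h3

end VField

/-! ### Integral curves: derivatives along them and local existence -/

namespace VField

variable {M : Type*} [TopologicalSpace M] [ChartedSpace Plane M] [IsManifold (𝓡 2) ∞ M] {r : ℕ∞}

lemma isMIntegralCurveOn_comp_add {X : VField M r} {c : ℝ → M} {a b : ℝ}
    (hc : IsMIntegralCurveOn c (fun p => X p) (Ioo a b)) (s : ℝ) :
    IsMIntegralCurveOn (fun t => c (t + s)) (fun p => X p) (Ioo (a - s) (b - s)) := by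
  refine (hc.comp_add s).mono fun t ht => ?_
  exact ⟨by linarith [ht.1], by linarith [ht.2]⟩

/-- Two integral curves that agree at the final time agree. -/
lemma eqOn_Icc_of_right [T2Space M] (hr : 1 ≤ r) {X : VField M r} {c d : ℝ → M} {a b : ℝ}
    (hcc : ContinuousOn c (Icc a b)) (hdc : ContinuousOn d (Icc a b))
    (hc : IsMIntegralCurveOn c (fun p => X p) (Ioo a b))
    (hd : IsMIntegralCurveOn d (fun p => X p) (Ioo a b)) (h : c b = d b) :
    EqOn c d (Icc a b) := by
  have hm : MapsTo (fun t : ℝ => t * (-1)) (Icc (-b) (-a)) (Icc a b) := fun t ht =>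
    ⟨by linarith [ht.2], by linarith [ht.1]⟩
  have hrev : ∀ f : ℝ → M, IsMIntegralCurveOn f (fun p => X p) (Ioo a b) →
      IsMIntegralCurveOn (f ∘ (fun t => t * (-1))) (fun p => ((-1 : ℝ) • X) p)
        (Ioo (-b) (-a)) := by
    intro f hf
    have h1 := (hf.comp_mul (-1)).mono (s' := Ioo (-b) (-a)) (fun t ht => by
      show t * (-1) ∈ Ioo a b
      exact ⟨by linarith [ht.2], by linarith [ht.1]⟩)
    exact h1
  have hcm : ContinuousOn (fun t : ℝ => t * (-1)) (Icc (-b) (-a)) := by fun_prop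
  have := eqOn_Icc_of_left hr (hcc.comp hcm hm) (hdc.comp hcm hm) (hrev c hc) (hrev d hd)
    (by simpa using h)
  intro t ht
  have h2 := this (x := -t) ⟨by linarith [ht.2], by linarith [ht.1]⟩
  simpa using h2

/-- The derivative of a function along a curve. -/
lemma hasDerivAt_comp {f : M → ℝ} {c : ℝ → M} {t : ℝ} {v : TangentSpace (𝓡 2) (c t)}
    (hf : MDifferentiableAt (𝓡 2) 𝓘(ℝ, ℝ) f (c t))
    (hc : HasMFDerivAt 𝓘(ℝ, ℝ) (𝓡 2) c t ((1 : ℝ →L[ℝ] ℝ).smulRight v)) :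
    HasDerivAt (f ∘ c) (mfderiv (𝓡 2) 𝓘(ℝ, ℝ) f (c t) v) t :=
  hasDerivAt_of_hasFDerivAt_comp_smulRight (E := Plane) (F := ℝ)
    (L := mfderiv (𝓡 2) 𝓘(ℝ, ℝ) f (c t)) (v := v) (hf.hasMFDerivAt.comp t hc).hasFDerivAt

/-- The derivative of a function on the surface in the direction of a field, computed in a chart. -/
lemma mfderiv_apply_eq_fderiv {e : OpenPartialHomeomorph M Plane}
    (he : e ∈ IsManifold.maximalAtlas (𝓡 2) ∞ M) {f : M → ℝ} {p : M}
    (hf : MDifferentiableAt (𝓡 2) 𝓘(ℝ, ℝ) f p) (hp : p ∈ e.source) (v : TangentSpace (𝓡 2) p) :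
    mfderiv (𝓡 2) 𝓘(ℝ, ℝ) f p v =
      fderiv ℝ (f ∘ e.symm) (e p) (mfderiv (𝓡 2) (𝓡 2) e p v : Plane) := by
  have h1 : MDifferentiableAt (𝓡 2) 𝓘(ℝ, ℝ) (f ∘ e.symm) (e p) := by
    refine MDifferentiableAt.comp (I' := 𝓡 2) (e p) ?_
      (mdifferentiableAt_chart_symm he (e.map_source hp))
    rw [e.left_inv hp]; exact hf
  have h2 := mfderiv_comp_apply (I := 𝓡 2) (I' := 𝓡 2) (I'' := 𝓘(ℝ, ℝ)) p h1
    (mdifferentiableAt_chart he hp) v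
  have hev : ((f ∘ e.symm) ∘ e : M → ℝ) =ᶠ[𝓝 p] f := by
    filter_upwards [e.open_source.mem_nhds hp] with q hq
    simp [e.left_inv hq]
  rw [hev.mfderiv_eq] at h2
  refine h2.trans ?_
  rw [mfderiv_eq_fderiv]
  rfl

/-- A curve whose speed in a chart is at most `C` as long as it stays in a ball of the chart stays
in that ball for some time. -/
lemma mem_box_of_speed_le [T2Space M] {e : OpenPartialHomeomorph M Plane} {c : ℝ → M}
    {v : ℝ → Plane} {a b C R : ℝ} {y₀ : Plane} (hB : Metric.closedBall y₀ R ⊆ e.target)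
    (hc : ContinuousOn c (Icc a b)) (ha : c a ∈ e.source)
    (hd : ∀ t ∈ Ioo a b, (∀ s ∈ Icc a t, c s ∈ e.source ∧ e (c s) ∈ Metric.ball y₀ R) →
      HasDerivAt (e ∘ c) (v t) t ∧ ‖v t‖ ≤ C)
    (hC : 0 ≤ C) (hR : C * (b - a) + dist (e (c a)) y₀ < R) :
    ∀ t ∈ Icc a b, c t ∈ e.source ∧ e (c t) ∈ Metric.ball y₀ R := by
  rcases lt_or_ge b a with hab | hab
  · intro t ht; exact absurd (ht.1.trans ht.2) hab.not_ge
  have hO : IsOpen (e.source ∩ e ⁻¹' Metric.ball y₀ R) := e.isOpen_inter_preimage Metric.isOpen_ball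
  have hK : IsClosed (e.symm '' Metric.closedBall y₀ R) :=
    ((isCompact_closedBall y₀ R).image_of_continuousOn (e.continuousOn_symm.mono hB)).isClosed
  refine mem_of_forall_not_exit hO hc ⟨ha, ?_⟩ fun t ht hst => ?_
  · rw [mem_preimage, Metric.mem_ball]
    have := mul_nonneg hC (sub_nonneg.2 hab)
    linarith
  have hsub : Icc a t ⊆ Icc a b := Icc_subset_Icc_right ht.2
  have htK : c t ∈ e.symm '' Metric.closedBall y₀ R := by
    have h1 : c t ∈ closure (c '' Ico a t) := by
      have h2 : t ∈ closure (Ico a t) := by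
        rw [closure_Ico ht.1.ne]; exact right_mem_Icc.2 ht.1.le
      exact ((hc t ⟨ht.1.le, ht.2⟩).mono (Ico_subset_Icc_self.trans hsub)).mem_closure_image h2
    refine hK.closure_subset_iff.2 ?_ h1
    rintro _ ⟨s, hs, rfl⟩
    exact ⟨e (c s), Metric.ball_subset_closedBall (hst s hs).2, e.left_inv (hst s hs).1⟩
  have htsrc : c t ∈ e.source := by
    obtain ⟨y, hy, hyc⟩ := htK
    rw [← hyc]; exact e.map_target (hB hy)
  have hmaps : MapsTo c (Icc a t) e.source := by
    intro s hs
    rcases hs.2.eq_or_lt with rfl | h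
    · exact htsrc
    · exact (hst s ⟨hs.1, h⟩).1
  have hcont : ContinuousOn (e ∘ c) (Icc a t) := e.continuousOn.comp (hc.mono hsub) hmaps
  have hder : ∀ s ∈ Ioo a t, HasDerivAt (e ∘ c) (v s) s ∧ ‖v s‖ ≤ C := fun s hs =>
    hd s ⟨hs.1, hs.2.trans_le ht.2⟩ fun x hx => hst x ⟨hx.1, hx.2.trans_lt hs.2⟩
  have hn := norm_sub_le_of_hasDerivAt_Ioo ht.1.le hcont (fun s hs => (hder s hs).1)
    (fun s hs => (hder s hs).2)
  refine ⟨htsrc, ?_⟩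
  rw [mem_preimage, Metric.mem_ball]
  have h3 : dist (e (c t)) (e (c a)) ≤ C * (t - a) := by rw [dist_eq_norm]; exact hn
  have h4 : C * (t - a) ≤ C * (b - a) := by
    have := ht.2
    gcongr
  linarith [dist_triangle (e (c t)) (e (c a)) y₀]

/-- Local existence of integral curves, with a uniform time and inside a given open set, for all
initial points near a given one. -/
lemma exists_isMIntegralCurveOn_uniform (hr : 1 ≤ r) (X : VField M r) (p₀ : M) {U : Set M}
    (hU : U ∈ 𝓝 p₀) :
    ∃ V ∈ 𝓝 p₀, ∃ h > (0 : ℝ), ∀ p ∈ V, ∃ d : ℝ → M, d 0 = p ∧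
      IsMIntegralCurveOn d (fun p => X p) (Ioo (-h) h) ∧ ∀ t ∈ Ioo (-h) h, d t ∈ U := by
  set e := chartAt Plane p₀
  have he : e ∈ IsManifold.maximalAtlas (𝓡 2) ∞ M := IsManifold.chart_mem_maximalAtlas _
  have hs : p₀ ∈ e.source := mem_chart_source _ _
  have hf : ContDiffAt ℝ 1 (X.inChart e) (e p₀) :=
    X.contDiffAt_inChart (m := 1) he (e.map_source hs) (by exact_mod_cast hr)
  obtain ⟨ε, hε, a, ρ, L, K, hρ, hpl⟩ := IsPicardLindelof.of_contDiffAt_one hf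
  obtain ⟨α, hα, hαc⟩ :=
    (hpl 0).exists_forall_mem_closedBall_eq_hasDerivWithinAt_continuousOn
  have h0 : α (e p₀, 0) = e p₀ := (hα (e p₀) (Metric.mem_closedBall_self ρ.2)).1
  have hnb : Metric.closedBall (e p₀) (ρ : ℝ) ×ˢ Icc (0 - ε) (0 + ε) ∈ 𝓝 (e p₀, (0 : ℝ)) :=
    prod_mem_nhds (Metric.closedBall_mem_nhds _ hρ) (Icc_mem_nhds (by linarith) (by linarith))
  have hca : ContinuousAt α (e p₀, 0) := hαc.continuousAt hnb
  have hT : e.target ∩ e.symm ⁻¹' U ∈ 𝓝 (α (e p₀, 0)) := by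
    rw [h0]
    exact inter_mem (e.open_target.mem_nhds (e.map_source hs))
      ((e.continuousAt_symm (e.map_source hs)).preimage_mem_nhds (by rwa [e.left_inv hs]))
  have hev := hca.preimage_mem_nhds hT
  rw [nhds_prod_eq] at hev
  obtain ⟨V, hV, W, hW, hVW⟩ := Filter.mem_prod_iff.1 hev
  obtain ⟨h, hh, hhW⟩ := Metric.mem_nhds_iff.1 hW
  rw [Real.ball_eq_Ioo] at hhW
  refine ⟨e.source ∩ e ⁻¹' (V ∩ Metric.closedBall (e p₀) ρ), ?_, min h ε, lt_min hh hε, ?_⟩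
  · exact inter_mem (e.open_source.mem_nhds hs) ((e.continuousAt hs).preimage_mem_nhds
      (inter_mem hV (Metric.closedBall_mem_nhds _ hρ)))
  rintro p ⟨hps, hpV, hpρ⟩
  obtain ⟨hα0, hαd⟩ := hα (e p) hpρ
  have hmem : ∀ t ∈ Ioo (-min h ε) (min h ε), α (e p, t) ∈ e.target ∩ e.symm ⁻¹' U := by
    intro t ht
    exact hVW (mk_mem_prod hpV (hhW ⟨by linarith [ht.1, min_le_left h ε],
      by linarith [ht.2, min_le_left h ε]⟩))
  refine ⟨fun t => e.symm (α (e p, t)), by simp [hα0, e.left_inv hps], ?_,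
    fun t ht => (hmem t ht).2⟩
  rw [isMIntegralCurveOn_Ioo_iff]
  intro t ht
  have htT := (hmem t ht).1
  have hder : HasDerivAt (fun t => α (e p, t)) (X.inChart e (α (e p, t))) t :=
    (hαd t ⟨by linarith [ht.1, min_le_right h ε], by linarith [ht.2, min_le_right h ε]⟩).hasDerivAt
      (Icc_mem_nhds (by linarith [ht.1, min_le_right h ε]) (by linarith [ht.2, min_le_right h ε]))
  refine hasMFDerivAt_of_chart he ?_ (e.map_target htT) ?_
  · exact ContinuousAt.comp (f := fun t => α (e p, t)) (e.continuousAt_symm htT) hder.continuousAt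
  · simp only [e.right_inv htT]
    refine hder.congr_of_eventuallyEq ?_
    filter_upwards [Ioo_mem_nhds ht.1 ht.2] with s hs
    simp [e.right_inv (hmem s hs).1]

end VField

/-! ### Straightening the switching curves -/

namespace Plane

/-- A nonzero linear form on the plane is the first coordinate of some linear coordinates. -/
lemma exists_equiv_of_surjective (L : Plane →L[ℝ] ℝ) (hL : Function.Surjective L) :
    ∃ A : Plane ≃L[ℝ] Plane, ∀ v, (A v) 0 = L v := by
  set a := L (EuclideanSpace.single 0 1)
  set b := L (EuclideanSpace.single 1 1)
  have hLv : ∀ v : Plane, L v = v 0 * a + v 1 * b := by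
    intro v
    have : v = v 0 • EuclideanSpace.single 0 (1 : ℝ) + v 1 • EuclideanSpace.single 1 (1 : ℝ) := by
      ext i; fin_cases i <;> simp
    conv_lhs => rw [this]
    simp [a, b]
  have hab : 0 < a ^ 2 + b ^ 2 := by
    obtain ⟨v, hv⟩ := hL 1
    rw [hLv] at hv
    by_contra h
    have ha : a = 0 := by nlinarith [sq_nonneg a, sq_nonneg b]
    have hb : b = 0 := by nlinarith [sq_nonneg a, sq_nonneg b]
    simp [ha, hb] at hv
  let f : Plane →ₗ[ℝ] Plane :=
    { toFun := fun v => !₂[v 0 * a + v 1 * b, - v 0 * b + v 1 * a]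
      map_add' := fun v w => by ext i; fin_cases i <;> simp <;> ring
      map_smul' := fun c v => by ext i; fin_cases i <;> simp <;> ring }
  have hf : Function.Injective f := by
    rw [← LinearMap.ker_eq_bot, LinearMap.ker_eq_bot']
    intro v hv
    have h0 : v 0 * a + v 1 * b = 0 := by simpa [f] using congrArg (fun w : Plane => w 0) hv
    have h1 : - v 0 * b + v 1 * a = 0 := by simpa [f] using congrArg (fun w : Plane => w 1) hv
    have h2 : (v 0) * (a ^ 2 + b ^ 2) = 0 := by linear_combination a * h0 - b * h1
    have h3 : (v 1) * (a ^ 2 + b ^ 2) = 0 := by linear_combination b * h0 + a * h1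
    ext i; fin_cases i
    · simpa [hab.ne'] using h2
    · simpa [hab.ne'] using h3
  refine ⟨(LinearEquiv.ofInjectiveEndo f hf).toContinuousLinearEquiv, fun v => ?_⟩
  simp [f, hLv]

/-- A function with nonvanishing differential is a coordinate of a local smooth change of
coordinates. -/
lemma exists_straightening {g : Plane → ℝ} {O : Set Plane} (hO : IsOpen O) {y₀ : Plane}
    (hy : y₀ ∈ O) (hg : ContDiffOn ℝ ∞ g O) (hg0 : g y₀ = 0)
    (hs : Function.Surjective (fderiv ℝ g y₀)) :
    ∃ (Φ : OpenPartialHomeomorph Plane Plane) (ρ : ℝ), 0 < ρ ∧ Φ.target = Metric.ball 0 ρ ∧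
      y₀ ∈ Φ.source ∧ Φ.source ⊆ O ∧ Φ y₀ = 0 ∧ (∀ y, (Φ y) 0 = g y) ∧
      ContDiffOn ℝ ∞ Φ Φ.source ∧ ContDiffOn ℝ ∞ Φ.symm Φ.target := by
  obtain ⟨A, hA⟩ := exists_equiv_of_surjective _ hs
  set L := fderiv ℝ g y₀ with hL
  -- the first coordinate of `G` is `g`, and the differential of `G` at `y₀` is the invertible `A`
  let G : Plane → Plane := fun y =>
    A (y - y₀) + (g y - L (y - y₀)) • EuclideanSpace.single 0 (1 : ℝ)
  have hgat : ∀ y ∈ O, ContDiffAt ℝ ∞ g y := fun y hy => hg.contDiffAt (hO.mem_nhds hy)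
  have hGat : ∀ y ∈ O, ContDiffAt ℝ ∞ G y := by
    intro y hy
    have h1 : ContDiffAt ℝ ∞ (fun y : Plane => A (y - y₀)) y :=
      (A.contDiff.comp (contDiff_id.sub contDiff_const)).contDiffAt
    have h2 : ContDiffAt ℝ ∞ (fun y : Plane => L (y - y₀)) y :=
      (L.contDiff.comp (contDiff_id.sub contDiff_const)).contDiffAt
    exact h1.add (((hgat y hy).sub h2).smul contDiffAt_const)
  have hGd : HasFDerivAt G (A : Plane →L[ℝ] Plane) y₀ := by
    have hi : HasFDerivAt (fun y : Plane => y - y₀) (ContinuousLinearMap.id ℝ Plane) y₀ :=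
      (hasFDerivAt_id y₀).sub_const y₀
    have h1 : HasFDerivAt (fun y : Plane => A (y - y₀)) (A : Plane →L[ℝ] Plane) y₀ := by
      exact (A : Plane →L[ℝ] Plane).hasFDerivAt.comp y₀ hi
    have h2 : HasFDerivAt (fun y : Plane => L (y - y₀)) L y₀ := by
      exact L.hasFDerivAt.comp y₀ hi
    have h3 : HasFDerivAt g L y₀ := ((hgat y₀ hy).differentiableAt (by simp)).hasFDerivAt
    have := h1.add ((h3.sub h2).smul_const (EuclideanSpace.single 0 (1 : ℝ)))
    rw [sub_self, ContinuousLinearMap.zero_smulRight, add_zero] at this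
    exact this
  have hG0 : ∀ y, (G y) 0 = g y := by
    intro y; simp [G, hA]
  have hGy : G y₀ = 0 := by simp [G, hg0]
  let Ψ := (hGat y₀ hy).toOpenPartialHomeomorph G hGd (by simp)
  have hΨ : (Ψ : Plane → Plane) = G := rfl
  have hyΨ : y₀ ∈ Ψ.source :=
    (hGat y₀ hy).mem_toOpenPartialHomeomorph_source hGd (by simp)
  -- the differential stays invertible near the base point
  have hinv : ∀ᶠ y in 𝓝 y₀,
      fderiv ℝ G y ∈ range ((↑) : (Plane ≃L[ℝ] Plane) → Plane →L[ℝ] Plane) := by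
    have hc : ContinuousAt (fderiv ℝ G) y₀ :=
      ((hGat y₀ hy).fderiv_right (m := 0) (by simp)).continuousAt
    refine hc.eventually ?_
    rw [hGd.fderiv]
    exact A.nhds
  have hnear : ∀ᶠ z in 𝓝 (0 : Plane), z ∈ Ψ.target ∧ Ψ.symm z ∈ O ∧
      fderiv ℝ G (Ψ.symm z) ∈ range ((↑) : (Plane ≃L[ℝ] Plane) → Plane →L[ℝ] Plane) := by
    have h0 : (0 : Plane) = Ψ y₀ := by rw [hΨ, hGy]
    have hsy : Ψ.symm 0 = y₀ := by rw [h0, Ψ.left_inv hyΨ]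
    have ht : (0 : Plane) ∈ Ψ.target := by rw [h0]; exact Ψ.map_source hyΨ
    have hcs : Tendsto Ψ.symm (𝓝 0) (𝓝 y₀) := by
      have := (Ψ.continuousAt_symm ht).tendsto
      rwa [hsy] at this
    filter_upwards [Ψ.open_target.mem_nhds ht, hcs (hO.mem_nhds hy), hcs hinv] with z h1 h2 h3
      using ⟨h1, h2, h3⟩
  obtain ⟨ρ, hρ, hball⟩ := Metric.eventually_nhds_iff_ball.1 hnear
  let Φ := (Ψ.symm.restrOpen (Metric.ball 0 ρ) Metric.isOpen_ball).symm
  have hΦt : Φ.target = Metric.ball 0 ρ := by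
    change Ψ.target ∩ Metric.ball 0 ρ = _
    exact inter_eq_right.2 fun z hz => (hball z hz).1
  have hΦc : (Φ : Plane → Plane) = G := rfl
  have hΦs : (Φ.symm : Plane → Plane) = Ψ.symm := rfl
  have hsO : Φ.source ⊆ O := by
    intro y hy
    have h1 := Φ.map_source hy
    rw [hΦt] at h1
    have h2 := (hball _ h1).2.1
    rw [← hΦs, Φ.left_inv hy] at h2
    exact h2
  have h0t : (0 : Plane) ∈ Φ.target := by rw [hΦt]; exact Metric.mem_ball_self hρ
  have hs0 : Φ.symm 0 = y₀ := by
    rw [hΦs, ← hGy, ← hΨ, Ψ.left_inv hyΨ]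
  refine ⟨Φ, ρ, hρ, hΦt, hs0 ▸ Φ.map_target h0t, hsO, by rw [hΦc, hGy], by rw [hΦc]; exact hG0,
    fun y hy => ?_, fun z hz => ?_⟩
  · rw [hΦc]; exact (hGat y (hsO hy)).contDiffWithinAt
  · rw [hΦt] at hz
    obtain ⟨hz1, hz2, B, hB⟩ := hball z hz
    rw [hΦs]
    refine (Ψ.contDiffAt_symm (f₀' := B) hz1 ?_ ?_).contDiffWithinAt
    · rw [hB]; exact ((hGat _ hz2).differentiableAt (by simp)).hasFDerivAt
    · exact hGat _ hz2

end Plane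

namespace SwitchingManifold

variable {M : Type*} [TopologicalSpace M] [ChartedSpace Plane M] [IsManifold (𝓡 2) ∞ M] {n : ℕ}

lemma continuous_γ (S : SwitchingManifold M n) (k : Fin n) : Continuous (S.γ k) :=
  (S.contMDiff_γ k).continuous

lemma mdifferentiableAt_γ (S : SwitchingManifold M n) (k : Fin n) (p : M) :
    MDifferentiableAt (𝓡 2) 𝓘(ℝ, ℝ) (S.γ k) p :=
  (S.contMDiff_γ k).mdifferentiable (by simp) p

lemma eventually_γ_ne_zero (S : SwitchingManifold M n) {k : Fin n} {p : M} (hp : S.γ k p = 0) :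
    ∀ᶠ q in 𝓝 p, ∀ l ≠ k, S.γ l q ≠ 0 := by
  rw [eventually_all]
  intro l
  by_cases hl : l = k
  · simp [hl]
  · have : S.γ l p ≠ 0 := fun h =>
      (disjoint_left.1 (S.disjoint_γ l k hl)) (show p ∈ {p | S.γ l p = 0} from h) hp
    filter_upwards [(S.continuous_γ l).continuousAt.eventually_ne this] with q hq _ using hq

/-- A smooth chart at a point of the curve `k`, onto a disc, whose first coordinate is `γ k`. The
other curves do not meet its domain. -/
structure IsStraightChart (S : SwitchingManifold M n) (k : Fin n)
    (ψ : OpenPartialHomeomorph M Plane) (ρ : ℝ) : Prop where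
  mem_atlas : ψ ∈ IsManifold.maximalAtlas (𝓡 2) ∞ M
  pos : 0 < ρ
  target_eq : ψ.target = Metric.ball 0 ρ
  apply_zero : ∀ q ∈ ψ.source, (ψ q) 0 = S.γ k q
  ne_zero : ∀ q ∈ ψ.source, ∀ l ≠ k, S.γ l q ≠ 0

/-- A chart of the surface in which the function `γ k` is the first coordinate, by the inverse
function theorem; it exists because `0` is a regular value. -/
lemma exists_isStraightChart (S : SwitchingManifold M n) {k : Fin n} {p : M} (hp : S.γ k p = 0)
    {U : Set M} (hU : U ∈ 𝓝 p) :
    ∃ ψ ρ, S.IsStraightChart k ψ ρ ∧ p ∈ ψ.source ∧ ψ p = 0 ∧ ψ.source ⊆ U := by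
  set e := chartAt Plane p
  have he : e ∈ IsManifold.maximalAtlas (𝓡 2) ∞ M := IsManifold.chart_mem_maximalAtlas _
  have hps : p ∈ e.source := mem_chart_source _ _
  obtain ⟨W, hWsub, hWo, hpW⟩ := mem_nhds_iff.1 (inter_mem hU (S.eventually_γ_ne_zero hp))
  have hO : IsOpen (e.target ∩ e.symm ⁻¹' W) := e.isOpen_inter_preimage_symm hWo
  have hg : ContDiffOn ℝ ∞ (S.γ k ∘ e.symm) (e.target ∩ e.symm ⁻¹' W) := by
    have h := (S.contMDiff_γ k).comp_contMDiffOn (contMDiffOn_symm_of_mem_maximalAtlas he)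
    exact (contMDiffOn_iff_contDiffOn.1 h).mono inter_subset_left
  have hsurj : Function.Surjective (fderiv ℝ (S.γ k ∘ e.symm) (e p)) := by
    intro x
    obtain ⟨v, hv⟩ := S.regular_γ k p hp x
    exact ⟨_, (VField.mfderiv_apply_eq_fderiv he (S.mdifferentiableAt_γ k p) hps v).symm.trans hv⟩
  obtain ⟨Φ, ρ, hρ, ht, hy, hsub, hy0, h0, hc1, hc2⟩ := Plane.exists_straightening hO
    (y₀ := e p) ⟨e.map_source hps, by simpa [e.left_inv hps] using hpW⟩ hg
    (by simp [e.left_inv hps, hp]) hsurj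
  have hsrc : ∀ q, q ∈ (e.trans Φ).source ↔ q ∈ e.source ∧ e q ∈ Φ.source := by
    intro q; simp
  have htgt : (e.trans Φ).target = Metric.ball 0 ρ := by
    rw [OpenPartialHomeomorph.trans_target, ← ht]
    refine inter_eq_left.2 fun z hz => ?_
    exact (hsub (Φ.map_target hz)).1
  have hW : ∀ q ∈ (e.trans Φ).source, q ∈ W := by
    intro q hq
    rw [hsrc] at hq
    have := (hsub hq.2).2
    simpa [e.left_inv hq.1] using this
  refine ⟨e.trans Φ, ρ, ⟨?_, hρ, htgt, fun q hq => ?_, fun q hq => (hWsub (hW q hq)).2⟩,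
    (hsrc p).2 ⟨hps, hy⟩, by simpa using hy0, fun q hq => (hWsub (hW q hq)).1⟩
  · refine OpenPartialHomeomorph.mem_maximalAtlas_of_contMDiffOn _ ?_ ?_
    · rw [OpenPartialHomeomorph.coe_trans]
      exact (contMDiffOn_iff_contDiffOn.2 hc1).comp
        ((contMDiffOn_of_mem_maximalAtlas he).mono fun q hq => ((hsrc q).1 hq).1)
        fun q hq => ((hsrc q).1 hq).2
    · rw [OpenPartialHomeomorph.coe_trans_symm, htgt, ← ht]
      exact (contMDiffOn_symm_of_mem_maximalAtlas he).comp (contMDiffOn_iff_contDiffOn.2 hc2)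
        fun z hz => (hsub (Φ.map_target hz)).1
  · rw [hsrc] at hq
    simp [h0, e.left_inv hq.1]

end SwitchingManifold

/-! ### The regions and the two sides of a curve -/

namespace SwitchingManifold

variable {M : Type*} [TopologicalSpace M] [ChartedSpace Plane M] [IsManifold (𝓡 2) ∞ M] {n : ℕ}

section region

variable (S : SwitchingManifold M n)

lemma exists_region_eq (i : Fin (n + 1)) : ∃ x ∈ {p | ∀ k, S.γ k p ≠ 0},
    S.region i = connectedComponentIn {p | ∀ k, S.γ k p ≠ 0} x := by
  have := S.range_region.subset (mem_range_self i)
  exact this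

lemma region_subset (i : Fin (n + 1)) {p : M} (hp : p ∈ S.region i) (k : Fin n) :
    S.γ k p ≠ 0 := by
  obtain ⟨x, -, h⟩ := S.exists_region_eq i
  rw [h] at hp
  exact connectedComponentIn_subset _ _ hp k

lemma isPreconnected_region (i : Fin (n + 1)) : IsPreconnected (S.region i) := by
  obtain ⟨x, -, h⟩ := S.exists_region_eq i
  rw [h]; exact isPreconnected_connectedComponentIn

lemma isOpen_region (i : Fin (n + 1)) : IsOpen (S.region i) := by
  obtain ⟨x, -, h⟩ := S.exists_region_eq i
  have := ChartedSpace.locallyConnectedSpace Plane M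
  rw [h]
  refine IsOpen.connectedComponentIn ?_
  have : {p | ∀ k, S.γ k p ≠ 0} = ⋂ k, {p | S.γ k p ≠ 0} := by ext; simp
  rw [this]
  exact isOpen_iInter_of_finite fun k => isOpen_ne_fun (S.continuous_γ k) continuous_const

lemma exists_subset_region {A : Set M} (hA : IsPreconnected A) (hne : A.Nonempty)
    (h : ∀ p ∈ A, ∀ k, S.γ k p ≠ 0) : ∃ i, A ⊆ S.region i := by
  obtain ⟨x, hx⟩ := hne
  have h1 := hA.subset_connectedComponentIn hx (fun p hp => h p hp)
  obtain ⟨i, hi⟩ := S.range_region.superset ⟨x, h x hx, rfl⟩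
  exact ⟨i, hi ▸ h1⟩

lemma exists_mem_region {p : M} (h : ∀ k, S.γ k p ≠ 0) : ∃ i, p ∈ S.region i := by
  obtain ⟨i, hi⟩ := S.exists_subset_region (A := {p}) isPreconnected_singleton ⟨p, rfl⟩
    (by rintro q rfl; exact h)
  exact ⟨i, hi rfl⟩

lemma eq_of_mem_region {i j : Fin (n + 1)} {p : M} (hi : p ∈ S.region i) (hj : p ∈ S.region j) :
    i = j := by
  apply S.region_injective
  obtain ⟨x, -, hx⟩ := S.exists_region_eq i
  obtain ⟨y, -, hy⟩ := S.exists_region_eq j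
  rw [hx] at hi ⊢
  rw [hy] at hj ⊢
  rw [connectedComponentIn_eq hi, connectedComponentIn_eq hj]

lemma eq_of_mem_closure_region {i j : Fin (n + 1)} {p : M} (hi : p ∈ closure (S.region i))
    (hj : p ∈ S.region j) : i = j := by
  obtain ⟨q, hq1, hq2⟩ := mem_closure_iff.1 hi _ (S.isOpen_region j) hj
  exact S.eq_of_mem_region hq2 hq1

lemma mem_region_of_mem_closure {i : Fin (n + 1)} {p : M} (hi : p ∈ closure (S.region i))
    (h : ∀ k, S.γ k p ≠ 0) : p ∈ S.region i := by
  obtain ⟨j, hj⟩ := S.exists_mem_region h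
  exact S.eq_of_mem_closure_region hi hj ▸ hj

lemma region_sign (i : Fin (n + 1)) (k : Fin n) {σ : ℝ} (hσ : σ ≠ 0) {q : M} (hq : q ∈ S.region i)
    (hq0 : 0 < σ * S.γ k q) {p : M} (hp : p ∈ S.region i) : 0 < σ * S.γ k p := by
  by_contra! hneg
  obtain ⟨x, hx, hx0⟩ := (S.isPreconnected_region i).intermediate_value hp hq
    ((continuous_const.mul (S.continuous_γ k)).continuousOn) ⟨hneg, hq0.le⟩
  exact S.region_subset i hx k ((mul_eq_zero.1 hx0).resolve_left hσ)

lemma frequently_sign {k : Fin n} {σ : ℝ} (hσ : σ ≠ 0) {p : M} (hp : S.γ k p = 0) :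
    ∃ᶠ q in 𝓝 p, 0 < σ * S.γ k q := by
  obtain ⟨ψ, ρ, hψ, hps, hp0, -⟩ := S.exists_isStraightChart hp univ_mem
  have hc : ContinuousAt ψ.symm 0 :=
    ψ.continuousAt_symm (by rw [hψ.target_eq]; exact Metric.mem_ball_self hψ.pos)
  have hpe : ψ.symm 0 = p := by rw [← hp0, ψ.left_inv hps]
  set u : Plane := EuclideanSpace.single 0 (1 : ℝ)
  have h2 : Tendsto (fun t : ℝ => (σ * t) • u) (𝓝[>] 0) (𝓝 0) := by
    have h1 : Continuous (fun t : ℝ => (σ * t) • u) := by fun_prop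
    simpa using (h1.tendsto 0).mono_left nhdsWithin_le_nhds
  have hl : Tendsto (fun t : ℝ => ψ.symm ((σ * t) • u)) (𝓝[>] 0) (𝓝 p) := by
    rw [← hpe]; exact hc.tendsto.comp h2
  refine hl.frequently (Eventually.frequently ?_)
  filter_upwards [h2.eventually (Metric.ball_mem_nhds 0 hψ.pos), self_mem_nhdsWithin] with t ht ht0
  replace ht : (σ * t) • u ∈ ψ.target := by rw [hψ.target_eq]; exact ht
  rw [← hψ.apply_zero _ (ψ.map_target ht), ψ.right_inv ht]
  have h3 : 0 < σ ^ 2 * t := mul_pos (by positivity) ht0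
  simp only [u, PiLp.smul_apply, PiLp.single_apply, if_true, smul_eq_mul]
  nlinarith

/-- Near a point of the curve `k`, all the points on one side of the curve lie in one region. -/
lemma exists_eventually_mem_region {k : Fin n} {σ : ℝ} (hσ : σ ≠ 0) {p : M} (hp : S.γ k p = 0) :
    ∃ i, ∀ᶠ q in 𝓝 p, 0 < σ * S.γ k q → q ∈ S.region i := by
  obtain ⟨ψ, ρ, hψ, hps, hp0, -⟩ := S.exists_isStraightChart hp univ_mem
  have hconv : Convex ℝ (Metric.ball (0 : Plane) ρ ∩ {z : Plane | 0 < σ * z 0}) := by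
    refine (convex_ball _ _).inter ?_
    intro x hx y hy a b ha hb hab
    simp only [mem_ofPred_eq, PiLp.add_apply, PiLp.smul_apply, smul_eq_mul] at *
    rcases ha.eq_or_lt with rfl | ha
    · have : b = 1 := by linarith
      simpa [this] using hy
    · nlinarith [mul_pos ha hx, mul_nonneg hb hy.le]
  set A := ψ.symm '' (Metric.ball (0 : Plane) ρ ∩ {z : Plane | 0 < σ * z 0})
  have hA : IsPreconnected A := by
    refine hconv.isPreconnected.image _ (ψ.continuousOn_symm.mono ?_)
    rw [hψ.target_eq]; exact inter_subset_left
  have hmemA : ∀ q ∈ ψ.source, 0 < σ * S.γ k q → q ∈ A := by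
    intro q hq h0
    refine ⟨ψ q, ⟨hψ.target_eq ▸ ψ.map_source hq, ?_⟩, ψ.left_inv hq⟩
    simpa [hψ.apply_zero q hq] using h0
  have hAsub : ∀ q ∈ A, ∀ l, S.γ l q ≠ 0 := by
    rintro _ ⟨z, ⟨hz, hz0⟩, rfl⟩ l
    rw [← hψ.target_eq] at hz
    have hzs := ψ.map_target hz
    by_cases hl : l = k
    · subst hl
      rw [← hψ.apply_zero _ hzs, ψ.right_inv hz]
      rintro h0
      simp [h0] at hz0
    · exact hψ.ne_zero _ hzs l hl
  have hsrc := ψ.open_source.mem_nhds hps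
  obtain ⟨q, hq, hqs⟩ := ((S.frequently_sign hσ hp).and_eventually hsrc).exists
  obtain ⟨i, hi⟩ := S.exists_subset_region hA ⟨q, hmemA q hqs hq⟩ hAsub
  refine ⟨i, ?_⟩
  filter_upwards [hsrc] with q hq h0 using hi (hmemA q hq h0)

/-- The points on one side of the curve `k` that are close enough to the curve lie in one region. -/
lemma exists_side (k : Fin n) {σ : ℝ} (hσ : σ ≠ 0) :
    ∃ i, ∀ p, S.γ k p = 0 → ∀ᶠ q in 𝓝 p, 0 < σ * S.γ k q → q ∈ S.region i := by
  obtain ⟨p₀, hp₀⟩ := (S.connected_γ k).nonempty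
  obtain ⟨i, hi⟩ := S.exists_eventually_mem_region hσ hp₀
  refine ⟨i, ?_⟩
  set A : Fin (n + 1) → Set M := fun j => {p | ∀ᶠ q in 𝓝 p, 0 < σ * S.γ k q → q ∈ S.region j}
  have hAo : ∀ j, IsOpen (A j) := fun j => isOpen_setOfPred_eventually_nhds
  have h1 := isPreconnected_iff_subset_of_disjoint.1 (S.connected_γ k).isPreconnected (A i)
    (⋃ j ∈ {j | j ≠ i}, A j) (hAo i) (isOpen_biUnion fun j _ => hAo j) ?_ ?_
  · rcases h1 with h1 | h1
    · exact h1
    · obtain ⟨j, hj, hj'⟩ := mem_iUnion₂.1 (h1 hp₀)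
      obtain ⟨q, hq, hq1, hq2⟩ := ((S.frequently_sign hσ hp₀).and_eventually (hi.and hj')).exists
      exact absurd (S.eq_of_mem_region (hq2 hq) (hq1 hq)) hj
  · intro p hp
    obtain ⟨j, hj⟩ := S.exists_eventually_mem_region hσ hp
    by_cases h : j = i
    · left; rw [← h]; exact hj
    · right; exact mem_iUnion₂.2 ⟨j, h, hj⟩
  · rw [eq_empty_iff_forall_notMem]
    rintro p ⟨hp, hpi, hpj⟩
    obtain ⟨j, hj, hj'⟩ := mem_iUnion₂.1 hpj
    obtain ⟨q, hq, hq1, hq2⟩ := ((S.frequently_sign hσ hp).and_eventually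
      ((show ∀ᶠ q in 𝓝 p, _ from hpi).and hj')).exists
    exact absurd (S.eq_of_mem_region (hq2 hq) (hq1 hq)) hj

/-- The region on the side of the curve `k` on which `γ k` is positive. -/
noncomputable def posSide (k : Fin n) : Fin (n + 1) := (S.exists_side k one_ne_zero).choose

/-- The region on the side of the curve `k` on which `γ k` is negative. -/
noncomputable def negSide (k : Fin n) : Fin (n + 1) :=
  (S.exists_side k (neg_ne_zero.2 one_ne_zero)).choose

variable {S} {k : Fin n} {p : M}

lemma eventually_mem_posSide (hp : S.γ k p = 0) :
    ∀ᶠ q in 𝓝 p, 0 < S.γ k q → q ∈ S.region (S.posSide k) := by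
  have : ∀ᶠ q in 𝓝 p, 0 < 1 * S.γ k q → q ∈ S.region (S.posSide k) :=
    (S.exists_side k one_ne_zero).choose_spec p hp
  simpa only [one_mul] using this

lemma eventually_mem_negSide (hp : S.γ k p = 0) :
    ∀ᶠ q in 𝓝 p, S.γ k q < 0 → q ∈ S.region (S.negSide k) := by
  have : ∀ᶠ q in 𝓝 p, 0 < -1 * S.γ k q → q ∈ S.region (S.negSide k) :=
    (S.exists_side k (neg_ne_zero.2 one_ne_zero)).choose_spec p hp
  simpa only [neg_mul, one_mul, neg_pos] using this

lemma frequently_pos (hp : S.γ k p = 0) : ∃ᶠ q in 𝓝 p, 0 < S.γ k q := by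
  simpa using S.frequently_sign one_ne_zero hp

lemma frequently_neg (hp : S.γ k p = 0) : ∃ᶠ q in 𝓝 p, S.γ k q < 0 := by
  simpa using S.frequently_sign (neg_ne_zero.2 one_ne_zero) hp

lemma γ_pos_of_mem_posSide (hp : p ∈ S.region (S.posSide k)) : 0 < S.γ k p := by
  obtain ⟨p₀, hp₀⟩ := (S.connected_γ k).nonempty
  obtain ⟨q, hq, hq1⟩ := ((frequently_pos hp₀).and_eventually (eventually_mem_posSide hp₀)).exists
  simpa using S.region_sign _ k one_ne_zero (hq1 hq) (by simpa using hq) hp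

lemma γ_neg_of_mem_negSide (hp : p ∈ S.region (S.negSide k)) : S.γ k p < 0 := by
  obtain ⟨p₀, hp₀⟩ := (S.connected_γ k).nonempty
  obtain ⟨q, hq, hq1⟩ := ((frequently_neg hp₀).and_eventually (eventually_mem_negSide hp₀)).exists
  simpa using S.region_sign _ k (neg_ne_zero.2 one_ne_zero) (hq1 hq) (by simpa using hq) hp

lemma γ_nonneg_of_mem_closure_posSide (hp : p ∈ closure (S.region (S.posSide k))) :
    0 ≤ S.γ k p :=
  closure_minimal (fun _ hq => (γ_pos_of_mem_posSide hq).le)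
    (isClosed_le continuous_const (S.continuous_γ k)) hp

lemma γ_nonpos_of_mem_closure_negSide (hp : p ∈ closure (S.region (S.negSide k))) :
    S.γ k p ≤ 0 :=
  closure_minimal (fun _ hq => (γ_neg_of_mem_negSide hq).le)
    (isClosed_le (S.continuous_γ k) continuous_const) hp

lemma mem_closure_posSide (hp : S.γ k p = 0) : p ∈ closure (S.region (S.posSide k)) :=
  mem_closure_iff_frequently.2 (((frequently_pos hp).and_eventually
    (eventually_mem_posSide hp)).mono fun _ h => h.2 h.1)

lemma mem_closure_negSide (hp : S.γ k p = 0) : p ∈ closure (S.region (S.negSide k)) :=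
  mem_closure_iff_frequently.2 (((frequently_neg hp).and_eventually
    (eventually_mem_negSide hp)).mono fun _ h => h.2 h.1)

/-- Only the two adjacent regions accumulate at a point of a curve. -/
lemma eq_posSide_or_eq_negSide (hp : S.γ k p = 0) {i : Fin (n + 1)}
    (hi : p ∈ closure (S.region i)) : i = S.posSide k ∨ i = S.negSide k := by
  obtain ⟨q, hq, h1, h2⟩ := ((mem_closure_iff_frequently.1 hi).and_eventually
    ((eventually_mem_posSide hp).and (eventually_mem_negSide hp))).exists
  rcases lt_or_gt_of_ne (S.region_subset i hq k) with h | h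
  · exact Or.inr (S.eq_of_mem_region hq (h2 h))
  · exact Or.inl (S.eq_of_mem_region hq (h1 h))

lemma isPosSide_iff {i : Fin (n + 1)} : S.IsPosSide k i ↔ i = S.posSide k := by
  obtain ⟨p₀, hp₀⟩ := (S.connected_γ k).nonempty
  constructor
  · rintro ⟨h1, h2⟩
    rcases eq_posSide_or_eq_negSide hp₀ (h1 hp₀) with h | h
    · exact h
    · obtain ⟨q, hq⟩ := (mem_closure_iff_frequently.1 (h1 hp₀)).exists
      exact absurd (h2 q hq) (γ_neg_of_mem_negSide (h ▸ hq)).not_gt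
  · rintro rfl
    exact ⟨fun p hp => mem_closure_posSide hp, fun p hp => γ_pos_of_mem_posSide hp⟩

lemma isNegSide_iff {i : Fin (n + 1)} : S.IsNegSide k i ↔ i = S.negSide k := by
  obtain ⟨p₀, hp₀⟩ := (S.connected_γ k).nonempty
  constructor
  · rintro ⟨h1, h2⟩
    rcases eq_posSide_or_eq_negSide hp₀ (h1 hp₀) with h | h
    · obtain ⟨q, hq⟩ := (mem_closure_iff_frequently.1 (h1 hp₀)).exists
      exact absurd (h2 q hq) (γ_pos_of_mem_posSide (h ▸ hq)).not_gt
    · exact h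
  · rintro rfl
    exact ⟨fun p hp => mem_closure_negSide hp, fun p hp => γ_neg_of_mem_negSide hp⟩

lemma posSide_ne_negSide (S : SwitchingManifold M n) (k : Fin n) : S.posSide k ≠ S.negSide k := by
  intro h
  obtain ⟨p₀, hp₀⟩ := (S.connected_γ k).nonempty
  obtain ⟨q, hq⟩ := (mem_closure_iff_frequently.1 (mem_closure_posSide hp₀)).exists
  exact absurd (γ_pos_of_mem_posSide hq) (γ_neg_of_mem_negSide (h ▸ hq)).not_gt

lemma eq_of_γ_eq_zero {l : Fin n} (hp : S.γ k p = 0) (hl : S.γ l p = 0) : k = l := by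
  by_contra h
  exact disjoint_left.1 (S.disjoint_γ k l h) (show p ∈ {p | S.γ k p = 0} from hp) hl

end region

end SwitchingManifold

/-! ### Stable and unstable points, and arcs -/

namespace Real

lemma nonneg_deriv_left_of_nonneg {f f' : ℝ → ℝ} {a b : ℝ} (hab : a < b)
    (hf : ContinuousOn f (Icc a b)) (hd : ∀ t ∈ Ioo a b, HasDerivAt f (f' t) t)
    (hc : ContinuousOn f' (Icc a b)) (ha : f a = 0) (h : ∀ t ∈ Icc a b, 0 ≤ f t) : 0 ≤ f' a := by
  by_contra! hneg
  have h1 : ∀ᶠ t in 𝓝[Icc a b] a, f' t < 0 :=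
    (hc a (left_mem_Icc.2 hab.le)).eventually_lt_const hneg
  rw [nhdsWithin_Icc_eq_nhdsGE hab] at h1
  obtain ⟨u, hu, hu'⟩ := (mem_nhdsGE_iff_exists_Icc_subset).1 h1
  set w := min u b
  have haw : a < w := lt_min hu hab
  have hanti : StrictAntiOn f (Icc a w) := by
    refine strictAntiOn_of_deriv_neg (convex_Icc _ _)
      (hf.mono (Icc_subset_Icc_right (min_le_right _ _))) fun t ht => ?_
    rw [interior_Icc] at ht
    rw [(hd t ⟨ht.1, ht.2.trans_le (min_le_right _ _)⟩).deriv]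
    exact hu' ⟨ht.1.le, ht.2.le.trans (min_le_left _ _)⟩
  have := hanti (left_mem_Icc.2 haw.le) (right_mem_Icc.2 haw.le) haw
  linarith [h w ⟨haw.le, min_le_right _ _⟩]

lemma nonpos_deriv_right_of_nonneg {f f' : ℝ → ℝ} {a b : ℝ} (hab : a < b)
    (hf : ContinuousOn f (Icc a b)) (hd : ∀ t ∈ Ioo a b, HasDerivAt f (f' t) t)
    (hc : ContinuousOn f' (Icc a b)) (hb : f b = 0) (h : ∀ t ∈ Icc a b, 0 ≤ f t) : f' b ≤ 0 := by
  have hm : MapsTo (fun t : ℝ => -t) (Icc (-b) (-a)) (Icc a b) := fun t ht =>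
    ⟨by linarith [ht.2], by linarith [ht.1]⟩
  have := nonneg_deriv_left_of_nonneg (f := fun t => f (-t)) (f' := fun t => - f' (-t))
    (a := -b) (b := -a) (by linarith) (hf.comp continuous_neg.continuousOn hm) (fun t ht => ?_)
    (hc.comp continuous_neg.continuousOn hm).neg (by simpa using hb) (fun t ht => h _ (hm ht))
  · simpa using this
  · have := HasDerivAt.comp t (h₂ := f) (hd (-t) ⟨by linarith [ht.2], by linarith [ht.1]⟩)
      (hasDerivAt_neg t)
    simpa [Function.comp_def] using this

end Real

namespace PSVF

variable {M : Type*} [TopologicalSpace M] [ChartedSpace Plane M] [IsManifold (𝓡 2) ∞ M]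
  {n : ℕ} {S : SwitchingManifold M n} {r : ℕ∞} {Z : PSVF S r}

lemma lieDeriv_eq_inChart (Z : PSVF S r) (i : Fin (n + 1)) (k : Fin n)
    {e : OpenPartialHomeomorph M Plane} (he : e ∈ IsManifold.maximalAtlas (𝓡 2) ∞ M) {p : M}
    (hp : p ∈ e.source) : Z.lieDeriv i k p =
      fderiv ℝ (S.γ k ∘ e.symm) (e p) ((Z.field i).inChart e (e p)) := by
  rw [VField.inChart_apply _ hp]
  exact VField.mfderiv_apply_eq_fderiv he (S.mdifferentiableAt_γ k p) hp _

lemma continuous_lieDeriv (Z : PSVF S r) (i : Fin (n + 1)) (k : Fin n) :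
    Continuous (Z.lieDeriv i k) := by
  rw [continuous_iff_continuousAt]
  intro p
  set e := chartAt Plane p
  have he : e ∈ IsManifold.maximalAtlas (𝓡 2) ∞ M := IsManifold.chart_mem_maximalAtlas _
  have hps : p ∈ e.source := mem_chart_source _ _
  have hev : Z.lieDeriv i k =ᶠ[𝓝 p] fun q =>
      fderiv ℝ (S.γ k ∘ e.symm) (e q) ((Z.field i).inChart e (e q)) := by
    filter_upwards [e.open_source.mem_nhds hps] with q hq using Z.lieDeriv_eq_inChart i k he hq
  refine ContinuousAt.congr ?_ hev.symm
  have hg : ContDiffAt ℝ ∞ (S.γ k ∘ e.symm) (e p) :=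
    (contMDiffOn_iff_contDiffOn.1 ((S.contMDiff_γ k).comp_contMDiffOn
      (contMDiffOn_symm_of_mem_maximalAtlas he))).contDiffAt
      (e.open_target.mem_nhds (e.map_source hps))
  have h1 : ContinuousAt (fderiv ℝ (S.γ k ∘ e.symm)) (e p) :=
    (hg.fderiv_right (m := 0) (by simp)).continuousAt
  have h2 : ContinuousAt ((Z.field i).inChart e) (e p) :=
    ((Z.field i).contDiffAt_inChart (m := 0) he (e.map_source hps) (by simp)).continuousAt
  have he' := e.continuousAt hps
  exact (ContinuousAt.comp (f := e) (g := fderiv ℝ (S.γ k ∘ e.symm)) h1 he').clm_apply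
    (ContinuousAt.comp (f := e) (g := (Z.field i).inChart e) h2 he')

lemma _root_.SwitchingManifold.IsStraightChart.lieDeriv_eq {k : Fin n}
    {ψ : OpenPartialHomeomorph M Plane} {ρ : ℝ} (hψ : S.IsStraightChart k ψ ρ) (Z : PSVF S r)
    (i : Fin (n + 1)) {p : M} (hp : p ∈ ψ.source) :
    Z.lieDeriv i k p = ((Z.field i).inChart ψ (ψ p)) 0 := by
  rw [lieDeriv_eq_inChart Z i k hψ.mem_atlas hp]
  have hev : (S.γ k ∘ ψ.symm) =ᶠ[𝓝 (ψ p)] fun z : Plane => z 0 := by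
    filter_upwards [ψ.open_target.mem_nhds (ψ.map_source hp)] with z hz
    simp [← hψ.apply_zero _ (ψ.map_target hz), ψ.right_inv hz]
  rw [hev.fderiv_eq]
  have : HasFDerivAt (fun z : Plane => z 0) (EuclideanSpace.proj 0 : Plane →L[ℝ] ℝ) (ψ p) :=
    (EuclideanSpace.proj 0 : Plane →L[ℝ] ℝ).hasFDerivAt
  rw [this.fderiv]
  rfl

/-- The points of the switching manifold towards which both adjacent fields point, in the wide
sense. -/
def stableSet (Z : PSVF S r) : Set M :=
  {p | ∃ k, S.γ k p = 0 ∧ Z.lieDeriv (S.posSide k) k p ≤ 0 ∧ 0 ≤ Z.lieDeriv (S.negSide k) k p}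

/-- The points of the switching manifold from which both adjacent fields point away, in the wide
sense. -/
def unstableSet (Z : PSVF S r) : Set M :=
  {p | ∃ k, S.γ k p = 0 ∧ 0 ≤ Z.lieDeriv (S.posSide k) k p ∧ Z.lieDeriv (S.negSide k) k p ≤ 0}

lemma isClosed_stableSet : IsClosed Z.stableSet := by
  have : Z.stableSet = ⋃ k, {p | S.γ k p = 0 ∧ Z.lieDeriv (S.posSide k) k p ≤ 0 ∧
      0 ≤ Z.lieDeriv (S.negSide k) k p} := by ext; simp [stableSet]
  rw [this]
  exact isClosed_iUnion_of_finite fun k =>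
    (isClosed_eq (S.continuous_γ k) continuous_const).inter
      ((isClosed_le (Z.continuous_lieDeriv _ _) continuous_const).inter
        (isClosed_le continuous_const (Z.continuous_lieDeriv _ _)))

lemma isClosed_unstableSet : IsClosed Z.unstableSet := by
  have : Z.unstableSet = ⋃ k, {p | S.γ k p = 0 ∧ 0 ≤ Z.lieDeriv (S.posSide k) k p ∧
      Z.lieDeriv (S.negSide k) k p ≤ 0} := by ext; simp [unstableSet]
  rw [this]
  exact isClosed_iUnion_of_finite fun k =>
    (isClosed_eq (S.continuous_γ k) continuous_const).inter
      ((isClosed_le continuous_const (Z.continuous_lieDeriv _ _)).inter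
        (isClosed_le (Z.continuous_lieDeriv _ _) continuous_const))

lemma mem_tangencySet_iff {p : M} : p ∈ Z.tangencySet ↔ ∃ k, S.γ k p = 0 ∧
    (Z.lieDeriv (S.posSide k) k p = 0 ∨ Z.lieDeriv (S.negSide k) k p = 0) := by
  constructor
  · rintro ⟨k, i, hp, hi, h⟩
    rw [SwitchingManifold.isPosSide_iff, SwitchingManifold.isNegSide_iff] at hi
    rcases hi with rfl | rfl
    · exact ⟨k, hp, Or.inl h⟩
    · exact ⟨k, hp, Or.inr h⟩
  · rintro ⟨k, hp, h | h⟩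
    · exact ⟨k, _, hp, Or.inl (SwitchingManifold.isPosSide_iff.2 rfl), h⟩
    · exact ⟨k, _, hp, Or.inr (SwitchingManifold.isNegSide_iff.2 rfl), h⟩

lemma slidingRegion_subset : Z.slidingRegion ⊆ Z.stableSet := by
  rintro p ⟨k, i, j, hp, hi, hj, h1, h2⟩
  rw [SwitchingManifold.isPosSide_iff] at hi
  rw [SwitchingManifold.isNegSide_iff] at hj
  subst hi hj
  exact ⟨k, hp, h1.le, h2.le⟩

lemma escapingRegion_subset : Z.escapingRegion ⊆ Z.unstableSet := by
  rintro p ⟨k, i, j, hp, hi, hj, h1, h2⟩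
  rw [SwitchingManifold.isPosSide_iff] at hi
  rw [SwitchingManifold.isNegSide_iff] at hj
  subst hi hj
  exact ⟨k, hp, h1.le, h2.le⟩

lemma mem_stableSet_or_mem_unstableSet {p : M} {k : Fin n} (hp : S.γ k p = 0)
    (h : Z.lieDeriv (S.posSide k) k p = 0 ∨ Z.lieDeriv (S.negSide k) k p = 0) :
    p ∈ Z.stableSet ∪ Z.unstableSet := by
  rcases h with h | h
  · rcases le_total 0 (Z.lieDeriv (S.negSide k) k p) with h' | h'
    · exact Or.inl ⟨k, hp, h.le, h'⟩
    · exact Or.inr ⟨k, hp, h.ge, h'⟩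
  · rcases le_total 0 (Z.lieDeriv (S.posSide k) k p) with h' | h'
    · exact Or.inr ⟨k, hp, h', h.le⟩
    · exact Or.inl ⟨k, hp, h', h.ge⟩

/-- The condition that the fields on the two sides of a curve are never tangent to it at the same
point. -/
def IsRegular (Z : PSVF S r) : Prop :=
  ∀ k p, S.γ k p = 0 → Z.lieDeriv (S.posSide k) k p = 0 → Z.lieDeriv (S.negSide k) k p ≠ 0

lemma IsRegular.disjoint (h : Z.IsRegular) : Disjoint Z.stableSet Z.unstableSet := by
  rw [disjoint_left]
  rintro p ⟨k, hk, h1, h2⟩ ⟨l, hl, h3, h4⟩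
  obtain rfl := SwitchingManifold.eq_of_γ_eq_zero hk hl
  exact h k p hk (le_antisymm h1 h3) (le_antisymm h4 h2)

lemma hasDerivAt_γ {i : Fin (n + 1)} {c : ℝ → M} {a b t : ℝ}
    (h : IsMIntegralCurveOn c (fun p => Z.field i p) (Ioo a b)) (ht : t ∈ Ioo a b) (k : Fin n) :
    HasDerivAt (S.γ k ∘ c) (Z.lieDeriv i k (c t)) t :=
  VField.hasDerivAt_comp (S.mdifferentiableAt_γ k _)
    (VField.hasMFDerivAt_of_isMIntegralCurveOn h ht)

/-- On `[a, b]`, `c` is an arc of trajectory of the `i`-th field in the closed `i`-th region. -/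
def IsArcOf (Z : PSVF S r) (i : Fin (n + 1)) (c : ℝ → M) (a b : ℝ) : Prop :=
  ContinuousOn c (Icc a b) ∧ (∀ t ∈ Icc a b, c t ∈ closure (S.region i)) ∧
    IsMIntegralCurveOn c (fun p => Z.field i p) (Ioo a b)

lemma isRegionArc_iff {c : ℝ → M} {a b : ℝ} : Z.IsRegionArc c a b ↔ ∃ i, Z.IsArcOf i c a b := by
  constructor
  · rintro ⟨h, i, h1, h2⟩; exact ⟨i, h, h1, h2⟩
  · rintro ⟨i, h, h1, h2⟩; exact ⟨h, i, h1, h2⟩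

lemma IsArcOf.mono {i : Fin (n + 1)} {c : ℝ → M} {a b a' b' : ℝ} (h : Z.IsArcOf i c a b)
    (ha : a ≤ a') (hb : b' ≤ b) : Z.IsArcOf i c a' b' :=
  ⟨h.1.mono (Icc_subset_Icc ha hb), fun t ht => h.2.1 t (Icc_subset_Icc ha hb ht),
    h.2.2.mono (Ioo_subset_Ioo ha hb)⟩

lemma IsSlidingArc.mono {c : ℝ → M} {a b a' b' : ℝ} (h : Z.IsSlidingArc c a b)
    (ha : a ≤ a') (hb : b' ≤ b) : Z.IsSlidingArc c a' b' :=
  ⟨h.1.mono (Icc_subset_Icc ha hb), fun t ht => h.2 t (Ioo_subset_Ioo ha hb ht)⟩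

lemma IsSlidingArc.mem {c : ℝ → M} {a b t : ℝ} (h : Z.IsSlidingArc c a b) (ht : t ∈ Ioo a b) :
    c t ∈ Z.stableSet ∪ Z.unstableSet := by
  obtain ⟨v, ⟨hv, -⟩, -⟩ := h.2 t ht
  exact union_subset_union slidingRegion_subset escapingRegion_subset hv

section ArcOf

variable {i : Fin (n + 1)} {c : ℝ → M} {a b : ℝ}

/-- An arc that starts on the switching manifold cannot start towards the outside of its region. -/
lemma IsArcOf.lieDeriv_left (h : Z.IsArcOf i c a b) (hab : a < b) {k : Fin n}
    (hk : S.γ k (c a) = 0) : (i = S.posSide k ∧ 0 ≤ Z.lieDeriv (S.posSide k) k (c a)) ∨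
      (i = S.negSide k ∧ Z.lieDeriv (S.negSide k) k (c a) ≤ 0) := by
  have hγ : ContinuousOn (S.γ k ∘ c) (Icc a b) := (S.continuous_γ k).comp_continuousOn h.1
  have hl := (Z.continuous_lieDeriv i k).comp_continuousOn h.1
  have hd := fun t ht => hasDerivAt_γ h.2.2 (t := t) ht k
  rcases SwitchingManifold.eq_posSide_or_eq_negSide hk (h.2.1 a (left_mem_Icc.2 hab.le))
    with rfl | rfl
  · exact Or.inl ⟨rfl, Real.nonneg_deriv_left_of_nonneg hab hγ hd hl hk fun t ht =>
      SwitchingManifold.γ_nonneg_of_mem_closure_posSide (h.2.1 t ht)⟩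
  · right
    refine ⟨rfl, ?_⟩
    have := Real.nonneg_deriv_left_of_nonneg hab hγ.neg (fun t ht => (hd t ht).neg) hl.neg
      (by simpa using hk) fun t ht => neg_nonneg.2
        (SwitchingManifold.γ_nonpos_of_mem_closure_negSide (h.2.1 t ht))
    simpa using this

/-- An arc that ends on the switching manifold cannot end with a velocity towards the inside of its
region. -/
lemma IsArcOf.lieDeriv_right (h : Z.IsArcOf i c a b) (hab : a < b) {k : Fin n}
    (hk : S.γ k (c b) = 0) : (i = S.posSide k ∧ Z.lieDeriv (S.posSide k) k (c b) ≤ 0) ∨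
      (i = S.negSide k ∧ 0 ≤ Z.lieDeriv (S.negSide k) k (c b)) := by
  have hγ : ContinuousOn (S.γ k ∘ c) (Icc a b) := (S.continuous_γ k).comp_continuousOn h.1
  have hl := (Z.continuous_lieDeriv i k).comp_continuousOn h.1
  have hd := fun t ht => hasDerivAt_γ h.2.2 (t := t) ht k
  rcases SwitchingManifold.eq_posSide_or_eq_negSide hk (h.2.1 b (right_mem_Icc.2 hab.le))
    with rfl | rfl
  · exact Or.inl ⟨rfl, Real.nonpos_deriv_right_of_nonneg hab hγ hd hl hk fun t ht =>
      SwitchingManifold.γ_nonneg_of_mem_closure_posSide (h.2.1 t ht)⟩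
  · right
    refine ⟨rfl, ?_⟩
    have := Real.nonpos_deriv_right_of_nonneg hab hγ.neg (fun t ht => (hd t ht).neg) hl.neg
      (by simpa using hk) fun t ht => neg_nonneg.2
        (SwitchingManifold.γ_nonpos_of_mem_closure_negSide (h.2.1 t ht))
    simpa using this

/-- At an interior time, a region arc can only touch the switching manifold, tangentially; one of
the two normal speeds vanishes there, so that the sign of the other one decides between the stable
and the unstable set. -/
lemma IsArcOf.mem_of_γ_eq_zero (h : Z.IsArcOf i c a b) {t : ℝ} (ht : t ∈ Ioo a b) {k : Fin n}
    (hk : S.γ k (c t) = 0) : c t ∈ Z.stableSet ∪ Z.unstableSet := by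
  refine mem_stableSet_or_mem_unstableSet hk ?_
  have h1 := (h.mono ht.1.le le_rfl).lieDeriv_left ht.2 hk
  have h2 := (h.mono le_rfl ht.2.le).lieDeriv_right ht.1 hk
  have hne := S.posSide_ne_negSide k
  rcases h1 with ⟨rfl, h1⟩ | ⟨rfl, h1⟩ <;> rcases h2 with ⟨h3, h2⟩ | ⟨h3, h2⟩
  · exact Or.inl (le_antisymm h2 h1)
  · exact absurd h3 hne
  · exact absurd h3.symm hne
  · exact Or.inr (le_antisymm h1 h2)

lemma IsArcOf.mem_region (h : Z.IsArcOf i c a b) {t : ℝ} (ht : t ∈ Ioo a b)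
    (hn : c t ∉ Z.stableSet ∪ Z.unstableSet) : c t ∈ S.region i :=
  S.mem_region_of_mem_closure (h.2.1 t (Ioo_subset_Icc_self ht))
    fun _ hk => hn (h.mem_of_γ_eq_zero ht hk)

end ArcOf

end PSVF

/-! ### Local trajectories, free paths and connections -/

namespace PSVF

variable {M : Type*} [TopologicalSpace M] [ChartedSpace Plane M] [IsManifold (𝓡 2) ∞ M]
  {n : ℕ} {S : SwitchingManifold M n} {r : ℕ∞} {Z : PSVF S r}

/-- On `[a, b]`, `c` is an arc of trajectory of one of the fields or of the sliding field. -/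
def IsArc (Z : PSVF S r) (c : ℝ → M) (a b : ℝ) : Prop :=
  (∃ i, Z.IsArcOf i c a b) ∨ Z.IsSlidingArc c a b

lemma IsArc.mono {c : ℝ → M} {a b a' b' : ℝ} (h : Z.IsArc c a b)
    (ha : a ≤ a') (hb : b' ≤ b) : Z.IsArc c a' b' := by
  rcases h with ⟨i, h⟩ | h
  · exact Or.inl ⟨i, h.mono ha hb⟩
  · exact Or.inr (h.mono ha hb)

lemma IsArc.continuousOn {c : ℝ → M} {a b : ℝ} (h : Z.IsArc c a b) : ContinuousOn c (Icc a b) := by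
  rcases h with ⟨i, h⟩ | h
  · exact h.1
  · exact h.1

lemma IsArc.exists_isArcOf {c : ℝ → M} {a b : ℝ} (h : Z.IsArc c a b) (hab : a < b)
    (hn : ∀ t ∈ Ioo a b, c t ∉ Z.stableSet ∪ Z.unstableSet) : ∃ i, Z.IsArcOf i c a b := by
  rcases h with h | h
  · exact h
  · obtain ⟨t, ht⟩ := exists_between hab
    exact absurd (h.mem ht) (hn t ht)

/-- The local form of the concatenations of arcs: every time of `[a, b]` is the initial time of an
arc and the final time of an arc. -/
def IsLocalTrajectory (Z : PSVF S r) (c : ℝ → M) (a b : ℝ) : Prop :=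
  ContinuousOn c (Icc a b) ∧ (∀ t ∈ Ico a b, ∃ u ∈ Ioc t b, Z.IsArc c t u) ∧
    ∀ t ∈ Ioc a b, ∃ s ∈ Ico a t, Z.IsArc c s t

/-- The local form of the concatenations of arcs of trajectories of the fields of the regions. -/
def IsRegionTrajectory (Z : PSVF S r) (c : ℝ → M) (a b : ℝ) : Prop :=
  ContinuousOn c (Icc a b) ∧ (∀ t ∈ Ico a b, ∃ u ∈ Ioc t b, ∃ i, Z.IsArcOf i c t u) ∧
    ∀ t ∈ Ioc a b, ∃ s ∈ Ico a t, ∃ i, Z.IsArcOf i c s t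

lemma IsLocalTrajectory.mono {c : ℝ → M} {a b a' b' : ℝ} (h : Z.IsLocalTrajectory c a b)
    (ha : a ≤ a') (hb : b' ≤ b) : Z.IsLocalTrajectory c a' b' := by
  refine ⟨h.1.mono (Icc_subset_Icc ha hb), fun t ht => ?_, fun t ht => ?_⟩
  · obtain ⟨u, hu, h1⟩ := h.2.1 t ⟨ha.trans ht.1, ht.2.trans_le hb⟩
    exact ⟨min u b', ⟨lt_min hu.1 ht.2, min_le_right _ _⟩, h1.mono le_rfl (min_le_left _ _)⟩
  · obtain ⟨u, hu, h1⟩ := h.2.2 t ⟨ha.trans_lt ht.1, ht.2.trans hb⟩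
    exact ⟨max u a', ⟨le_max_right _ _, max_lt hu.2 ht.1⟩, h1.mono (le_max_left _ _) le_rfl⟩

lemma IsRegionTrajectory.mono {c : ℝ → M} {a b a' b' : ℝ} (h : Z.IsRegionTrajectory c a b)
    (ha : a ≤ a') (hb : b' ≤ b) : Z.IsRegionTrajectory c a' b' := by
  refine ⟨h.1.mono (Icc_subset_Icc ha hb), fun t ht => ?_, fun t ht => ?_⟩
  · obtain ⟨u, hu, i, h1⟩ := h.2.1 t ⟨ha.trans ht.1, ht.2.trans_le hb⟩
    exact ⟨min u b', ⟨lt_min hu.1 ht.2, min_le_right _ _⟩, i, h1.mono le_rfl (min_le_left _ _)⟩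
  · obtain ⟨u, hu, i, h1⟩ := h.2.2 t ⟨ha.trans_lt ht.1, ht.2.trans hb⟩
    exact ⟨max u a', ⟨le_max_right _ _, max_lt hu.2 ht.1⟩, i, h1.mono (le_max_left _ _) le_rfl⟩

lemma IsRegionTrajectory.isLocalTrajectory {c : ℝ → M} {a b : ℝ}
    (h : Z.IsRegionTrajectory c a b) : Z.IsLocalTrajectory c a b := by
  refine ⟨h.1, fun t ht => ?_, fun t ht => ?_⟩
  · obtain ⟨u, hu, h1⟩ := h.2.1 t ht; exact ⟨u, hu, Or.inl h1⟩
  · obtain ⟨u, hu, h1⟩ := h.2.2 t ht; exact ⟨u, hu, Or.inl h1⟩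

lemma IsLocalTrajectory.isRegionTrajectory {c : ℝ → M} {a b : ℝ}
    (h : Z.IsLocalTrajectory c a b) (hn : ∀ t ∈ Ioo a b, c t ∉ Z.stableSet ∪ Z.unstableSet) :
    Z.IsRegionTrajectory c a b := by
  refine ⟨h.1, fun t ht => ?_, fun t ht => ?_⟩
  · obtain ⟨u, hu, h1⟩ := h.2.1 t ht
    exact ⟨u, hu, h1.exists_isArcOf hu.1 fun x hx => hn x ⟨ht.1.trans_lt hx.1, hx.2.trans_le hu.2⟩⟩
  · obtain ⟨u, hu, h1⟩ := h.2.2 t ht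
    exact ⟨u, hu, h1.exists_isArcOf hu.2 fun x hx => hn x ⟨hu.1.trans_lt hx.1, hx.2.trans_le ht.2⟩⟩

lemma IsLocalTrajectory.append {c : ℝ → M} {a b d : ℝ} (hab : a ≤ b) (hbd : b ≤ d)
    (h : Z.IsLocalTrajectory c a b) (h' : Z.IsLocalTrajectory c b d) :
    Z.IsLocalTrajectory c a d := by
  refine ⟨?_, fun t ht => ?_, fun t ht => ?_⟩
  · rw [← Icc_union_Icc_eq_Icc hab hbd]
    exact h.1.union_of_isClosed h'.1 isClosed_Icc isClosed_Icc
  · rcases lt_or_ge t b with hb | hb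
    · obtain ⟨u, hu, h1⟩ := h.2.1 t ⟨ht.1, hb⟩
      exact ⟨u, ⟨hu.1, hu.2.trans hbd⟩, h1⟩
    · exact h'.2.1 t ⟨hb, ht.2⟩
  · rcases le_or_gt t b with hb | hb
    · exact h.2.2 t ⟨ht.1, hb⟩
    · obtain ⟨u, hu, h1⟩ := h'.2.2 t ⟨hb, ht.2⟩
      exact ⟨u, ⟨hab.trans hu.1, hu.2⟩, h1⟩

lemma IsRegionTrajectory.append {c : ℝ → M} {a b d : ℝ} (hab : a ≤ b) (hbd : b ≤ d)
    (h : Z.IsRegionTrajectory c a b) (h' : Z.IsRegionTrajectory c b d) :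
    Z.IsRegionTrajectory c a d := by
  refine ⟨(h.isLocalTrajectory.append hab hbd h'.isLocalTrajectory).1, fun t ht => ?_,
    fun t ht => ?_⟩
  · rcases lt_or_ge t b with hb | hb
    · obtain ⟨u, hu, h1⟩ := h.2.1 t ⟨ht.1, hb⟩
      exact ⟨u, ⟨hu.1, hu.2.trans hbd⟩, h1⟩
    · exact h'.2.1 t ⟨hb, ht.2⟩
  · rcases le_or_gt t b with hb | hb
    · exact h.2.2 t ⟨ht.1, hb⟩
    · obtain ⟨u, hu, h1⟩ := h'.2.2 t ⟨hb, ht.2⟩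
      exact ⟨u, ⟨hab.trans hu.1, hu.2⟩, h1⟩

lemma IsArc.isLocalTrajectory {c : ℝ → M} {a b : ℝ} (h : Z.IsArc c a b) :
    Z.IsLocalTrajectory c a b :=
  ⟨h.continuousOn, fun _ ht => ⟨b, ⟨ht.2, le_rfl⟩, h.mono ht.1 le_rfl⟩,
    fun _ ht => ⟨a, ⟨le_rfl, ht.1⟩, h.mono le_rfl ht.2⟩⟩

lemma IsArcOf.isRegionTrajectory {i : Fin (n + 1)} {c : ℝ → M} {a b : ℝ} (h : Z.IsArcOf i c a b) :
    Z.IsRegionTrajectory c a b :=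
  ⟨h.1, fun _ ht => ⟨b, ⟨ht.2, le_rfl⟩, i, h.mono ht.1 le_rfl⟩,
    fun _ ht => ⟨a, ⟨le_rfl, ht.1⟩, i, h.mono le_rfl ht.2⟩⟩

lemma IsConcatenation.isLocalTrajectory {c : ℝ → M} {a b : ℝ} (h : Z.IsConcatenation c a b) :
    Z.IsLocalTrajectory c a b := by
  obtain ⟨N, τ, rfl, rfl, h⟩ := h
  have key : ∀ m ≤ N, τ 0 ≤ τ m ∧ Z.IsLocalTrajectory c (τ 0) (τ m) := by
    intro m
    induction m with
    | zero =>
      refine fun _ => ⟨le_rfl, ?_, fun t ht => ?_, fun t ht => ?_⟩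
      · rw [Icc_self]; exact continuousOn_singleton _ _
      · exact absurd ht.2 ht.1.not_gt
      · exact absurd ht.1 ht.2.not_gt
    | succ m ih =>
      intro hm
      obtain ⟨h1, h2⟩ := ih (by omega)
      obtain ⟨h3, h4⟩ := h m (by omega)
      refine ⟨h1.trans h3.le, h2.append h1 h3.le (IsArc.isLocalTrajectory ?_)⟩
      rwa [isRegionArc_iff] at h4
  exact (key N le_rfl).2

/-- A trajectory that stays in a region is a trajectory of the field of that region. -/
lemma IsLocalTrajectory.isArcOf {i : Fin (n + 1)} {c : ℝ → M} {a b : ℝ} (hab : a < b)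
    (h : Z.IsLocalTrajectory c a b) (hi : ∀ t ∈ Ioo a b, c t ∈ S.region i) : Z.IsArcOf i c a b := by
  have hnot : ∀ t ∈ Ioo a b, c t ∉ Z.stableSet ∪ Z.unstableSet := by
    rintro t ht (⟨k, hk, -⟩ | ⟨k, hk, -⟩)
    · exact S.region_subset i (hi t ht) k hk
    · exact S.region_subset i (hi t ht) k hk
  have h' := h.isRegionTrajectory hnot
  have harc : ∀ s u, a ≤ s → u ≤ b → s < u → ∀ j, Z.IsArcOf j c s u → Z.IsArcOf i c s u := by
    intro s u hs hu hsu j hj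
    obtain ⟨t, ht⟩ := exists_between hsu
    have := S.eq_of_mem_closure_region (hj.2.1 t (Ioo_subset_Icc_self ht))
      (hi t ⟨hs.trans_lt ht.1, ht.2.trans_le hu⟩)
    exact this ▸ hj
  refine ⟨h.1, fun t ht => ?_, ?_⟩
  · have h1 : Icc a b ⊆ closure (Ioo a b) := by rw [closure_Ioo hab.ne]
    exact ((h.1 t ht).mono Ioo_subset_Icc_self).mem_closure (h1 ht) hi
  · rw [VField.isMIntegralCurveOn_Ioo_iff]
    intro t ht
    obtain ⟨u, hu, j, hj⟩ := h'.2.1 t (Ioo_subset_Ico_self ht)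
    obtain ⟨s, hs, l, hl⟩ := h'.2.2 t (Ioo_subset_Ioc_self ht)
    have hj := harc t u ht.1.le hu.2 hu.1 j hj
    have hl := harc s t hs.1 ht.2.le hs.2 l hl
    refine VField.hasMFDerivAt_of_punctured _ (h.1.continuousAt (Icc_mem_nhds ht.1 ht.2)) ?_
    filter_upwards [mem_nhdsWithin_of_mem_nhds (Ioo_mem_nhds hs.2 hu.1), self_mem_nhdsWithin]
      with x hx hxt
    rcases lt_or_gt_of_ne hxt with hlt | hgt
    · exact VField.hasMFDerivAt_of_isMIntegralCurveOn hl.2.2 ⟨hx.1, hlt⟩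
    · exact VField.hasMFDerivAt_of_isMIntegralCurveOn hj.2.2 ⟨hgt, hx.2⟩

lemma IsArcOf.comp_add {i : Fin (n + 1)} {c : ℝ → M} {a b : ℝ} (h : Z.IsArcOf i c a b) (s : ℝ) :
    Z.IsArcOf i (fun t => c (t + s)) (a - s) (b - s) := by
  have hm : MapsTo (fun t => t + s) (Icc (a - s) (b - s)) (Icc a b) := fun t ht =>
    ⟨by linarith [ht.1], by linarith [ht.2]⟩
  exact ⟨h.1.comp (by fun_prop) hm, fun t ht => h.2.1 _ (hm ht),
    VField.isMIntegralCurveOn_comp_add h.2.2 s⟩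

lemma IsRegionTrajectory.comp_add {c : ℝ → M} {a b : ℝ} (h : Z.IsRegionTrajectory c a b) (s : ℝ) :
    Z.IsRegionTrajectory (fun t => c (t + s)) (a - s) (b - s) := by
  have hm : MapsTo (fun t => t + s) (Icc (a - s) (b - s)) (Icc a b) := fun t ht =>
    ⟨by linarith [ht.1], by linarith [ht.2]⟩
  refine ⟨h.1.comp (by fun_prop) hm, fun t ht => ?_, fun t ht => ?_⟩
  · obtain ⟨u, hu, i, hi⟩ := h.2.1 (t + s) ⟨by linarith [ht.1], by linarith [ht.2]⟩
    refine ⟨u - s, ⟨by linarith [hu.1], by linarith [hu.2]⟩, i, ?_⟩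
    simpa using hi.comp_add s
  · obtain ⟨u, hu, i, hi⟩ := h.2.2 (t + s) ⟨by linarith [ht.1], by linarith [ht.2]⟩
    refine ⟨u - s, ⟨by linarith [hu.1], by linarith [hu.2]⟩, i, ?_⟩
    simpa using hi.comp_add s

lemma IsArcOf.congr {i : Fin (n + 1)} {c d : ℝ → M} {a b : ℝ} (h : Z.IsArcOf i c a b)
    (hcd : EqOn c d (Icc a b)) : Z.IsArcOf i d a b := by
  refine ⟨h.1.congr hcd.symm, fun t ht => hcd ht ▸ h.2.1 t ht, ?_⟩
  rw [VField.isMIntegralCurveOn_Ioo_iff]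
  intro t ht
  have h1 := VField.hasMFDerivAt_of_isMIntegralCurveOn h.2.2 ht
  have h2 : d =ᶠ[𝓝 t] c := by
    filter_upwards [Ioo_mem_nhds ht.1 ht.2] with x hx using (hcd (Ioo_subset_Icc_self hx)).symm
  have key : ∀ q (hq : q = c t), (1 : ℝ →L[ℝ] ℝ).smulRight (Z.field i (c t) : Plane) =
      (1 : ℝ →L[ℝ] ℝ).smulRight (Z.field i q : Plane) := by rintro q rfl; rfl
  have h3 := h1.congr_of_eventuallyEq h2
  exact (key _ (hcd (Ioo_subset_Icc_self ht)).symm) ▸ h3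

lemma IsRegionTrajectory.congr {c d : ℝ → M} {a b : ℝ} (h : Z.IsRegionTrajectory c a b)
    (hcd : EqOn c d (Icc a b)) : Z.IsRegionTrajectory d a b := by
  refine ⟨h.1.congr hcd.symm, fun t ht => ?_, fun t ht => ?_⟩
  · obtain ⟨u, hu, i, hi⟩ := h.2.1 t ht
    exact ⟨u, hu, i, hi.congr (hcd.mono (Icc_subset_Icc ht.1 hu.2))⟩
  · obtain ⟨u, hu, i, hi⟩ := h.2.2 t ht
    exact ⟨u, hu, i, hi.congr (hcd.mono (Icc_subset_Icc hu.1 ht.2))⟩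

/-- A free path of duration `a`: a trajectory that leaves the stable set, necessarily at a tangency
point, and that meets neither the stable nor the unstable set between its end points. -/
structure IsFreePath (Z : PSVF S r) (c : ℝ → M) (a : ℝ) : Prop where
  nonneg : 0 ≤ a
  mem_stableSet : c 0 ∈ Z.stableSet
  mem_tangencySet : c 0 ∈ Z.tangencySet
  isRegionTrajectory : Z.IsRegionTrajectory c 0 a
  notMem : ∀ t ∈ Ioo 0 a, c t ∉ Z.stableSet ∪ Z.unstableSet

/-- A connection: a free path that ends in the unstable set. -/
def IsConnection (Z : PSVF S r) (c : ℝ → M) (a : ℝ) : Prop :=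
  Z.IsFreePath c a ∧ c a ∈ Z.unstableSet

lemma IsFreePath.mono {c : ℝ → M} {a b : ℝ} (h : Z.IsFreePath c a) (hb : 0 ≤ b) (hab : b ≤ a) :
    Z.IsFreePath c b :=
  ⟨hb, h.mem_stableSet, h.mem_tangencySet, h.isRegionTrajectory.mono le_rfl hab,
    fun t ht => h.notMem t ⟨ht.1, ht.2.trans_le hab⟩⟩

/-- Free paths are determined by their initial point. -/
lemma IsFreePath.eqOn [T2Space M] (hr : 1 ≤ r) (hZ : Z.IsRegular) {c d : ℝ → M} {a : ℝ}
    (hc : Z.IsFreePath c a) (hd : Z.IsFreePath d a) (h : c 0 = d 0) : EqOn c d (Icc 0 a) := by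
  have hclosed : IsClosed ({t | c t = d t} ∩ Icc 0 a) := by
    have := (hc.isRegionTrajectory.1.prodMk hd.isRegionTrajectory.1).preimage_isClosed_of_isClosed
      isClosed_Icc isClosed_diagonal
    rw [inter_comm]; exact this
  refine fun t ht => hclosed.Icc_subset_of_forall_exists_gt (a := 0) h ?_ ht
  rintro x ⟨hxe, hx⟩ y hy
  have hxe : c x = d x := hxe
  obtain ⟨u, hu, i, hi⟩ := hc.isRegionTrajectory.2.1 x hx
  obtain ⟨v, hv, j, hj⟩ := hd.isRegionTrajectory.2.1 x hx
  have hxu : c x ∉ Z.unstableSet := by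
    rcases hx.1.eq_or_lt with rfl | h0
    · exact disjoint_left.1 hZ.disjoint hc.mem_stableSet
    · exact fun hm => hc.notMem x ⟨h0, hx.2⟩ (Or.inr hm)
  -- two arcs leaving a point into different regions would put this point in the unstable set
  have hij : i = j := by
    by_cases hk : ∃ k, S.γ k (c x) = 0
    · obtain ⟨k, hk⟩ := hk
      have h1 := hi.lieDeriv_left hu.1 hk
      have h2 := hj.lieDeriv_left hv.1 (k := k) (by rw [← hxe]; exact hk)
      rw [← hxe] at h2
      rcases h1 with ⟨rfl, h1⟩ | ⟨rfl, h1⟩ <;> rcases h2 with ⟨rfl, h2⟩ | ⟨rfl, h2⟩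
      · rfl
      · exact absurd ⟨k, hk, h1, h2⟩ hxu
      · exact absurd ⟨k, hk, h2, h1⟩ hxu
      · rfl
    · push Not at hk
      have h1 := hi.2.1 x (left_mem_Icc.2 hu.1.le)
      have h2 := hj.2.1 x (left_mem_Icc.2 hv.1.le)
      rw [← hxe] at h2
      exact S.eq_of_mem_closure_region h1 (S.mem_region_of_mem_closure h2 hk)
  subst hij
  set w := min (min u v) y
  have hxw : x < w := lt_min (lt_min hu.1 hv.1) hy
  have hwu : w ≤ u := (min_le_left _ _).trans (min_le_left _ _)
  have hwv : w ≤ v := (min_le_left _ _).trans (min_le_right _ _)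
  have hi' := hi.mono le_rfl hwu
  have hj' := hj.mono le_rfl hwv
  exact ⟨w, VField.eqOn_Icc_of_left hr hi'.1 hj'.1 hi'.2.2 hj'.2.2 hxe (right_mem_Icc.2 hxw.le),
    hxw, min_le_right _ _⟩

/-- A trajectory leaves the stable set along an arc of a region, whose field points towards the
curve in the wide sense and has to be tangent to it. -/
lemma isFreePath_comp_add {c : ℝ → M} {s b : ℝ} (hsb : s < b) (h : Z.IsLocalTrajectory c s b)
    (hs : c s ∈ Z.stableSet) (hn : ∀ t ∈ Ioo s b, c t ∉ Z.stableSet ∪ Z.unstableSet) :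
    Z.IsFreePath (fun t => c (t + s)) (b - s) := by
  have hR := h.isRegionTrajectory hn
  refine ⟨by linarith, by simpa using hs, ?_, by simpa using hR.comp_add s, fun t ht =>
    hn _ ⟨by linarith [ht.1], by linarith [ht.2]⟩⟩
  obtain ⟨u, hu, i, hi⟩ := hR.2.1 s ⟨le_rfl, hsb⟩
  obtain ⟨k, hk, h1, h2⟩ := hs
  rw [zero_add, mem_tangencySet_iff]
  rcases hi.lieDeriv_left hu.1 hk with ⟨-, h3⟩ | ⟨-, h3⟩
  · exact ⟨k, hk, Or.inl (le_antisymm h1 h3)⟩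
  · exact ⟨k, hk, Or.inr (le_antisymm h3 h2)⟩

/-- Without connections, a trajectory that has met the stable set follows a free path since it last
left it. -/
lemma IsLocalTrajectory.exists_isFreePath [T2Space M] (hZ : Z.IsRegular)
    (hno : ∀ c a, ¬ Z.IsConnection c a) {c : ℝ → M} {a b s₀ : ℝ} (h : Z.IsLocalTrajectory c a b)
    (hs₀ : s₀ ∈ Icc a b) (hc₀ : c s₀ ∈ Z.stableSet) (hb : c b ∉ Z.stableSet) :
    ∃ s ∈ Ico a b, Z.IsFreePath (fun t => c (t + s)) (b - s) := by
  have hcomp : IsCompact (Icc a b ∩ c ⁻¹' Z.stableSet) :=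
    isCompact_Icc.of_isClosed_subset
      (h.1.preimage_isClosed_of_isClosed isClosed_Icc isClosed_stableSet) inter_subset_left
  -- the last visit of the stable set; a later visit of the unstable set would be a connection
  obtain ⟨s, ⟨hsI, hss⟩, hmax⟩ := hcomp.exists_isGreatest ⟨s₀, hs₀, hc₀⟩
  have hsb : s < b := lt_of_le_of_ne hsI.2 fun h => hb (h ▸ hss)
  have hS : ∀ t, s < t → t ≤ b → c t ∉ Z.stableSet := fun t h1 h2 h3 =>
    (hmax ⟨⟨hsI.1.trans h1.le, h2⟩, h3⟩).not_gt h1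
  refine ⟨s, ⟨hsI.1, hsb⟩, isFreePath_comp_add hsb (h.mono hsI.1 le_rfl) hss ?_⟩
  by_contra! hne
  obtain ⟨t₀, ht₀, hct₀⟩ := hne
  have hcomp' : IsCompact (Icc s b ∩ c ⁻¹' Z.unstableSet) :=
    isCompact_Icc.of_isClosed_subset
      ((h.1.mono (Icc_subset_Icc_left hsI.1)).preimage_isClosed_of_isClosed isClosed_Icc
        isClosed_unstableSet) inter_subset_left
  obtain ⟨t, ⟨htI, htu⟩, hmin⟩ := hcomp'.exists_isLeast
    ⟨t₀, Ioo_subset_Icc_self ht₀, hct₀.resolve_left (hS t₀ ht₀.1 ht₀.2.le)⟩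
  have hst : s < t := lt_of_le_of_ne htI.1 fun h =>
    disjoint_left.1 hZ.disjoint hss (h ▸ htu)
  refine hno (fun t => c (t + s)) (t - s) ⟨isFreePath_comp_add hst (h.mono hsI.1 htI.2) hss ?_, ?_⟩
  · rintro x hx (h1 | h1)
    · exact hS x hx.1 (hx.2.le.trans htI.2) h1
    · exact (hmin ⟨⟨hx.1.le, hx.2.le.trans htI.2⟩, h1⟩).not_gt hx.2
  · simpa using htu

end PSVF

/-! ### A field without connections is not transitive -/

namespace PSVF

variable {M : Type*} [TopologicalSpace M] [ChartedSpace Plane M] [IsManifold (𝓡 2) ∞ M]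
  {n : ℕ} {S : SwitchingManifold M n} {r : ℕ∞} {Z : PSVF S r}

lemma notMem_of_mem_region {i : Fin (n + 1)} {p : M} (hp : p ∈ S.region i) :
    p ∉ Z.stableSet ∪ Z.unstableSet := by
  rintro (⟨k, hk, -⟩ | ⟨k, hk, -⟩)
  · exact S.region_subset i hp k hk
  · exact S.region_subset i hp k hk

/-- A disc around a point of the sliding region, seen from the side on which `σ * γ k` is positive
(`σ = 1` or `σ = -1`): in the disc the field `i` of that side points towards the curve `k`, with
normal speed at least `κ` and speed at most `C` in the chart `ψ`, and the curve consists of stable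
points. The trajectories that start at a distance less than `δ` reach the curve in the disc. -/
structure IsTrap (Z : PSVF S r) (k : Fin n) (i : Fin (n + 1)) (σ : ℝ)
    (ψ : OpenPartialHomeomorph M Plane) (ρ κ C δ : ℝ) : Prop where
  mem_atlas : ψ ∈ IsManifold.maximalAtlas (𝓡 2) ∞ M
  subset_target : Metric.ball 0 ρ ⊆ ψ.target
  apply_zero : ∀ q ∈ ψ.source, (ψ q) 0 = S.γ k q
  sq_eq : σ ^ 2 = 1
  mem_region : ∀ q ∈ ψ.source, ψ q ∈ Metric.ball 0 ρ → 0 < σ * S.γ k q → q ∈ S.region i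
  lieDeriv_le : ∀ q ∈ ψ.source, ψ q ∈ Metric.ball 0 ρ → σ * Z.lieDeriv i k q ≤ -κ
  norm_le : ∀ q ∈ ψ.source, ψ q ∈ Metric.ball 0 ρ → ‖(Z.field i).inChart ψ (ψ q)‖ ≤ C
  mem_stableSet : ∀ q ∈ ψ.source, ψ q ∈ Metric.ball 0 ρ → S.γ k q = 0 → q ∈ Z.stableSet
  κ_pos : 0 < κ
  C_nonneg : 0 ≤ C
  δ_pos : 0 < δ
  lt : δ + C * (δ / κ) < ρ

/-- The half-disc of radius `R` on the side of the curve on which `σ * γ k` is positive. -/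
def halfDisc (S : SwitchingManifold M n) (k : Fin n) (σ : ℝ) (ψ : OpenPartialHomeomorph M Plane)
    (R : ℝ) : Set M :=
  {q | q ∈ ψ.source ∧ ψ q ∈ Metric.ball 0 R ∧ 0 < σ * S.γ k q}

lemma isOpen_halfDisc {k : Fin n} {σ : ℝ} {ψ : OpenPartialHomeomorph M Plane} {R : ℝ} :
    IsOpen (halfDisc S k σ ψ R) := by
  have h1 := ψ.isOpen_inter_preimage (s := Metric.ball 0 R) Metric.isOpen_ball
  have h2 : IsOpen {q | 0 < σ * S.γ k q} :=
    isOpen_lt continuous_const (continuous_const.mul (S.continuous_γ k))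
  have h3 : halfDisc S k σ ψ R = ψ.source ∩ ψ ⁻¹' Metric.ball 0 R ∩ {q | 0 < σ * S.γ k q} := by
    ext q
    exact and_assoc.symm
  rw [h3]
  exact h1.inter h2

section Trap

variable {k : Fin n} {i : Fin (n + 1)} {σ : ℝ} {ψ : OpenPartialHomeomorph M Plane} {ρ κ C δ : ℝ}

lemma IsTrap.δ_lt (hT : IsTrap Z k i σ ψ ρ κ C δ) : δ < ρ := by
  have := hT.lt
  have := mul_nonneg hT.C_nonneg (div_nonneg hT.δ_pos.le hT.κ_pos.le)
  linarith

lemma IsTrap.mem_region_of_mem (hT : IsTrap Z k i σ ψ ρ κ C δ) {q : M}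
    (hq : q ∈ halfDisc S k σ ψ δ) : q ∈ S.region i :=
  hT.mem_region q hq.1 (Metric.ball_subset_ball hT.δ_lt.le hq.2.1) hq.2.2

/-- In the half-disc a trajectory approaches the curve with normal speed at least `κ`, and moves
with speed at most `C`. -/
lemma IsTrap.estimates (hT : IsTrap Z k i σ ψ ρ κ C δ) {c : ℝ → M} {a b : ℝ} (hab : a ≤ b)
    (h : Z.IsLocalTrajectory c a b) (hO : ∀ t ∈ Icc a b, c t ∈ halfDisc S k σ ψ ρ) :
    σ * S.γ k (c b) ≤ σ * S.γ k (c a) - κ * (b - a) ∧ ‖ψ (c b) - ψ (c a)‖ ≤ C * (b - a) := by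
  rcases hab.eq_or_lt with rfl | hab
  · simp
  have harc := h.isArcOf hab (i := i) fun t ht =>
    hT.mem_region _ (hO t (Ioo_subset_Icc_self ht)).1 (hO t (Ioo_subset_Icc_self ht)).2.1
      (hO t (Ioo_subset_Icc_self ht)).2.2
  constructor
  · have hcont : ContinuousOn (fun t => σ * S.γ k (c t) + κ * t) (Icc a b) :=
      ((continuous_const.mul (S.continuous_γ k)).comp_continuousOn h.1).add
        (by fun_prop)
    have hanti : AntitoneOn (fun t => σ * S.γ k (c t) + κ * t) (Icc a b) := by
      have hd : ∀ t ∈ Ioo a b, HasDerivAt (fun t => σ * S.γ k (c t) + κ * t)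
          (σ * Z.lieDeriv i k (c t) + κ * 1) t := fun t ht =>
        ((hasDerivAt_γ harc.2.2 ht k).const_mul σ).add ((hasDerivAt_id t).const_mul κ)
      refine antitoneOn_of_deriv_nonpos (convex_Icc _ _) hcont ?_ ?_
      · rw [interior_Icc]; exact fun t ht => (hd t ht).differentiableAt.differentiableWithinAt
      · rw [interior_Icc]; intro t ht
        rw [(hd t ht).deriv]
        have := hT.lieDeriv_le _ (hO t (Ioo_subset_Icc_self ht)).1
          (hO t (Ioo_subset_Icc_self ht)).2.1
        linarith
    have := hanti (left_mem_Icc.2 hab.le) (right_mem_Icc.2 hab.le) hab.le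
    simp only at this
    linarith
  · refine norm_sub_le_of_hasDerivAt_Ioo (f := ψ ∘ c)
      (f' := fun t => (Z.field i).inChart ψ (ψ (c t))) hab.le ?_ (fun t ht => ?_) (fun t ht => ?_)
    · exact ψ.continuousOn.comp h.1 fun t ht => (hO t ht).1
    · exact VField.hasDerivAt_chart hT.mem_atlas
        (VField.hasMFDerivAt_of_isMIntegralCurveOn harc.2.2 ht) (hO t (Ioo_subset_Icc_self ht)).1
    · exact hT.norm_le _ (hO t (Ioo_subset_Icc_self ht)).1 (hO t (Ioo_subset_Icc_self ht)).2.1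

/-- A trajectory that starts in the small half-disc stays in the large one until it meets the
stable set. -/
lemma IsTrap.stay [T2Space M] (hT : IsTrap Z k i σ ψ ρ κ C δ) {c : ℝ → M} {a b : ℝ}
    (h : Z.IsLocalTrajectory c a b) (ha : c a ∈ halfDisc S k σ ψ δ)
    (hn : ∀ t ∈ Icc a b, c t ∉ Z.stableSet) : ∀ t ∈ Icc a b, c t ∈ halfDisc S k σ ψ ρ := by
  have hsub : halfDisc S k σ ψ δ ⊆ halfDisc S k σ ψ ρ := fun q hq =>
    ⟨hq.1, Metric.ball_subset_ball hT.δ_lt.le hq.2.1, hq.2.2⟩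
  refine mem_of_forall_not_exit isOpen_halfDisc h.1 (hsub ha) fun t ht hs => ?_
  set R := δ + C * (δ / κ) with hR
  have hclB : Metric.closedBall (0 : Plane) R ⊆ ψ.target :=
    (Metric.closedBall_subset_ball hT.lt).trans hT.subset_target
  have hKclosed : IsClosed (ψ.symm '' Metric.closedBall (0 : Plane) R) :=
    ((isCompact_closedBall _ _).image_of_continuousOn (ψ.continuousOn_symm.mono hclB)).isClosed
  have hin : ∀ s ∈ Ico a t, c s ∈ ψ.symm '' Metric.closedBall (0 : Plane) R ∩
      {q | 0 ≤ σ * S.γ k q} := by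
    intro s hst
    obtain ⟨h1, h2⟩ := hT.estimates hst.1 (h.mono le_rfl (hst.2.le.trans ht.2)) fun u hu =>
      hs u ⟨hu.1, hu.2.trans_lt hst.2⟩
    have h0 := (hs s hst).2.2
    have hna : ‖ψ (c a)‖ < δ := by simpa using ha.2.1
    have hga : σ * S.γ k (c a) < δ := by
      rw [← hT.apply_zero _ ha.1]
      have h3 : ‖(ψ (c a)) 0‖ ≤ ‖ψ (c a)‖ := PiLp.norm_apply_le (ψ (c a)) 0
      have h4 : |σ| = 1 := by
        have := hT.sq_eq; rw [← sq_abs] at this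
        nlinarith [abs_nonneg σ]
      calc σ * (ψ (c a)) 0 ≤ |σ * (ψ (c a)) 0| := le_abs_self _
        _ = ‖(ψ (c a)) 0‖ := by rw [abs_mul, h4, one_mul, Real.norm_eq_abs]
        _ < δ := h3.trans_lt hna
    have hts : s - a ≤ δ / κ := by
      rw [le_div_iff₀ hT.κ_pos]; nlinarith
    refine ⟨⟨ψ (c s), ?_, ψ.left_inv (hs s hst).1⟩, h0.le⟩
    rw [mem_closedBall_zero_iff]
    calc ‖ψ (c s)‖ = ‖ψ (c a) + (ψ (c s) - ψ (c a))‖ := by congr 1; abel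
      _ ≤ ‖ψ (c a)‖ + ‖ψ (c s) - ψ (c a)‖ := norm_add_le _ _
      _ ≤ R := by
        rw [hR]
        exact add_le_add hna.le (h2.trans (mul_le_mul_of_nonneg_left hts hT.C_nonneg))
  have hct : c t ∈ ψ.symm '' Metric.closedBall (0 : Plane) R ∩ {q | 0 ≤ σ * S.γ k q} := by
    have hcl : IsClosed (ψ.symm '' Metric.closedBall (0 : Plane) R ∩ {q | 0 ≤ σ * S.γ k q}) :=
      hKclosed.inter (isClosed_le continuous_const (continuous_const.mul (S.continuous_γ k)))
    have h1 : t ∈ closure (Ico a t) := by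
      rw [closure_Ico ht.1.ne]; exact right_mem_Icc.2 ht.1.le
    have h2 := ((h.1 t (Ioc_subset_Icc_self ht)).mono
      (fun s hs => ⟨hs.1, hs.2.le.trans ht.2⟩ : Ico a t ⊆ Icc a b)).mem_closure h1 hin
    rwa [hcl.closure_eq] at h2
  obtain ⟨⟨z, hz, hzc⟩, h0⟩ := hct
  have hzs : c t ∈ ψ.source := hzc ▸ ψ.map_target (hclB hz)
  have hzb : ψ (c t) ∈ Metric.ball 0 ρ := by
    rw [← hzc, ψ.right_inv (hclB hz)]
    exact Metric.closedBall_subset_ball hT.lt hz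
  refine ⟨hzs, hzb, lt_of_le_of_ne h0 fun h0 => ?_⟩
  have hσ : σ ≠ 0 := by
    rintro rfl; have := hT.sq_eq; norm_num at this
  exact hn t (Ioc_subset_Icc_self ht) (hT.mem_stableSet _ hzs hzb
    ((mul_eq_zero.1 h0.symm).resolve_left hσ))

/-- The end points of free paths are not dense in the half-disc: two such end points on the same
free path lie on the same short arc, which is transverse to the level sets of `γ k`. -/
lemma IsTrap.exists_isOpen [T2Space M] (hT : IsTrap Z k i σ ψ ρ κ C δ) (hr : 1 ≤ r)
    (hZ : Z.IsRegular) (ht : Z.tangencySet.Finite) :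
    ∃ U ⊆ halfDisc S k σ ψ δ, IsOpen U ∧ U.Nonempty ∧ ∀ c a, Z.IsFreePath c a → c a ∉ U := by
  by_contra! hcon
  have hκ := hT.κ_pos
  have hC := hT.C_nonneg
  have hδ := hT.δ_pos
  have hσ : |σ| = 1 := by
    have := hT.sq_eq; rw [← sq_abs] at this
    nlinarith [abs_nonneg σ]
  have := ht.fintype
  set m := Fintype.card Z.tangencySet
  -- `m + 1` points with spacing `d` on one level of `γ k`: if free paths ended near all of them,
  -- two of these free paths would have the same initial point, so that one would extend the other
  set d : ℝ := δ / (4 * (m + 1)) with hd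
  have hdpos : 0 < d := by positivity
  have hd4 : d ≤ δ / 4 := by
    rw [hd, div_le_div_iff₀ (by positivity) (by positivity)]
    have : (0 : ℝ) ≤ m := by positivity
    nlinarith
  set A := 2 * (1 + C / κ) with hA
  have hA1 : 2 ≤ A := by rw [hA]; have := div_nonneg hC hκ.le; linarith
  set ε := d / (2 * A) with hε
  have hεpos : 0 < ε := by positivity
  have hεA : ε * A < d := by
    rw [hε]; field_simp; linarith
  have hεd : ε < d := by nlinarith
  let y : Fin (m + 1) → Plane := fun j =>
    (σ * (δ / 4)) • EuclideanSpace.single 0 1 + (d * j) • EuclideanSpace.single 1 1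
  have hy0 : ∀ j, (y j) 0 = σ * (δ / 4) := by intro j; simp [y]
  have hy1 : ∀ j, (y j) 1 = d * j := by intro j; simp [y]
  have hynorm : ∀ j, ‖y j‖ ≤ δ / 2 := by
    intro j
    have h1 : (d * j : ℝ) ≤ δ / 4 := by
      have hj : ((j : ℕ) : ℝ) ≤ m + 1 := by exact_mod_cast j.2.le
      calc (d * j : ℝ) ≤ d * (m + 1) := mul_le_mul_of_nonneg_left hj hdpos.le
        _ = δ / 4 := by rw [hd]; field_simp
    have h2 : (0 : ℝ) ≤ d * j := by positivity
    refine (norm_add_le _ _).trans ?_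
    rw [norm_smul, norm_smul, PiLp.norm_single, PiLp.norm_single]
    simp only [Real.norm_eq_abs, abs_mul, hσ, abs_one, mul_one, one_mul]
    rw [abs_of_pos (show 0 < δ / 4 by positivity), abs_of_pos hdpos, Nat.abs_cast]
    linarith
  have hball : ∀ j, Metric.ball (y j) ε ⊆ Metric.ball 0 δ := by
    intro j z hz
    rw [mem_ball_zero_iff]
    rw [mem_ball_iff_norm] at hz
    calc ‖z‖ = ‖(z - y j) + y j‖ := by congr 1; abel
      _ ≤ ‖z - y j‖ + ‖y j‖ := norm_add_le _ _
      _ < δ := by linarith [hynorm j]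
  have hex : ∀ j : Fin (m + 1), ∃ (c : ℝ → M) (a : ℝ), Z.IsFreePath c a ∧
      c a ∈ ψ.source ∧ ψ (c a) ∈ Metric.ball (y j) ε ∧ c a ∈ halfDisc S k σ ψ δ := by
    intro j
    have hyt : y j ∈ ψ.target :=
      hT.subset_target (Metric.ball_subset_ball hT.δ_lt.le (hball j (Metric.mem_ball_self hεpos)))
    obtain ⟨c, a, h1, h2⟩ := hcon (ψ.source ∩ ψ ⁻¹' Metric.ball (y j) ε ∩ halfDisc S k σ ψ δ)
      inter_subset_right ((ψ.isOpen_inter_preimage Metric.isOpen_ball).inter isOpen_halfDisc) (by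
        refine ⟨ψ.symm (y j), ⟨ψ.map_target hyt, ?_⟩, ψ.map_target hyt, ?_, ?_⟩
        · simpa [ψ.right_inv hyt] using hεpos
        · rw [ψ.right_inv hyt]; exact hball j (Metric.mem_ball_self hεpos)
        · rw [← hT.apply_zero _ (ψ.map_target hyt), ψ.right_inv hyt, hy0]
          have : σ * (σ * (δ / 4)) = σ ^ 2 * (δ / 4) := by ring
          rw [this, hT.sq_eq]; positivity)
    exact ⟨c, a, h1, h2.1.1, h2.1.2, h2.2⟩
  choose c a hfree hsrc hmem hhalf using hex
  obtain ⟨j, j', hjj, he₀⟩ := Fintype.exists_ne_map_eq_of_card_lt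
    (fun j => (⟨c j 0, (hfree j).mem_tangencySet⟩ : Z.tangencySet)) (by simp [m])
  have he : c j 0 = c j' 0 := congrArg Subtype.val he₀
  clear hcon he₀
  wlog haa : a j ≤ a j' generalizing j j'
  · exact this j' j hjj.symm he.symm (le_of_not_ge haa)
  have heq := (hfree j).eqOn hr hZ ((hfree j').mono (hfree j).nonneg haa) he
  have hca : c j (a j) = c j' (a j) := heq (right_mem_Icc.2 (hfree j).nonneg)
  have hapos : 0 < a j := by
    refine lt_of_le_of_ne (hfree j).nonneg fun h0 => ?_
    refine notMem_of_mem_region (Z := Z) (hT.mem_region_of_mem (hhalf j)) (Or.inl ?_)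
    rw [← h0]; exact (hfree j).mem_stableSet
  have hnS : ∀ t ∈ Icc (a j) (a j'), c j' t ∉ Z.stableSet := by
    intro t ht h
    rcases ht.2.eq_or_lt with rfl | h1
    · exact notMem_of_mem_region (Z := Z) (hT.mem_region_of_mem (hhalf j')) (Or.inl h)
    · exact (hfree j').notMem t ⟨hapos.trans_le ht.1, h1⟩ (Or.inl h)
  have hLT := (hfree j').isRegionTrajectory.isLocalTrajectory.mono hapos.le le_rfl
  obtain ⟨h1, h2⟩ := hT.estimates haa hLT (hT.stay hLT (hca ▸ hhalf j) hnS)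
  rw [← hca, ← hT.apply_zero _ (hsrc j), ← hT.apply_zero _ (hsrc j')] at h1
  rw [← hca] at h2
  have hm := hmem j
  have hm' := hmem j'
  rw [mem_ball_iff_norm] at hm hm'
  have e1 : |(ψ (c j (a j)) - y j) 0| < ε := (PiLp.norm_apply_le _ 0).trans_lt hm
  have e2 : |(ψ (c j' (a j')) - y j') 0| < ε := (PiLp.norm_apply_le _ 0).trans_lt hm'
  have e3 : |(ψ (c j (a j)) - y j) 1| < ε := (PiLp.norm_apply_le _ 1).trans_lt hm
  have e4 : |(ψ (c j' (a j')) - y j') 1| < ε := (PiLp.norm_apply_le _ 1).trans_lt hm'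
  have e5 : |(ψ (c j' (a j')) - ψ (c j (a j))) 1| ≤ C * (a j' - a j) :=
    (PiLp.norm_apply_le _ 1).trans h2
  simp only [PiLp.sub_apply, hy0, hy1] at e1 e2 e3 e4 e5
  -- the extension lasts a short time, since it hardly changes `γ k`, and cannot cover the spacing
  have e6 : κ * (a j' - a j) ≤ 2 * ε := by
    have h3 : κ * (a j' - a j) ≤ σ * ((ψ (c j (a j)) 0 - σ * (δ / 4)) -
        (ψ (c j' (a j')) 0 - σ * (δ / 4))) := by linarith
    refine h3.trans ((le_abs_self _).trans ?_)
    rw [abs_mul, hσ, one_mul]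
    exact (abs_sub _ _).trans (by linarith)
  have e7 : C * (a j' - a j) ≤ C / κ * (2 * ε) := by
    calc C * (a j' - a j) = C / κ * (κ * (a j' - a j)) := by field_simp
      _ ≤ _ := mul_le_mul_of_nonneg_left e6 (div_nonneg hC hκ.le)
  have e8 : d ≤ |d * j - d * j'| := by
    rw [← mul_sub, abs_mul, abs_of_pos hdpos]
    refine le_mul_of_one_le_right hdpos.le ?_
    have : (1 : ℤ) ≤ |((j : ℕ) : ℤ) - ((j' : ℕ) : ℤ)| := by
      refine Int.one_le_abs (sub_ne_zero.2 ?_)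
      intro h
      exact hjj (Fin.ext (by exact_mod_cast h))
    exact_mod_cast this
  have e9 : |d * j - d * j'| ≤ 2 * ε + C / κ * (2 * ε) := by
    rw [abs_lt] at e3 e4
    rw [abs_le] at e5 ⊢
    constructor <;> linarith [e3.1, e3.2, e4.1, e4.2, e5.1, e5.2]
  have : 2 * ε + C / κ * (2 * ε) = ε * A := by rw [hA]; ring
  linarith

end Trap

/-- Both sides of the curve are trapped near a sliding point. -/
lemma exists_isTrap {p : M} (hp : p ∈ Z.slidingRegion) : ∃ k ψ ρ κ C δ, 
    IsTrap Z k (S.posSide k) 1 ψ ρ κ C δ ∧ IsTrap Z k (S.negSide k) (-1) ψ ρ κ C δ := by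
  obtain ⟨k, i, j, hk, hi, hj, h1, h2⟩ := hp
  rw [SwitchingManifold.isPosSide_iff] at hi
  rw [SwitchingManifold.isNegSide_iff] at hj
  subst hi hj
  have hk : S.γ k p = 0 := hk
  obtain ⟨ψ, ρ₀, hψ, hps, hp0, -⟩ := S.exists_isStraightChart hk univ_mem
  set κ := min (- Z.lieDeriv (S.posSide k) k p) (Z.lieDeriv (S.negSide k) k p) / 2 with hκ
  have hκpos : 0 < κ := half_pos (lt_min (neg_pos.2 h1) h2)
  set C := max ‖(Z.field (S.posSide k)).inChart ψ (ψ p)‖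
    ‖(Z.field (S.negSide k)).inChart ψ (ψ p)‖ + 1
    with hC
  have hcF : ∀ i, ContinuousAt (fun q => ‖(Z.field i).inChart ψ (ψ q)‖) p := by
    intro i
    have := ((Z.field i).contDiffAt_inChart (m := 0) hψ.mem_atlas (ψ.map_source hps)
      (by simp)).continuousAt
    exact (ContinuousAt.comp (f := ψ) this (ψ.continuousAt hps)).norm
  have hev : ∀ᶠ q in 𝓝 p, (0 < S.γ k q → q ∈ S.region (S.posSide k)) ∧
      (S.γ k q < 0 → q ∈ S.region (S.negSide k)) ∧ Z.lieDeriv (S.posSide k) k q < -κ ∧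
      κ < Z.lieDeriv (S.negSide k) k q ∧ ‖(Z.field (S.posSide k)).inChart ψ (ψ q)‖ < C ∧
      ‖(Z.field (S.negSide k)).inChart ψ (ψ q)‖ < C := by
    refine (SwitchingManifold.eventually_mem_posSide hk).and
      ((SwitchingManifold.eventually_mem_negSide hk).and (Eventually.and ?_ (Eventually.and ?_
        (Eventually.and ?_ ?_))))
    · refine (Z.continuous_lieDeriv _ _).continuousAt.eventually_lt_const ?_
      have := min_le_left (- Z.lieDeriv (S.posSide k) k p) (Z.lieDeriv (S.negSide k) k p)
      linarith
    · refine (Z.continuous_lieDeriv _ _).continuousAt.eventually_const_lt ?_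
      have := min_le_right (- Z.lieDeriv (S.posSide k) k p) (Z.lieDeriv (S.negSide k) k p)
      linarith
    · exact (hcF _).eventually_lt_const ((le_max_left _ _).trans_lt (lt_add_one _))
    · exact (hcF _).eventually_lt_const ((le_max_right _ _).trans_lt (lt_add_one _))
  have hC0 : 0 ≤ C := by positivity
  have h0t : (0 : Plane) ∈ ψ.target := by rw [hψ.target_eq]; exact Metric.mem_ball_self hψ.pos
  have hpe : ψ.symm 0 = p := by rw [← hp0, ψ.left_inv hps]
  have hct : Tendsto ψ.symm (𝓝 0) (𝓝 p) := hpe ▸ (ψ.continuousAt_symm h0t).tendsto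
  obtain ⟨ρ₁, hρ₁, hb⟩ := Metric.eventually_nhds_iff_ball.1 (hct.eventually hev)
  set ρ := min ρ₀ ρ₁
  have hρ : 0 < ρ := lt_min hψ.pos hρ₁
  have hb' : ∀ q ∈ ψ.source, ψ q ∈ Metric.ball 0 ρ → _ := fun q hq hqb =>
    (ψ.left_inv hq) ▸ hb (ψ q) (Metric.ball_subset_ball (min_le_right _ _) hqb)
  have hsub : Metric.ball 0 ρ ⊆ ψ.target := by
    rw [hψ.target_eq]; exact Metric.ball_subset_ball (min_le_left _ _)
  set δ := ρ / (2 * (1 + C / κ))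
  have hden : 0 < 1 + C / κ := by positivity
  have hδ : 0 < δ := by positivity
  have hlt : δ + C * (δ / κ) < ρ := by
    have : δ + C * (δ / κ) = δ * (1 + C / κ) := by ring
    rw [this]
    have : δ * (1 + C / κ) = ρ / 2 := by simp only [δ]; field_simp
    linarith
  have hst : ∀ q ∈ ψ.source, ψ q ∈ Metric.ball 0 ρ → S.γ k q = 0 → q ∈ Z.stableSet := by
    intro q hq hqb h0
    obtain ⟨-, -, h3, h4, -⟩ := hb' q hq hqb
    exact ⟨k, h0, by linarith, by linarith⟩
  refine ⟨k, ψ, ρ, κ, C, δ, ⟨hψ.mem_atlas, hsub, hψ.apply_zero, by norm_num, ?_, ?_, ?_, hst,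
    hκpos, hC0, hδ, hlt⟩, ⟨hψ.mem_atlas, hsub, hψ.apply_zero, by norm_num, ?_, ?_, ?_, hst,
    hκpos, hC0, hδ, hlt⟩⟩
  · intro q hq hqb h; exact (hb' q hq hqb).1 (by simpa using h)
  · intro q hq hqb; rw [one_mul]; exact (hb' q hq hqb).2.2.1.le
  · intro q hq hqb; exact (hb' q hq hqb).2.2.2.2.1.le
  · intro q hq hqb h; exact (hb' q hq hqb).2.1 (by linarith)
  · intro q hq hqb; have := (hb' q hq hqb).2.2.2.1; linarith
  · intro q hq hqb; exact (hb' q hq hqb).2.2.2.2.2.le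

/-- A regular field with a sliding point and without connections is not transitive. -/
theorem not_isTransitive [T2Space M] (hr : 1 ≤ r) (hZ : Z.IsRegular) (ht : Z.tangencySet.Finite)
    (hs : Z.slidingRegion.Nonempty) (hno : ∀ c a, ¬ Z.IsConnection c a) : ¬ Z.IsTransitive := by
  intro htr
  obtain ⟨p, hp⟩ := hs
  obtain ⟨k, ψ, ρ, κ, C, δ, hT, hT'⟩ := exists_isTrap hp
  obtain ⟨U, hUs, hUo, hUne, hU⟩ := hT.exists_isOpen hr hZ ht
  obtain ⟨V, hVs, hVo, hVne, hV⟩ := hT'.exists_isOpen hr hZ ht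
  obtain ⟨J, c, hc, ⟨s, hsJ, hsU⟩, t, htJ, htV⟩ := htr U V hUo hUne hVo hVne
  -- to go from one half-disc to the other a trajectory has to meet the stable set; it then arrives
  -- along a free path
  have key : ∀ {i j : Fin (n + 1)} {σ : ℝ} {a b : ℝ}, IsTrap Z k i σ ψ ρ κ C δ →
      Z.IsConcatenation c a b → a ≤ b → c a ∈ halfDisc S k σ ψ δ → σ * S.γ k (c b) < 0 →
      c b ∈ S.region j → ∃ d x, Z.IsFreePath d x ∧ d x = c b := by
    intro i j σ a b hT hcab hab ha hb hbj
    have hL := hcab.isLocalTrajectory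
    have hbS : c b ∉ Z.stableSet := fun h => notMem_of_mem_region (Z := Z) hbj (Or.inl h)
    obtain ⟨s₀, hs₀, hs₀S⟩ : ∃ s₀ ∈ Icc a b, c s₀ ∈ Z.stableSet := by
      by_contra! hcon
      exact (hT.stay hL ha hcon b (right_mem_Icc.2 hab)).2.2.not_gt hb
    obtain ⟨s, hs, hfree⟩ := hL.exists_isFreePath hZ hno hs₀ hs₀S hbS
    exact ⟨_, _, hfree, by simp⟩
  have hsU' := hUs hsU
  have htV' := hVs htV
  rcases le_total s t with hst | hst
  · obtain ⟨d, x, h1, h2⟩ := key hT (hc.1.2.2 s hsJ t htJ hst) hst hsU'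
      (by have := htV'.2.2; linarith) (hT'.mem_region_of_mem htV')
    exact hV d x h1 (h2 ▸ htV)
  · obtain ⟨d, x, h1, h2⟩ := key hT' (hc.1.2.2 t htJ s hsJ hst) hst htV'
      (by have := hsU'.2.2; linarith) (hT.mem_region_of_mem hsU')
    exact hU d x h1 (h2 ▸ hsU)

end PSVF

/-! ### Removing the double tangencies -/

/-- By the theorem of Sard, a differentiable function of a real variable has arbitrarily small
regular values, whose level sets in a compact set are finite. -/
lemma exists_finite_level {F F' : ℝ → ℝ} {K : Set ℝ} (hK : IsCompact K)
    (hd : ∀ x ∈ K, HasDerivAt F (F' x) x) {ε : ℝ} (hε : 0 < ε) :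
    ∃ s ∈ Ioo 0 ε, {x ∈ K | F x = -s}.Finite := by
  set Cr := {x ∈ K | F' x = 0} with hCr
  have h0 : MeasureTheory.volume (F '' Cr) = 0 := by
    refine MeasureTheory.addHaar_image_eq_zero_of_det_fderivWithin_eq_zero
      (f' := fun _ => (0 : ℝ →L[ℝ] ℝ)) _ (fun x hx => ?_) (fun x hx => ?_)
    · have := (hd x hx.1).hasFDerivAt.hasFDerivWithinAt (s := Cr)
      rw [hx.2] at this
      simpa using this
    · simp [ContinuousLinearMap.det]
  obtain ⟨y, hy, hyC⟩ : ∃ y ∈ Ioo (-ε) 0, y ∉ F '' Cr := by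
    by_contra! hcon
    have h1 := MeasureTheory.measure_mono (μ := MeasureTheory.volume)
      (show Ioo (-ε) 0 ⊆ F '' Cr from hcon)
    rw [h0, Real.volume_Ioo] at h1
    simp at h1
    linarith
  refine ⟨-y, ⟨by linarith [hy.2], by linarith [hy.1]⟩, ?_⟩
  by_contra hinf
  obtain ⟨x, hxK, hx⟩ := Set.Infinite.exists_accPt_of_subset_isCompact hinf hK (sep_subset _ _)
  have hfreq : ∃ᶠ z in 𝓝[≠] x, F z = y := by
    refine (accPt_iff_frequently_nhdsNE.1 hx).mono fun z hz => ?_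
    simpa using hz.2
  have hFx : F x = y := by
    by_contra hne
    have := ((hd x hxK).continuousAt.eventually_ne hne).filter_mono
      (nhdsWithin_le_nhds (s := {x}ᶜ))
    obtain ⟨z, h1, h2⟩ := (hfreq.and_eventually this).exists
    exact h2 h1
  have hne : F' x ≠ 0 := fun h => hyC ⟨x, ⟨hxK, h⟩, hFx⟩
  obtain ⟨z, h1, h2⟩ := (hfreq.and_eventually ((hd x hxK).eventually_ne (c := y) hne)).exists
  exact h2 h1

namespace PSVF

variable {M : Type*} [TopologicalSpace M] [ChartedSpace Plane M] [IsManifold (𝓡 2) ∞ M]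
  {n : ℕ} {S : SwitchingManifold M n} {r : ℕ∞} {Z : PSVF S r}

/-- Adding small multiples of a fixed field to one of the fields is a small perturbation. -/
lemma tendsto_update_add_smul (Z : PSVF S r) (i : Fin (n + 1)) (Y : VField M r) :
    Tendsto (fun s : ℝ => (⟨Function.update Z.field i (Z.field i + s • Y)⟩ : PSVF S r)) (𝓝 0)
      (𝓝 Z) := by
  refine tendsto_nhds_of_inChart fun j e K m he hK hKe hm ε hε => ?_
  have hc : ContinuousOn (fun p => iteratedFDeriv ℝ m (Y.inChart e) (e p)) K :=
    (Y.continuousOn_iteratedFDeriv_inChart he hm).comp (e.continuousOn.mono hKe)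
      fun p hp => e.map_source (hKe hp)
  obtain ⟨C, hC⟩ := hK.exists_bound_of_continuousOn hc
  have hsmall : ∀ᶠ s : ℝ in 𝓝 0, |s| * C < ε := by
    have : Tendsto (fun s : ℝ => |s| * C) (𝓝 0) (𝓝 0) := by
      have h : Continuous (fun s : ℝ => |s| * C) := by fun_prop
      simpa using h.tendsto 0
    exact this.eventually_lt_const hε
  filter_upwards [hsmall] with s hs p hp
  by_cases hj : j = i
  · subst hj
    have h1 : Function.update Z.field j (Z.field j + s • Y) j - Z.field j = s • Y := by simp
    simp only [h1]
    rw [VField.inChart_smul, iteratedFDeriv_const_smul_apply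
      (Y.contDiffAt_inChart he (e.map_source (hKe hp)) hm), norm_smul, Real.norm_eq_abs]
    exact (mul_le_mul_of_nonneg_left (hC p hp) (abs_nonneg s)).trans_lt hs
  · have h1 : Function.update Z.field i (Z.field i + s • Y) j - Z.field j = (0 : ℝ) • Y := by
      simp [hj]
    simp only [h1]
    rw [VField.inChart_smul, iteratedFDeriv_const_smul_apply
      (Y.contDiffAt_inChart he (e.map_source (hKe hp)) hm), norm_smul]
    simpa using hε

/-- The points at which the fields on both sides of a curve are tangent to it. -/
def doubleTangencySet (Z : PSVF S r) : Set M :=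
  {p | ∃ k, S.γ k p = 0 ∧ Z.lieDeriv (S.posSide k) k p = 0 ∧ Z.lieDeriv (S.negSide k) k p = 0}

lemma doubleTangencySet_subset : Z.doubleTangencySet ⊆ Z.tangencySet := by
  rintro p ⟨k, hk, h1, -⟩
  exact mem_tangencySet_iff.2 ⟨k, hk, Or.inl h1⟩

lemma isRegular_iff : Z.IsRegular ↔ Z.doubleTangencySet = ∅ := by
  rw [eq_empty_iff_forall_notMem]
  exact ⟨fun h p ⟨k, hk, h1, h2⟩ => h k p hk h1 h2, fun h k p hk h1 h2 => h p ⟨k, hk, h1, h2⟩⟩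

/-- A small perturbation removes one double tangency, creates no new ones, and keeps the set of
tangency points finite. -/
lemma frequently_doubleTangencySet_ssubset [T2Space M] (hr : 1 ≤ r) (ht : Z.tangencySet.Finite)
    {p p₀ : M} (hp : p ∈ Z.doubleTangencySet) (hp₀ : p₀ ∈ Z.slidingRegion) :
    ∃ᶠ Z' in 𝓝 Z, Z'.tangencySet.Finite ∧ p₀ ∈ Z'.slidingRegion ∧
      Z'.doubleTangencySet ⊂ Z.doubleTangencySet := by
  obtain ⟨k, hk, hpos, hneg⟩ := hp
  have hne : p₀ ≠ p := by
    rintro rfl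
    obtain ⟨l, i, j, hl, hi, hj, h1, h2⟩ := hp₀
    obtain rfl := SwitchingManifold.eq_of_γ_eq_zero hk hl
    rw [SwitchingManifold.isPosSide_iff] at hi
    subst hi
    exact h1.ne hpos
  have hU : (Z.tangencySet \ {p})ᶜ ∩ {p₀}ᶜ ∈ 𝓝 p :=
    inter_mem ((ht.subset sdiff_subset).isClosed.isOpen_compl.mem_nhds (by simp))
      (isOpen_compl_singleton.mem_nhds hne.symm)
  obtain ⟨ψ, ρ, hψ, hps, hp0, hsub⟩ := S.exists_isStraightChart hk hU
  have hTp : ∀ q ∈ ψ.source, q ∈ Z.tangencySet → q = p := fun q hq hqT => by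
    by_contra h; exact (hsub hq).1 ⟨hqT, h⟩
  have hp₀s : p₀ ∉ ψ.source := fun h => (hsub h).2 rfl
  set i := S.posSide k with hi
  -- the perturbation is constant, in the chart, near `p`
  let g : ContDiffBump (0 : Plane) := ⟨ρ / 4, ρ / 2, by linarith [hψ.pos], by linarith [hψ.pos]⟩
  have hgB : ∀ x ∉ Metric.closedBall (0 : Plane) (ρ / 2), g x = 0 := fun x hx =>
    g.zero_of_le_dist (by rw [Metric.mem_closedBall, not_le] at hx; exact hx.le)
  have hBt : Metric.closedBall (0 : Plane) (ρ / 2) ⊆ ψ.target := by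
    rw [hψ.target_eq]; exact Metric.closedBall_subset_ball (by linarith [hψ.pos])
  obtain ⟨Y, hY⟩ := VField.exists_isChartField (r := r) hψ.mem_atlas g.contDiff
    (isCompact_closedBall (0 : Plane) (ρ / 2)) hgB hBt (EuclideanSpace.single 0 (1 : ℝ))
  let F : ℝ → PSVF S r := fun s => ⟨Function.update Z.field i (Z.field i + s • Y)⟩
  have hF : ∀ s, (F s).field i = Z.field i + s • Y := fun s => by simp [F]
  have hFj : ∀ s j, j ≠ i → (F s).field j = Z.field j := fun s j hj => by simp [F, hj]
  have hlie : ∀ s q, q ∈ ψ.source → (F s).lieDeriv i k q = Z.lieDeriv i k q + s * g (ψ q) := by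
    intro s q hq
    rw [hψ.lieDeriv_eq _ _ hq, hψ.lieDeriv_eq _ _ hq, hF, VField.inChart_add, VField.inChart_smul]
    simp [hY.inChart_eq (ψ.map_source hq)]
  have hlien : ∀ s q, (F s).lieDeriv (S.negSide k) k q = Z.lieDeriv (S.negSide k) k q := by
    intro s q
    rw [lieDeriv, hFj s _ (S.posSide_ne_negSide k).symm, lieDeriv]
  have hlieo : ∀ s q j l, q ∉ ψ.source → (F s).lieDeriv j l q = Z.lieDeriv j l q := by
    intro s q j l hq
    by_cases hj : j = i
    · subst hj
      rw [lieDeriv, hF, lieDeriv, ContMDiffSection.coe_add, Pi.add_apply,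
        ContMDiffSection.coe_smul, Pi.smul_apply, hY.2 q hq, smul_zero, add_zero]
    · rw [lieDeriv, hFj s j hj, lieDeriv]
  have hcurve : ∀ q ∈ ψ.source, ∀ l, S.γ l q = 0 → l = k := fun q hq l hl => by
    by_contra h; exact hψ.ne_zero q hq l h hl
  -- the Lie derivative does not vanish near the boundary of the support of the perturbation
  let L : ℝ → Plane := fun x => x • EuclideanSpace.single 1 (1 : ℝ)
  have hL : Continuous L := by fun_prop
  have hLn : ∀ x, ‖L x‖ = |x| := fun x => by simp [L, norm_smul]
  have hL0 : ∀ x, (L x) 0 = 0 := fun x => by simp [L]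
  have hLq : ∀ z : Plane, z 0 = 0 → z = L (z 1) := by
    intro z hz; ext j; fin_cases j
    · simpa [L] using hz
    · simp [L]
  have hLt : ∀ x, |x| < ρ → L x ∈ ψ.target := fun x hx => by
    rw [hψ.target_eq]; simpa [hLn] using hx
  let f : ℝ → ℝ := fun x => ((Z.field i).inChart ψ (L x)) 0
  have hfq : ∀ q ∈ ψ.source, S.γ k q = 0 → f ((ψ q) 1) = Z.lieDeriv i k q := by
    intro q hq h0
    rw [hψ.lieDeriv_eq _ _ hq]
    simp only [f]
    rw [← hLq _ (by rw [hψ.apply_zero q hq, h0])]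
  have hfd : ∀ x, |x| < ρ → DifferentiableAt ℝ f x := by
    intro x hx
    have h1 : DifferentiableAt ℝ ((Z.field i).inChart ψ) (L x) :=
      ((Z.field i).contDiffAt_inChart (m := 1) hψ.mem_atlas (hLt x hx)
        (by exact_mod_cast hr)).differentiableAt (by simp)
    have h2 : DifferentiableAt ℝ L x := by fun_prop
    have h3 : DifferentiableAt ℝ (fun x => (Z.field i).inChart ψ (L x)) x := h1.comp x h2
    exact (EuclideanSpace.proj 0 : Plane →L[ℝ] ℝ).differentiableAt.comp x h3
  have hfne : ∀ x, |x| < ρ → x ≠ 0 → f x ≠ 0 := by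
    intro x hx hx0 hfx
    have hxt := hLt x hx
    have hxs := ψ.map_target hxt
    have hγ : S.γ k (ψ.symm (L x)) = 0 := by
      rw [← hψ.apply_zero _ hxs, ψ.right_inv hxt, hL0]
    have h1 : ψ.symm (L x) ∈ Z.tangencySet := by
      refine mem_tangencySet_iff.2 ⟨k, hγ, Or.inl ?_⟩
      rw [← hfq _ hxs hγ, ψ.right_inv hxt]
      simpa [L] using hfx
    have h2 := hTp _ hxs h1
    have h3 : L x = 0 := by rw [← ψ.right_inv hxt, h2, hp0]
    have := hLn x
    rw [h3, norm_zero] at this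
    exact hx0 (abs_eq_zero.1 this.symm)
  obtain ⟨m, hm, hmf⟩ : ∃ m > 0, ∀ x, ρ / 4 ≤ |x| → |x| ≤ ρ / 2 → m ≤ |f x| := by
    have hcpt : IsCompact {x : ℝ | ρ / 4 ≤ |x| ∧ |x| ≤ ρ / 2} := by
      have h1 : IsClosed {x : ℝ | ρ / 4 ≤ |x| ∧ |x| ≤ ρ / 2} :=
        (isClosed_le continuous_const continuous_abs).inter
          (isClosed_le continuous_abs continuous_const)
      refine (isCompact_Icc (a := -(ρ / 2)) (b := ρ / 2)).of_isClosed_subset h1 fun x hx => ?_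
      exact abs_le.1 hx.2
    have hfc : ContinuousOn (fun x => |f x|) {x : ℝ | ρ / 4 ≤ |x| ∧ |x| ≤ ρ / 2} := fun x hx =>
      (hfd x (by linarith [hx.2, hψ.pos])).continuousAt.abs.continuousWithinAt
    obtain ⟨x, hx, hmin⟩ := hcpt.exists_isMinOn
      ⟨ρ / 2, by rw [mem_ofPred_eq, abs_of_pos (by linarith [hψ.pos])]
                 constructor <;> linarith [hψ.pos]⟩ hfc
    refine ⟨|f x|, abs_pos.2 (hfne x (by linarith [hx.2, hψ.pos]) ?_), fun y h1 h2 =>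
      hmin ⟨h1, h2⟩⟩
    rintro rfl
    have := hx.1
    rw [abs_zero] at this
    linarith [hψ.pos]
  -- for arbitrarily small `s`, adding `s` to `f` creates finitely many zeros where the bump is `1`
  have hfreq : ∃ᶠ s : ℝ in 𝓝 0, 0 < s ∧ s < m ∧ {x ∈ Icc (-(ρ / 4)) (ρ / 4) | f x = -s}.Finite := by
    rw [Metric.nhds_basis_ball.frequently_iff]
    intro ε hε
    obtain ⟨s, hs, hfin⟩ := exists_finite_level (F := f) (F' := deriv f)
      (isCompact_Icc (a := -(ρ / 4)) (b := ρ / 4))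
      (fun x hx => (hfd x
        (by rw [abs_lt]; constructor <;> linarith [hx.1, hx.2, hψ.pos])).hasDerivAt)
      (lt_min hε hm)
    refine ⟨s, ?_, hs.1, hs.2.trans_le (min_le_right _ _), hfin⟩
    rw [mem_ball_zero_iff, Real.norm_eq_abs, abs_of_pos hs.1]
    exact hs.2.trans_le (min_le_left _ _)
  refine (tendsto_update_add_smul Z i Y).frequently (hfreq.mono ?_)
  rintro s ⟨hs0, hsm, hfin⟩
  change (F s).tangencySet.Finite ∧ p₀ ∈ (F s).slidingRegion ∧
    (F s).doubleTangencySet ⊂ Z.doubleTangencySet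
  have hg0 : g (0 : Plane) = 1 := g.one_of_mem_closedBall (Metric.mem_closedBall_self g.rIn_pos.le)
  refine ⟨?_, ?_, ?_⟩
  · refine (ht.union (hfin.image fun x => ψ.symm (L x))).subset fun q hq => ?_
    obtain ⟨l, hl, h⟩ := mem_tangencySet_iff.1 hq
    by_cases hqs : q ∈ ψ.source
    · obtain rfl := hcurve q hqs l hl
      rw [hlie s q hqs, hlien] at h
      rcases h with h | h
      -- new zeros: finitely many where the bump is `1`, none where it decreases to `0`
      · rw [← hfq q hqs hl] at h
        set x := (ψ q) 1
        have hz : ψ q = L x := hLq _ (by rw [hψ.apply_zero q hqs, hl])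
        rcases le_or_gt |x| (ρ / 4) with hx | hx
        · right
          have h1 : g (ψ q) = 1 := g.one_of_mem_closedBall (by simpa [hz, hLn] using hx)
          rw [h1] at h
          exact ⟨x, ⟨abs_le.1 hx, by linarith⟩, by simp only; rw [← hz, ψ.left_inv hqs]⟩
        · rcases le_or_gt |x| (ρ / 2) with hx2 | hx2
          · exfalso
            have h1 := hmf x hx.le hx2
            have h2 : f x = - (s * g (ψ q)) := by linarith
            rw [h2, abs_neg, abs_mul, abs_of_pos hs0, abs_of_nonneg g.nonneg] at h1
            have := mul_le_mul_of_nonneg_left (g.le_one (x := ψ q)) hs0.le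
            linarith
          · left
            have h1 : g (ψ q) = 0 := hgB _ (by simpa [hz, hLn] using hx2)
            rw [h1, mul_zero, add_zero, hfq q hqs hl] at h
            exact mem_tangencySet_iff.2 ⟨l, hl, Or.inl h⟩
      · exact Or.inl (mem_tangencySet_iff.2 ⟨l, hl, Or.inr h⟩)
    · left
      rw [hlieo s q _ _ hqs, hlieo s q _ _ hqs] at h
      exact mem_tangencySet_iff.2 ⟨l, hl, h⟩
  · obtain ⟨l, a, b, hl, ha, hb, h1, h2⟩ := hp₀
    exact ⟨l, a, b, hl, ha, hb, by rwa [hlieo s _ _ _ hp₀s], by rwa [hlieo s _ _ _ hp₀s]⟩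
  · have hpn : p ∉ (F s).doubleTangencySet := by
      rintro ⟨l, hl, h1, -⟩
      obtain rfl := hcurve p hps l hl
      rw [hlie s p hps, hp0, hg0, hpos] at h1
      linarith
    refine (ssubset_iff_of_subset ?_).2 ⟨p, ⟨k, hk, hpos, hneg⟩, hpn⟩
    rintro q ⟨l, hl, h1, h2⟩
    by_cases hqs : q ∈ ψ.source
    · obtain rfl := hcurve q hqs l hl
      rw [hlien] at h2
      have := hTp q hqs (mem_tangencySet_iff.2 ⟨l, hl, Or.inr h2⟩)
      subst this
      exact ⟨l, hk, hpos, hneg⟩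
    · rw [hlieo s q _ _ hqs] at h1 h2
      exact ⟨l, hl, h1, h2⟩

/-- The double tangencies are removed one at a time, by induction on a bound `m` of their number. -/
lemma frequently_isRegular [T2Space M] (hr : 1 ≤ r) {p₀ : M} : ∀ (m : ℕ) (Z : PSVF S r),
    Z.tangencySet.Finite → p₀ ∈ Z.slidingRegion → Z.doubleTangencySet.ncard ≤ m →
    ∃ᶠ Z' in 𝓝 Z, Z'.tangencySet.Finite ∧ p₀ ∈ Z'.slidingRegion ∧ Z'.IsRegular := by
  intro m
  induction m with
  | zero =>
    intro Z ht hp hm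
    have := (Set.ncard_eq_zero (ht.subset doubleTangencySet_subset)).1 (Nat.le_zero.1 hm)
    intro h
    exact h.self_of_nhds ⟨ht, hp, isRegular_iff.2 this⟩
  | succ m ih =>
    intro Z ht hp hm
    rcases Z.doubleTangencySet.eq_empty_or_nonempty with he | ⟨p, hpd⟩
    · exact ih Z ht hp (by simp [he])
    intro h
    have h1 := eventually_eventually_nhds.2 h
    obtain ⟨Z', ⟨h2, h3, h4⟩, h5⟩ :=
      ((frequently_doubleTangencySet_ssubset hr ht hpd hp).and_eventually h1).exists
    have := Set.ncard_lt_ncard h4 (ht.subset doubleTangencySet_subset)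
    exact ih Z' h2 h3 (by omega) h5

end PSVF

/-! ### Curves pushed to one side of a planar field -/

/-- A continuous function on an interval has a primitive. -/
lemma exists_primitive {f : ℝ → ℝ} {T : ℝ} (hT : 0 ≤ T) (hf : ContinuousOn f (Icc 0 T)) :
    ∃ P : ℝ → ℝ, P 0 = 0 ∧ Continuous P ∧ ∀ t ∈ Ioo 0 T, HasDerivAt P (f t) t := by
  set G := IccExtend hT ((Icc (0 : ℝ) T).domRestrict f)
  have hG : Continuous G := (continuousOn_iff_continuous_domRestrict.1 hf).Icc_extend'
  have hd : ∀ t, HasDerivAt (fun t => ∫ s in (0 : ℝ)..t, G s) (G t) t := fun t =>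
    intervalIntegral.integral_hasDerivAt_right (hG.intervalIntegrable _ _)
      hG.stronglyMeasurable.stronglyMeasurableAtFilter hG.continuousAt
  refine ⟨fun t => ∫ s in (0 : ℝ)..t, G s, by simp,
    continuous_iff_continuousAt.2 fun t => (hd t).continuousAt, fun t ht => ?_⟩
  have : G t = f t := by
    simp only [G]; rw [IccExtend_of_mem hT _ (Ioo_subset_Icc_self ht)]; rfl
  exact this ▸ hd t

section

variable {E : Type*} [NormedAddCommGroup E] [InnerProductSpace ℝ E]

/-- The elementary inequality behind `eq_of_pushed_curve`: a displacement that is nearly parallel to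
`v` is not nearly parallel to a vector `w` orthogonal to `v`. -/
lemma eq_zero_of_smul_add_eq {v w x D : E} {s P : ℝ} (hv : v ≠ 0) (hw : ‖w‖ = 1)
    (hvw : inner ℝ v w = 0) (hs : 0 ≤ s) (hP : 0 ≤ P) (hx : ‖x - s • v‖ ≤ ‖v‖ / 8 * s)
    (hD : ‖D‖ ≤ P / 8) (h : x = P • w + D ∨ x = -(P • w + D)) : s = 0 ∧ P = 0 := by
  have hv0 : 0 < ‖v‖ := norm_pos_iff.2 hv
  wlog hxe : x = P • w + D generalizing w D
  · have hxe' := h.resolve_left hxe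
    refine this (w := -w) (D := -D) (by rwa [norm_neg]) (by rw [inner_neg_right, hvw, neg_zero])
      (by rwa [norm_neg]) (Or.inl ?_) ?_ <;> rw [hxe'] <;> simp [add_comm]
  have hvw' : inner ℝ w v = 0 := by rw [real_inner_comm]; exact hvw
  -- the components along `w` and along `v`
  have h1 : 7 * P ≤ ‖v‖ * s := by
    have e1 : inner ℝ (x - s • v) w = P + inner ℝ D w := by
      rw [hxe, inner_sub_left, inner_add_left, real_inner_smul_left, real_inner_smul_left, hvw,
        real_inner_self_eq_norm_sq, hw]; ring
    have e2 := (abs_le.1 (abs_real_inner_le_norm (x - s • v) w)).2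
    have e3 := (abs_le.1 (abs_real_inner_le_norm D w)).1
    rw [hw, mul_one] at e2 e3
    linarith
  have h2 : 7 * (‖v‖ * s) ≤ P := by
    have e1 : inner ℝ (x - s • v) v = inner ℝ D v - s * ‖v‖ ^ 2 := by
      rw [hxe, inner_sub_left, inner_add_left, real_inner_smul_left, real_inner_smul_left, hvw',
        real_inner_self_eq_norm_sq]; ring
    have e2 := (abs_le.1 (abs_real_inner_le_norm (x - s • v) v)).1
    have e3 := (abs_le.1 (abs_real_inner_le_norm D v)).2
    have e4 : ‖x - s • v‖ * ‖v‖ ≤ ‖v‖ / 8 * s * ‖v‖ := mul_le_mul_of_nonneg_right hx hv0.le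
    have e5 : ‖D‖ * ‖v‖ ≤ P / 8 * ‖v‖ := mul_le_mul_of_nonneg_right hD hv0.le
    have e6 : (7 * (‖v‖ * s)) * ‖v‖ ≤ P * ‖v‖ := by nlinarith
    exact le_of_mul_le_mul_right e6 hv0
  have h3 : ‖v‖ * s = 0 := by nlinarith [mul_nonneg hv0.le hs]
  refine ⟨(mul_eq_zero.1 h3).resolve_left hv0.ne', by linarith⟩

/-- A field `F` that is almost constant is pushed to one side of its trajectories. A short
trajectory `c` of the pushed field `F + g w` cannot have both its end points on the same trajectory
`φ` of `F`, unless it is not pushed at all. -/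
lemma eq_of_pushed_curve {F : E → E} {g : E → ℝ} {B : Set E} {L h T T' : ℝ} {c φ : ℝ → E}
    {v w : E} (hF : ∀ x ∈ B, ‖F x - v‖ ≤ ‖v‖ / 8)
    (hL : ∀ x ∈ B, ∀ y ∈ B, ‖F x - F y‖ ≤ L * ‖x - y‖) (hL0 : 0 ≤ L) (hLh : L * h ≤ 1 / 9)
    (hv : v ≠ 0) (hw : ‖w‖ = 1) (hvw : inner ℝ v w = 0) (hg : Continuous g) (hg0 : ∀ x, 0 ≤ g x)
    (hT : 0 ≤ T) (hTh : T ≤ h) (hT' : 0 < T')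
    (hc : ContinuousOn c (Icc 0 T)) (hφ : ContinuousOn φ (Icc 0 T'))
    (hcd : ∀ t ∈ Ioo 0 T, HasDerivAt c (F (c t) + g (c t) • w) t)
    (hφd : ∀ t ∈ Ioo 0 T', HasDerivAt φ (F (φ t)) t)
    (hcB : ∀ t ∈ Icc 0 T, c t ∈ B) (hφB : ∀ t ∈ Icc 0 T', φ t ∈ B)
    (h0 : c 0 = φ 0) (hend : c T = φ T') :
    T = T' ∧ EqOn c φ (Icc 0 T) ∧ ∀ t ∈ Icc 0 T, g (c t) = 0 := by
  -- `P t` is the total push up to the time `t`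
  obtain ⟨P, hP0, hPc, hPd⟩ := exists_primitive hT (hg.comp_continuousOn hc)
  have hPmono : MonotoneOn P (Icc 0 T) := by
    refine monotoneOn_of_deriv_nonneg (convex_Icc _ _) hPc.continuousOn ?_ ?_
    · rw [interior_Icc]; exact fun t ht => (hPd t ht).differentiableAt.differentiableWithinAt
    · rw [interior_Icc]; intro t ht; rw [(hPd t ht).deriv]; exact hg0 _
  have hPT : ∀ t ∈ Icc 0 T, 0 ≤ P t ∧ P t ≤ P T := fun t ht =>
    ⟨hP0 ▸ hPmono (left_mem_Icc.2 hT) ht ht.1, hPmono ht (right_mem_Icc.2 hT) ht.2⟩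
  have hPT0 : 0 ≤ P T := (hPT T (right_mem_Icc.2 hT)).1
  set m := min T T' with hm
  have hm0 : 0 ≤ m := le_min hT hT'.le
  have hmT : m ≤ T := min_le_left _ _
  have hmT' : m ≤ T' := min_le_right _ _
  -- the pushed curve is displaced by `P t • w`, up to an error `D` with `‖D‖ ≤ P T / 8`
  set D : ℝ → E := fun t => c t - φ t - P t • w with hDdef
  have hDc : ContinuousOn D (Icc 0 m) :=
    ((hc.mono (Icc_subset_Icc_right hmT)).sub (hφ.mono (Icc_subset_Icc_right hmT'))).sub
      (hPc.continuousOn.smul continuousOn_const)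
  have hDd : ∀ t ∈ Ioo 0 m, HasDerivAt D (F (c t) - F (φ t)) t := by
    intro t ht
    have h1 := ((hcd t ⟨ht.1, ht.2.trans_le hmT⟩).sub (hφd t ⟨ht.1, ht.2.trans_le hmT'⟩)).sub
      ((hPd t ⟨ht.1, ht.2.trans_le hmT⟩).smul_const w)
    exact HasDerivAt.congr_deriv h1 (by simp only [Function.comp]; abel)
  have hD0 : D 0 = 0 := by simp [hDdef, h0, hP0]
  have hDle : ∀ t ∈ Icc 0 m, ‖D t‖ ≤ P T / 8 := by
    obtain ⟨u, hu, hmax⟩ := isCompact_Icc.exists_isMaxOn (nonempty_Icc.2 hm0) hDc.norm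
    have hmax' : ∀ t ∈ Icc 0 m, ‖D t‖ ≤ ‖D u‖ := fun t ht => hmax ht
    have h1 : ‖D u - D 0‖ ≤ L * (‖D u‖ + P T) * (u - 0) := by
      refine norm_sub_le_of_hasDerivAt_Ioo hu.1 (hDc.mono (Icc_subset_Icc_right hu.2))
        (fun t ht => hDd t ⟨ht.1, ht.2.trans_le hu.2⟩) fun t ht => ?_
      have htm : t ≤ m := ht.2.le.trans hu.2
      have h2 := hL (c t) (hcB t ⟨ht.1.le, htm.trans hmT⟩) (φ t) (hφB t ⟨ht.1.le, htm.trans hmT'⟩)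
      refine h2.trans (mul_le_mul_of_nonneg_left ?_ hL0)
      have h3 : c t - φ t = D t + P t • w := by simp [hDdef]
      rw [h3]
      refine (norm_add_le _ _).trans (add_le_add (hmax' t ⟨ht.1.le, htm⟩) ?_)
      have h4 := hPT t ⟨ht.1.le, htm.trans hmT⟩
      rw [norm_smul, hw, mul_one, Real.norm_eq_abs, abs_of_nonneg h4.1]
      exact h4.2
    rw [hD0, sub_zero, sub_zero] at h1
    have h5 : L * (‖D u‖ + P T) * u ≤ (‖D u‖ + P T) * (1 / 9) := by
      have h6 : L * u ≤ 1 / 9 :=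
        (mul_le_mul_of_nonneg_left (hu.2.trans (hmT.trans hTh)) hL0).trans hLh
      have h7 : 0 ≤ ‖D u‖ + P T := by positivity
      nlinarith
    intro t ht
    have := hmax' t ht
    linarith
  have hDm := hDle m (right_mem_Icc.2 hm0)
  -- one of the two curves runs on for a time `|T' - T|`, nearly in the direction `v`, and this has
  -- to compensate for the displacement, nearly in the direction `w`
  have hfin : T = T' ∧ P T = 0 := by
    rcases le_total T T' with hle | hle
    · have hmeq : m = T := min_eq_left hle
      have h1 : ‖(φ T' - T' • v) - (φ T - T • v)‖ ≤ ‖v‖ / 8 * (T' - T) := by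
        refine norm_sub_le_of_hasDerivAt_Ioo (f := fun t => φ t - t • v)
          (f' := fun t => F (φ t) - v) hle ?_ (fun t ht => ?_) fun t ht => ?_
        · exact (hφ.mono (Icc_subset_Icc_left hT)).sub (by fun_prop)
        · have h2 := (hφd t ⟨hT.trans_lt ht.1, ht.2⟩).sub ((hasDerivAt_id t).smul_const v)
          rw [one_smul] at h2
          exact h2
        · exact hF _ (hφB t ⟨hT.trans ht.1.le, ht.2.le⟩)
      have h2 := eq_zero_of_smul_add_eq (x := φ T' - φ T) (s := T' - T) (P := P T) (D := D m) hv hw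
        hvw (sub_nonneg.2 hle) hPT0 (by
          refine le_trans (le_of_eq ?_) h1
          congr 1; rw [sub_smul]; abel) hDm (Or.inl (by
          rw [← hend, hmeq]; simp only [hDdef]; abel))
      exact ⟨by linarith [h2.1], h2.2⟩
    · have hmeq : m = T' := min_eq_right hle
      have h1 : ‖(c T - T • v - P T • w) - (c T' - T' • v - P T' • w)‖ ≤ ‖v‖ / 8 * (T - T') := by
        refine norm_sub_le_of_hasDerivAt_Ioo (f := fun t => c t - t • v - P t • w)
          (f' := fun t => F (c t) - v) hle ?_ (fun t ht => ?_) fun t ht => ?_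
        · exact ((hc.mono (Icc_subset_Icc_left hT'.le)).sub (by fun_prop)).sub
            (hPc.continuousOn.smul continuousOn_const)
        · have h2 := ((hcd t ⟨hT'.trans ht.1, ht.2⟩).sub
            ((hasDerivAt_id t).smul_const v)).sub ((hPd t ⟨hT'.trans ht.1, ht.2⟩).smul_const w)
          exact HasDerivAt.congr_deriv h2 (by simp only [Function.comp, one_smul]; abel)
        · exact hF _ (hcB t ⟨hT'.le.trans ht.1.le, ht.2.le⟩)
      have h2 := eq_zero_of_smul_add_eq (x := c T - c T' - (P T - P T') • w) (s := T - T')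
        (P := P T) (D := D m) hv hw hvw (sub_nonneg.2 hle) hPT0 (by
          refine le_trans (le_of_eq ?_) h1
          congr 1; rw [sub_smul, sub_smul]; abel) hDm (Or.inr (by
          rw [hend, hmeq]; simp only [hDdef, sub_smul]; abel))
      exact ⟨by linarith [h2.1], h2.2⟩
  obtain ⟨hTT, hPz⟩ := hfin
  have hmeq : m = T := by rw [hm, ← hTT, min_self]
  have hP : ∀ t ∈ Icc 0 T, P t = 0 := fun t ht => le_antisymm (hPz ▸ (hPT t ht).2) (hPT t ht).1
  refine ⟨hTT, fun t ht => ?_, ?_⟩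
  · have h1 := hDle t (hmeq ▸ ht)
    rw [hPz, zero_div] at h1
    have h2 := norm_le_zero_iff.1 h1
    simp only [hDdef, hP t ht, zero_smul, sub_zero] at h2
    exact sub_eq_zero.1 h2
  · have hgc : ContinuousOn (fun t => g (c t)) (Icc 0 T) := hg.comp_continuousOn hc
    have hin : ∀ t ∈ Ioo 0 T, g (c t) = 0 := by
      intro t ht
      have h1 : P =ᶠ[𝓝 t] fun _ => 0 := by
        filter_upwards [Ioo_mem_nhds ht.1 ht.2] with x hx using hP x (Ioo_subset_Icc_self hx)
      have := (hPd t ht).unique ((hasDerivAt_const t (0 : ℝ)).congr_of_eventuallyEq h1)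
      exact this
    intro t ht
    have hcl : t ∈ closure (Ioo 0 T) := by rwa [closure_Ioo (hTT ▸ hT').ne]
    have := ((hgc t ht).mono Ioo_subset_Icc_self).mem_closure hcl (t := {0}) hin
    simpa using this

end

/-! ### Free paths of fields that agree on the switching manifold -/

namespace PSVF

variable {M : Type*} [TopologicalSpace M] [ChartedSpace Plane M] [IsManifold (𝓡 2) ∞ M]
  {n : ℕ} {S : SwitchingManifold M n} {r : ℕ∞} {Z Z' : PSVF S r}

section AgreeOnCurves

/-- Two piecewise-smooth vector fields that have the same values on the switching manifold. -/
def AgreeOnCurves (Z Z' : PSVF S r) : Prop :=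
  ∀ k p, S.γ k p = 0 → ∀ i, Z.field i p = Z'.field i p

lemma lieDeriv_congr {i : Fin (n + 1)} {k : Fin n} {p : M} (h : Z.field i p = Z'.field i p) :
    Z.lieDeriv i k p = Z'.lieDeriv i k p := by
  rw [lieDeriv, h, lieDeriv]

lemma AgreeOnCurves.lieDeriv_eq (h : AgreeOnCurves Z Z') {k l : Fin n} {p : M}
    (hp : S.γ l p = 0) (i : Fin (n + 1)) : Z.lieDeriv i k p = Z'.lieDeriv i k p :=
  lieDeriv_congr (h l p hp i)

lemma AgreeOnCurves.symm (h : AgreeOnCurves Z Z') : AgreeOnCurves Z' Z :=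
  fun k p hp i => (h k p hp i).symm

lemma AgreeOnCurves.stableSet_eq (h : AgreeOnCurves Z Z') : Z.stableSet = Z'.stableSet := by
  ext p
  refine exists_congr fun k => and_congr_right fun hk => ?_
  rw [h.lieDeriv_eq hk, h.lieDeriv_eq hk]

lemma AgreeOnCurves.unstableSet_eq (h : AgreeOnCurves Z Z') :
    Z.unstableSet = Z'.unstableSet := by
  ext p
  refine exists_congr fun k => and_congr_right fun hk => ?_
  rw [h.lieDeriv_eq hk, h.lieDeriv_eq hk]

lemma AgreeOnCurves.tangencySet_eq (h : AgreeOnCurves Z Z') :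
    Z.tangencySet = Z'.tangencySet := by
  ext p
  rw [mem_tangencySet_iff, mem_tangencySet_iff]
  refine exists_congr fun k => and_congr_right fun hk => ?_
  rw [h.lieDeriv_eq hk, h.lieDeriv_eq hk]

lemma AgreeOnCurves.isRegular (h : AgreeOnCurves Z Z') (hZ : Z.IsRegular) : Z'.IsRegular := by
  intro k p hk h1
  rw [← h.lieDeriv_eq hk] at h1 ⊢
  exact hZ k p hk h1

lemma AgreeOnCurves.slidingRegion_subset (h : AgreeOnCurves Z Z') :
    Z.slidingRegion ⊆ Z'.slidingRegion := by
  rintro p ⟨k, i, j, hk, hi, hj, h1, h2⟩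
  exact ⟨k, i, j, hk, hi, hj, by rwa [← h.lieDeriv_eq hk], by rwa [← h.lieDeriv_eq hk]⟩

end AgreeOnCurves

lemma IsArcOf.of_field_eq {i : Fin (n + 1)} {c : ℝ → M} {a b : ℝ} (h : Z.IsArcOf i c a b)
    (hf : ∀ t ∈ Ioo a b, Z.field i (c t) = Z'.field i (c t)) : Z'.IsArcOf i c a b := by
  refine ⟨h.1, h.2.1, ?_⟩
  rw [VField.isMIntegralCurveOn_Ioo_iff]
  intro t ht
  rw [← hf t ht]
  exact VField.hasMFDerivAt_of_isMIntegralCurveOn h.2.2 ht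

lemma IsRegionTrajectory.of_field_eq {c : ℝ → M} {a b : ℝ} (h : Z.IsRegionTrajectory c a b)
    (hf : ∀ t ∈ Ioo a b, ∀ i, Z.field i (c t) = Z'.field i (c t)) :
    Z'.IsRegionTrajectory c a b := by
  refine ⟨h.1, fun t ht => ?_, fun t ht => ?_⟩
  · obtain ⟨u, hu, i, hi⟩ := h.2.1 t ht
    exact ⟨u, hu, i, hi.of_field_eq fun x hx =>
      hf x ⟨ht.1.trans_lt hx.1, hx.2.trans_le hu.2⟩ i⟩
  · obtain ⟨u, hu, i, hi⟩ := h.2.2 t ht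
    exact ⟨u, hu, i, hi.of_field_eq fun x hx =>
      hf x ⟨hu.1.trans_lt hx.1, hx.2.trans_le ht.2⟩ i⟩

/-- A free path on which two fields agree is a free path of both. -/
lemma IsFreePath.of_field_eq (hZ : AgreeOnCurves Z Z') {c : ℝ → M} {a : ℝ} (h : Z.IsFreePath c a)
    (hf : ∀ t ∈ Ioo 0 a, ∀ i, Z.field i (c t) = Z'.field i (c t)) : Z'.IsFreePath c a :=
  ⟨h.nonneg, hZ.stableSet_eq ▸ h.mem_stableSet, hZ.tangencySet_eq ▸ h.mem_tangencySet,
    h.isRegionTrajectory.of_field_eq hf, by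
      rw [← hZ.stableSet_eq, ← hZ.unstableSet_eq]; exact h.notMem⟩

lemma IsFreePath.notMem_region_zero {c : ℝ → M} {a : ℝ} (h : Z.IsFreePath c a)
    {i : Fin (n + 1)} : c 0 ∉ S.region i := fun h0 =>
  notMem_of_mem_region (Z := Z) h0 (Or.inl h.mem_stableSet)

/-- A free path that arrives in the region `i` has followed the trajectory of the field `i` for as
long as that trajectory has been in the region. -/
lemma IsFreePath.eqOn_of_isArcOf [T2Space M] (hr : 1 ≤ r) {c d : ℝ → M} {τ y : ℝ}
    {i : Fin (n + 1)} (hc : Z.IsFreePath c τ) (hτ : 0 < τ) (hy : 0 ≤ y)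
    (hd : Z.IsArcOf i d (τ - y) τ) (hreg : ∀ t ∈ Ico (τ - y) τ, d t ∈ S.region i)
    (he : c τ = d τ) (hfin : d τ ∈ S.region i ∨ ∃ s ∈ Ico 0 τ, Z.IsArcOf i c s τ) :
    y < τ ∧ EqOn c d (Icc (τ - y) τ) := by
  set a := max 0 (τ - y) with ha
  have ha0 : 0 ≤ a := le_max_left _ _
  have hay : τ - y ≤ a := le_max_right _ _
  have haτ : a ≤ τ := max_le hτ.le (by linarith)
  have hm : MapsTo (fun u => τ - u) (Icc 0 (τ - a)) (Icc a τ) := fun u hu =>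
    ⟨by linarith [hu.2], by linarith [hu.1]⟩
  have hc1 : ContinuousOn (fun u => c (τ - u)) (Icc 0 (τ - a)) :=
    (hc.isRegionTrajectory.1.mono (Icc_subset_Icc_left ha0)).comp (by fun_prop) hm
  have hd1 : ContinuousOn (fun u => d (τ - u)) (Icc 0 (τ - a)) :=
    (hd.1.mono (Icc_subset_Icc_left hay)).comp (by fun_prop) hm
  have hclosed : IsClosed ({u | c (τ - u) = d (τ - u)} ∩ Icc 0 (τ - a)) := by
    have := (hc1.prodMk hd1).preimage_isClosed_of_isClosed isClosed_Icc isClosed_diagonal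
    rw [inter_comm]; exact this
  have hsub := hclosed.Icc_subset_of_forall_exists_gt (a := 0) (by simpa using he) (by
    rintro u ⟨hue, hu⟩ z hz
    have hue : c (τ - u) = d (τ - u) := hue
    have hx0 : a < τ - u := by linarith [hu.2]
    have hxτ : τ - u ≤ τ := by linarith [hu.1]
    obtain ⟨s, hs, hsi⟩ : ∃ s ∈ Ico 0 (τ - u), Z.IsArcOf i c s (τ - u) := by
      have hregion : d (τ - u) ∈ S.region i → ∃ s ∈ Ico 0 (τ - u), Z.IsArcOf i c s (τ - u) := by
        intro hdi
        obtain ⟨s, hs, j, hj⟩ := hc.isRegionTrajectory.2.2 (τ - u) ⟨ha0.trans_lt hx0, hxτ⟩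
        have := S.eq_of_mem_closure_region (hj.2.1 _ (right_mem_Icc.2 hs.2.le)) (hue ▸ hdi)
        exact ⟨s, hs, this ▸ hj⟩
      rcases hu.1.eq_or_lt with rfl | hu0
      · rcases hfin with h | h
        · exact hregion (by simpa using h)
        · simpa using h
      · exact hregion (hreg _ ⟨hay.trans hx0.le, by linarith⟩)
    set w := max (max s a) (τ - z)
    have hwx : w < τ - u := max_lt (max_lt hs.2 hx0) (by linarith [mem_Ioi.1 hz])
    have hsw : s ≤ w := (le_max_left _ _).trans (le_max_left _ _)
    have haw : a ≤ w := (le_max_right _ _).trans (le_max_left _ _)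
    have hzw : τ - z ≤ w := le_max_right _ _
    have h1 := hsi.mono hsw le_rfl
    have h2 := hd.mono (hay.trans haw) hxτ
    have h3 := VField.eqOn_Icc_of_right hr h1.1 h2.1 h1.2.2 h2.2.2 hue (left_mem_Icc.2 hwx.le)
    exact ⟨τ - w, by simpa using h3, by linarith, by linarith⟩)
  have heq : EqOn c d (Icc a τ) := by
    intro t ht
    have hmem : τ - t ∈ Icc 0 (τ - a) := ⟨by linarith [ht.2], by linarith [ht.1]⟩
    simpa using hsub hmem
  have hyτ : y < τ := by
    by_contra! hcon
    have ha' : a = 0 := max_eq_left (by linarith)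
    have h1 := heq (x := 0) ⟨ha'.le, hτ.le⟩
    exact hc.notMem_region_zero (h1 ▸ hreg 0 ⟨by linarith, hτ⟩)
  have ha' : a = τ - y := max_eq_right (by linarith)
  exact ⟨hyτ, ha' ▸ heq⟩

/-- The extension of a free path by an arc that stays in a region. -/
lemma IsFreePath.extend {c d : ℝ → M} {τ b : ℝ} {i : Fin (n + 1)} (hc : Z.IsFreePath c τ)
    (hb : τ < b) (hd : Z.IsArcOf i d τ b) (hreg : ∀ t ∈ Ico τ b, d t ∈ S.region i)
    (he : c τ = d τ) : Z.IsFreePath (fun t => if t ≤ τ then c t else d t) b := by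
  have h1 : EqOn c (fun t => if t ≤ τ then c t else d t) (Icc 0 τ) := fun t ht => by
    simp [ht.2]
  have h2 : EqOn d (fun t => if t ≤ τ then c t else d t) (Icc τ b) := fun t ht => by
    rcases ht.1.eq_or_lt with rfl | h
    · simp [he]
    · simp [h.not_ge]
  refine ⟨hc.nonneg.trans hb.le, ?_, ?_, (hc.isRegionTrajectory.congr h1).append hc.nonneg hb.le
    (hd.isRegionTrajectory.congr h2), fun t ht => ?_⟩
  · simpa [hc.nonneg] using hc.mem_stableSet
  · simpa [hc.nonneg] using hc.mem_tangencySet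
  · rcases lt_or_ge t τ with h | h
    · simpa [h.le] using hc.notMem t ⟨ht.1, h⟩
    · have h3 := h2 ⟨h, ht.2.le⟩
      simp only at h3 ⊢
      rw [← h3]
      exact notMem_of_mem_region (hreg t ⟨h, ht.2⟩)

/-- The last arc of a connection. -/
lemma IsConnection.exists_isArcOf (hZ : Z.IsRegular) {c : ℝ → M} {a : ℝ}
    (h : Z.IsConnection c a) : 0 < a ∧ ∃ i, ∃ s ∈ Ico 0 a, Z.IsArcOf i c s a ∧
      ∀ t ∈ Ico s a, c t ∈ S.region i := by
  have ha : 0 < a := by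
    refine lt_of_le_of_ne h.1.nonneg fun h0 => ?_
    have h2 := h.2
    rw [← h0] at h2
    exact disjoint_left.1 hZ.disjoint h.1.mem_stableSet h2
  obtain ⟨s, hs, i, hi⟩ := h.1.isRegionTrajectory.2.2 a ⟨ha, le_rfl⟩
  have h1 : (s + a) / 2 < a := by linarith [hs.2]
  have h2 : s < (s + a) / 2 := by linarith [hs.2]
  refine ⟨ha, i, (s + a) / 2, ⟨hs.1.trans h2.le, h1⟩, hi.mono h2.le le_rfl, fun t ht => ?_⟩
  exact hi.mem_region ⟨h2.trans_le ht.1, ht.2⟩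
    (h.1.notMem t ⟨hs.1.trans_lt (h2.trans_le ht.1), ht.2⟩)

/-- Near a point `b` of the region `i`, the free paths of bounded duration only arrive along the
trajectory `β` of `b`. -/
lemma eventually_eq_arc [T2Space M] (hr : 1 ≤ r) (hZ : Z.IsRegular) (ht : Z.tangencySet.Finite)
    {i : Fin (n + 1)} {β : ℝ → M} {h₀ : ℝ} (h₀pos : 0 < h₀)
    (hβ : IsMIntegralCurveOn β (fun p => Z.field i p) (Ioo (-h₀) h₀)) (hb : β 0 ∈ S.region i)
    (A : ℝ) {κ : ℝ} (hκ : 0 < κ) :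
    ∀ᶠ e in 𝓝 (β 0), ∀ c τ, Z.IsFreePath c τ → τ ≤ A → c τ = e → ∃ x, |x| < κ ∧ e = β x := by
  obtain ⟨V, hV, h, hh, hflow⟩ := VField.exists_isMIntegralCurveOn_uniform hr (Z.field i) (β 0)
    ((S.isOpen_region i).mem_nhds hb)
  -- free paths with the same initial point and durations differing by at most `δ` end on one
  -- trajectory, at times differing by at most `δ`
  set δ := min h (min κ h₀) / 4 with hδ
  have hδpos : 0 < δ := by positivity
  have h4 : 4 * δ = min h (min κ h₀) := by rw [hδ]; ring
  have hδh : 4 * δ ≤ h := h4 ▸ min_le_left _ _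
  have hδκ : 4 * δ ≤ κ := h4 ▸ (min_le_right _ _).trans (min_le_left _ _)
  have hδh₀ : 4 * δ ≤ h₀ := h4 ▸ (min_le_right _ _).trans (min_le_right _ _)
  -- it is enough to consider one initial point, and durations in a short interval
  suffices key : ∀ t ∈ Z.tangencySet, ∀ m : ℕ, ∀ᶠ e in 𝓝 (β 0), ∀ c τ, Z.IsFreePath c τ → c 0 = t →
      τ ∈ Icc (m * δ) ((m + 1) * δ) → c τ = e → ∃ x, |x| < κ ∧ e = β x by
    obtain ⟨K, hK⟩ := exists_nat_gt (A / δ)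
    have h1 : ∀ᶠ e in 𝓝 (β 0), ∀ t ∈ Z.tangencySet, ∀ m ∈ Set.Iio K, ∀ c τ, Z.IsFreePath c τ →
        c 0 = t → τ ∈ Icc (m * δ) ((m + 1) * δ) → c τ = e → ∃ x, |x| < κ ∧ e = β x :=
      (eventually_all_finite ht).2 fun t htt =>
        (eventually_all_finite (Set.finite_Iio K)).2 fun m _ => key t htt m
    filter_upwards [h1] with e he c τ hc hτA hce
    have hτ0 : 0 ≤ τ / δ := div_nonneg hc.nonneg hδpos.le
    refine he (c 0) hc.mem_tangencySet ⌊τ / δ⌋₊ ?_ c τ hc rfl ⟨?_, ?_⟩ hce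
    · rw [Set.mem_Iio, Nat.floor_lt hτ0]
      exact (div_le_div_of_nonneg_right hτA hδpos.le).trans_lt hK
    · rw [← le_div_iff₀ hδpos]; exact Nat.floor_le hτ0
    · rw [← div_le_iff₀ hδpos]; exact (Nat.lt_floor_add_one _).le
  intro t _ m
  by_contra hnot
  rw [not_eventually] at hnot
  obtain ⟨e₀, hbad₀, he₀V⟩ := (hnot.and_eventually hV).exists
  push Not at hbad₀
  obtain ⟨c₀, τ₀, hc₀, hct₀, hτ₀, hce₀, hx₀⟩ := hbad₀
  obtain ⟨d, hd0, hd, hdreg⟩ := hflow e₀ he₀V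
  have hdc : ContinuousOn d (Ioo (-h) h) := hd.continuousOn
  have harc : ∀ a b, -h < a → b < h → Z.IsArcOf i d a b := fun a b ha hb =>
    ⟨hdc.mono fun x hx => ⟨ha.trans_le hx.1, hx.2.trans_lt hb⟩,
      fun x hx => subset_closure (hdreg x ⟨ha.trans_le hx.1, hx.2.trans_lt hb⟩),
      hd.mono fun x hx => ⟨ha.trans hx.1, hx.2.trans hb⟩⟩
  have he₀r : e₀ ∈ S.region i := hd0 ▸ hdreg 0 ⟨by linarith, hh⟩
  -- all the other end points are on the trajectory of `e₀`
  have hon : ∃ᶠ e in 𝓝 (β 0), e ∈ d '' Icc (-δ) δ := by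
    refine hnot.mono fun e hbad => ?_
    push Not at hbad
    obtain ⟨c, τ, hc, hct, hτ, hce, -⟩ := hbad
    have hdiff : |τ - τ₀| ≤ δ := by
      rw [abs_le]
      constructor <;> nlinarith [hτ.1, hτ.2, hτ₀.1, hτ₀.2]
    refine ⟨τ - τ₀, abs_le.1 hdiff, ?_⟩
    rw [abs_le] at hdiff
    rcases le_or_gt τ τ₀ with hle | hlt
    · rcases hle.eq_or_lt with rfl | hlt
      · have := hc.eqOn hr hZ hc₀ (hct.trans hct₀.symm) (right_mem_Icc.2 hc.nonneg)
        rw [sub_self, hd0, ← hce, this, hce₀]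
      have hsh := (harc (τ - τ₀) 0 (by linarith) hh).comp_add (-τ₀)
      have e1 : τ - τ₀ - -τ₀ = τ₀ - (τ₀ - τ) := by ring
      have e2 : 0 - -τ₀ = τ₀ := by ring
      rw [e1, e2] at hsh
      have h1 := hc₀.eqOn_of_isArcOf hr (hc.nonneg.trans_lt hlt) (y := τ₀ - τ) (by linarith) hsh
        (fun x hx => hdreg _ ⟨by linarith [hx.1], by linarith [hx.2]⟩)
        (by simp [hd0, hce₀]) (Or.inl (by simpa [hd0] using he₀r))
      have h2 := h1.2 (x := τ) ⟨by linarith, hlt.le⟩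
      have h3 := hc.eqOn hr hZ (hc₀.mono hc.nonneg hlt.le) (hct.trans hct₀.symm)
        (right_mem_Icc.2 hc.nonneg)
      rw [← hce, h3, h2, sub_eq_add_neg]
    · have hsh := (harc 0 (τ - τ₀) (by linarith) (by linarith)).comp_add (-τ₀)
      have e1 : τ - τ₀ - -τ₀ = τ := by ring
      have e2 : 0 - -τ₀ = τ₀ := by ring
      rw [e1, e2] at hsh
      have h1 := hc₀.extend hlt hsh
        (fun x hx => hdreg _ ⟨by linarith [hx.1], by linarith [hx.2]⟩) (by simp [hd0, hce₀])
      have h2 := hc.eqOn hr hZ h1 (by simp [hc₀.nonneg, hct, hct₀]) (right_mem_Icc.2 hc.nonneg)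
      rw [← hce, h2]
      simp [hlt.not_ge, sub_eq_add_neg]
  have hcl : IsClosed (d '' Icc (-δ) δ) :=
    (isCompact_Icc.image_of_continuousOn (harc (-δ) δ (by linarith) (by linarith)).1).isClosed
  obtain ⟨x₀, hx₀I, hdx₀⟩ := hcl.closure_eq ▸ mem_closure_iff_frequently.2 hon
  refine hx₀ (-x₀) (by rw [abs_neg, abs_lt]; constructor <;> linarith [hx₀I.1, hx₀I.2]) ?_
  have hsh : ∀ a b, -h < a + x₀ → b + x₀ < h → ContinuousOn (fun s => d (s + x₀)) (Icc a b) ∧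
      IsMIntegralCurveOn (fun s => d (s + x₀)) (fun p => Z.field i p) (Ioo a b) := by
    intro a b ha hb
    have := (harc (a + x₀) (b + x₀) ha hb).comp_add x₀
    simp only [add_sub_cancel_right] at this
    exact ⟨this.1, this.2.2⟩
  have hβ' : ∀ a b, -h₀ < a → b < h₀ → ContinuousOn β (Icc a b) ∧
      IsMIntegralCurveOn β (fun p => Z.field i p) (Ioo a b) := fun a b ha hb =>
    ⟨hβ.continuousOn.mono fun x hx => ⟨ha.trans_le hx.1, hx.2.trans_lt hb⟩,
      hβ.mono fun x hx => ⟨ha.trans hx.1, hx.2.trans hb⟩⟩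
  rcases le_total x₀ 0 with hneg | hpos
  · obtain ⟨a1, a2⟩ := hsh 0 (-x₀) (by linarith [hx₀I.1]) (by linarith)
    obtain ⟨b1, b2⟩ := hβ' 0 (-x₀) (by linarith) (by linarith [hx₀I.1])
    have := VField.eqOn_Icc_of_left hr a1 b1 a2 b2 (by simp [hdx₀])
      (right_mem_Icc.2 (by linarith))
    simpa [hd0] using this
  · obtain ⟨a1, a2⟩ := hsh (-x₀) 0 (by linarith) (by linarith [hx₀I.2])
    obtain ⟨b1, b2⟩ := hβ' (-x₀) 0 (by linarith [hx₀I.2]) (by linarith)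
    have := VField.eqOn_Icc_of_right hr a1 b1 a2 b2 (by simp [hdx₀])
      (left_mem_Icc.2 (by linarith))
    simpa [hd0] using this

end PSVF

/-! ### The data for breaking the connections -/

namespace PSVF

variable {M : Type*} [TopologicalSpace M] [ChartedSpace Plane M] [IsManifold (𝓡 2) ∞ M]
  {n : ℕ} {S : SwitchingManifold M n} {r : ℕ∞} {Z : PSVF S r}

/-- The data that are needed to break the connections of `Z`. For each `j`, `β j` is an arc that
arrives, from the inside of the region `i j`, at a point of the unstable set, and every such arc is
one of them near its end. The fields will be modified near the point `β j (-α)`, in the disc of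
radius `R j` of the chart `φ j`, in which the field is close to the constant `v j`; the
modification is a multiple of the vector `w j`, which is orthogonal to `v j`. -/
structure BreakData (Z : PSVF S r) (ι : Type*) where
  /-- the region of the arc -/
  i : ι → Fin (n + 1)
  /-- the arc -/
  β : ι → ℝ → M
  /-- the chart in which the field is modified -/
  φ : ι → OpenPartialHomeomorph M Plane
  /-- the approximate value of the field -/
  v : ι → Plane
  /-- the direction of the modification -/
  w : ι → Plane
  /-- the radius of the disc -/
  R : ι → ℝ
  /-- a Lipschitz constant of the field in the disc -/
  L : ι → ℝ
  /-- a bound of the field in the disc -/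
  C : ι → ℝ
  /-- half the duration of the arcs -/
  α : ℝ
  /-- a unit of time -/
  κ : ℝ
  /-- a bound for the size of the modifications -/
  ε : ℝ
  α_pos : 0 < α
  κ_pos : 0 < κ
  ε_pos : 0 < ε
  two_κ_le : 2 * κ ≤ α
  ε_le_one : ε ≤ 1
  ε_le : ∀ j, ε ≤ ‖v j‖ / 16
  isArcOf : ∀ j, Z.IsArcOf (i j) (β j) (-(2 * α)) 0
  mem_region : ∀ j, ∀ t ∈ Ico (-(2 * α)) 0, β j t ∈ S.region (i j)
  mem_unstableSet : ∀ j, β j 0 ∈ Z.unstableSet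
  exists_eq : ∀ k c a, a < 0 → Z.IsArcOf k c a 0 → c 0 ∈ Z.unstableSet →
    (∀ t ∈ Ico a 0, c t ∈ S.region k) → ∃ j, β j 0 = c 0 ∧ i j = k
  mem_atlas : ∀ j, φ j ∈ IsManifold.maximalAtlas (𝓡 2) ∞ M
  source_subset : ∀ j, (φ j).source ⊆ S.region (i j)
  disjoint_source : ∀ j j', j ≠ j' → Disjoint (φ j).source (φ j').source
  notMem_source : ∀ j j', j ≠ j' → ∀ t ∈ Icc (-(2 * α)) 0, β j' t ∉ (φ j).source
  mem_source : ∀ j, ∀ x ∈ Icc 0 (2 * κ), β j (-α - x) ∈ (φ j).source ∧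
    φ j (β j (-α - x)) ∈ Metric.ball (φ j (β j (-α))) (R j / 2)
  R_pos : ∀ j, 0 < R j
  ball_subset : ∀ j, Metric.closedBall (φ j (β j (-α))) (R j) ⊆ (φ j).target
  v_ne_zero : ∀ j, v j ≠ 0
  norm_w : ∀ j, ‖w j‖ = 1
  inner_eq_zero : ∀ j, inner ℝ (v j) (w j) = 0
  L_nonneg : ∀ j, 0 ≤ L j
  C_nonneg : ∀ j, 0 ≤ C j
  norm_sub_le : ∀ j, ∀ x ∈ Metric.closedBall (φ j (β j (-α))) (R j),
    ∀ y ∈ Metric.closedBall (φ j (β j (-α))) (R j),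
    ‖(Z.field (i j)).inChart (φ j) x - (Z.field (i j)).inChart (φ j) y‖ ≤ L j * ‖x - y‖
  norm_sub_v_le : ∀ j, ∀ x ∈ Metric.closedBall (φ j (β j (-α))) (R j),
    ‖(Z.field (i j)).inChart (φ j) x - v j‖ ≤ ‖v j‖ / 16
  norm_le : ∀ j, ∀ x ∈ Metric.closedBall (φ j (β j (-α))) (R j),
    ‖(Z.field (i j)).inChart (φ j) x‖ ≤ C j
  L_mul_le : ∀ j, (L j + 1) * (3 * κ) ≤ 1 / 9
  C_mul_lt : ∀ j, (C j + 1) * (3 * κ) < R j / 2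

lemma _root_.Plane.exists_orthogonal {v : Plane} (hv : v ≠ 0) :
    ∃ w : Plane, ‖w‖ = 1 ∧ inner ℝ v w = 0 := by
  have hn : 0 < ‖v‖ := norm_pos_iff.2 hv
  refine ⟨‖v‖⁻¹ • !₂[-(v 1), v 0], ?_, ?_⟩
  · rw [norm_smul, norm_inv, norm_norm, inv_mul_eq_one₀ hn.ne', EuclideanSpace.norm_eq,
      EuclideanSpace.norm_eq]
    simp [Fin.sum_univ_two, add_comm]
  · rw [real_inner_smul_right]
    simp [PiLp.inner_apply, Fin.sum_univ_two]
    right; ring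

/-- An arc can arrive at a point of the unstable set only if its field is tangent to the curve
there. -/
lemma IsArcOf.mem_unstableSet_right {i : Fin (n + 1)} {c : ℝ → M} {a : ℝ} (ha : a < 0)
    (h : Z.IsArcOf i c a 0) (h0 : c 0 ∈ Z.unstableSet) : ∃ k, S.γ k (c 0) = 0 ∧
      ((i = S.posSide k ∧ Z.lieDeriv (S.posSide k) k (c 0) = 0) ∨
        (i = S.negSide k ∧ Z.lieDeriv (S.negSide k) k (c 0) = 0)) := by
  obtain ⟨k, hk, h1, h2⟩ := h0
  rcases h.lieDeriv_right ha hk with ⟨rfl, h3⟩ | ⟨rfl, h3⟩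
  · exact ⟨k, hk, Or.inl ⟨rfl, le_antisymm h3 h1⟩⟩
  · exact ⟨k, hk, Or.inr ⟨rfl, le_antisymm h2 h3⟩⟩

/-- Two arcs that arrive at the unstable set from the inside of the same region and that meet before
that arrive at the same point. -/
lemma IsArcOf.eq_of_eq [T2Space M] (hr : 1 ≤ r) {i : Fin (n + 1)} {c d : ℝ → M} {a s t : ℝ}
    (hc : Z.IsArcOf i c a 0) (hd : Z.IsArcOf i d a 0) (hd0 : ∀ t ∈ Ico a 0, d t ∈ S.region i)
    (hcu : c 0 ∈ Z.unstableSet) (ha : a ≤ s)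
    (hst : s ≤ t) (ht0 : t ≤ 0) (h : c t = d s) : s = t ∧ c 0 = d 0 := by
  have h1 := (hc.mono (ha.trans hst) le_rfl).comp_add t
  have h2 := (hd.mono ha (show s - t ≤ 0 by linarith)).comp_add s
  have e1 : s - t - s = 0 - t := by ring
  rw [sub_self] at h1 h2
  rw [e1] at h2
  have := VField.eqOn_Icc_of_left hr h1.1 h2.1 h1.2.2 h2.2.2 (by simpa using h)
    (right_mem_Icc.2 (by linarith))
  simp only [sub_add_cancel] at this
  have e2 : 0 - t + s = s - t := by ring
  rw [e2] at this
  rcases hst.eq_or_lt with rfl | hlt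
  · exact ⟨rfl, by simpa using this⟩
  · exfalso
    have h3 := hd0 (s - t) ⟨by linarith, by linarith⟩
    rw [← this] at h3
    exact notMem_of_mem_region (Z := Z) h3 (Or.inr hcu)

/-- Arcs arrive at the unstable set from the inside of a region only at tangency points, hence at
finitely many points, and from one side only, since there is no double tangency. The arcs at
different points are disjoint, so that they can be modified independently. -/
lemma exists_breakData [T2Space M] (hr : 1 ≤ r) (hZ : Z.IsRegular) (ht : Z.tangencySet.Finite) :
    ∃ Q : Set M, Q.Finite ∧ Nonempty (BreakData Z Q) := by
  classical
  set Q : Set M := {p | p ∈ Z.unstableSet ∧ ∃ k c a, a < 0 ∧ Z.IsArcOf k c a 0 ∧ c 0 = p ∧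
    ∀ t ∈ Ico a 0, c t ∈ S.region k} with hQ
  have hQf : Q.Finite := by
    refine ht.subset ?_
    rintro p ⟨hp, k, c, a, ha, hc, rfl, -⟩
    obtain ⟨l, hl, h | h⟩ := hc.mem_unstableSet_right ha hp
    · exact mem_tangencySet_iff.2 ⟨l, hl, Or.inl h.2⟩
    · exact mem_tangencySet_iff.2 ⟨l, hl, Or.inr h.2⟩
  have : Finite Q := hQf
  have hex : ∀ q : Q, ∃ k c a, a < 0 ∧ Z.IsArcOf k c a 0 ∧ c 0 = q ∧
    ∀ t ∈ Ico a 0, c t ∈ S.region k := fun q => q.2.2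
  choose i β a ha hβ hβ0 hβr using hex
  have hβu : ∀ j, β j 0 ∈ Z.unstableSet := fun j => hβ0 j ▸ j.2.1
  -- a common duration
  obtain ⟨α, hαa, hα⟩ : ∃ α : ℝ, (∀ j, a j ≤ -(2 * α)) ∧ 0 < α := by
    have h1 : ∀ᶠ α : ℝ in 𝓝[>] 0, ∀ j, a j ≤ -(2 * α) := by
      refine eventually_all.2 fun j => ?_
      have : Tendsto (fun α : ℝ => -(2 * α)) (𝓝[>] 0) (𝓝 0) := by
        have h : Continuous (fun α : ℝ => -(2 * α)) := by fun_prop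
        simpa using (h.tendsto 0).mono_left nhdsWithin_le_nhds
      exact (this.eventually_const_lt (ha j)).mono fun _ h => h.le
    exact (h1.and self_mem_nhdsWithin).exists
  have harc : ∀ j, Z.IsArcOf (i j) (β j) (-(2 * α)) 0 := fun j => (hβ j).mono (hαa j) le_rfl
  have hreg : ∀ j, ∀ t ∈ Ico (-(2 * α)) 0, β j t ∈ S.region (i j) := fun j t ht =>
    hβr j t ⟨(hαa j).trans ht.1, ht.2⟩
  have hdisj : ∀ j j', j ≠ j' → ∀ t ∈ Ico (-(2 * α)) 0, ∀ t' ∈ Icc (-(2 * α)) 0,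
      β j t ≠ β j' t' := by
    intro j j' hjj t ht t' ht' heq
    have h0 : t' < 0 := by
      refine lt_of_le_of_ne ht'.2 ?_
      rintro rfl
      exact notMem_of_mem_region (Z := Z) (heq ▸ hreg j t ht) (Or.inr (hβu j'))
    have hi : i j = i j' := S.eq_of_mem_region (hreg j t ht) (heq ▸ hreg j' t' ⟨ht'.1, h0⟩)
    have hne : β j 0 ≠ β j' 0 := by
      rw [hβ0, hβ0]; exact fun h => hjj (Subtype.ext h)
    have harc' := harc j'
    have hreg' := hreg j'
    rw [← hi] at harc' hreg'
    rcases le_total t' t with h | h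
    · exact hne ((harc j).eq_of_eq hr harc' hreg' (hβu j) ht'.1 h ht.2.le heq).2
    · exact hne (harc'.eq_of_eq hr (harc j) (hreg j) (hβu j') ht.1 h ht'.2 heq.symm).2.symm
  have hαmem : -α ∈ Ico (-(2 * α)) 0 := ⟨by linarith, by linarith⟩
  -- disjoint neighbourhoods of the base points
  obtain ⟨U₀, hU₀, hU₀d⟩ := (Set.finite_range fun j => β j (-α)).t2_separation
  let U : Q → Set M := fun j => U₀ (β j (-α)) ∩ S.region (i j) ∩
    ⋂ j' ∈ {j' | j' ≠ j}, (β j' '' Icc (-(2 * α)) 0)ᶜ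
  have hUo : ∀ j, IsOpen (U j) := by
    intro j
    refine ((hU₀ _).2.inter (S.isOpen_region _)).inter ?_
    refine (Set.toFinite _).isOpen_biInter fun j' _ => ?_
    exact (isCompact_Icc.image_of_continuousOn (harc j').1).isClosed.isOpen_compl
  have hbU : ∀ j, β j (-α) ∈ U j := by
    intro j
    refine ⟨⟨(hU₀ _).1, hreg j _ hαmem⟩, mem_iInter₂.2 fun j' hj' => ?_⟩
    rintro ⟨t, ht, h⟩
    exact hdisj j j' (Ne.symm hj') _ hαmem t ht h.symm
  let φ : Q → OpenPartialHomeomorph M Plane := fun j => (chartAt Plane (β j (-α))).restr (U j)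
  have hφ : ∀ j, φ j ∈ IsManifold.maximalAtlas (𝓡 2) ∞ M := fun j =>
    restr_mem_maximalAtlas _ (IsManifold.chart_mem_maximalAtlas _) (hUo j)
  have hφs : ∀ j, (φ j).source ⊆ U j := by
    intro j p hp
    have : p ∈ (chartAt Plane (β j (-α))).source ∩ interior (U j) := hp
    exact interior_subset this.2
  have hbs : ∀ j, β j (-α) ∈ (φ j).source := by
    intro j
    change β j (-α) ∈ (chartAt Plane (β j (-α))).source ∩ interior (U j)
    exact ⟨mem_chart_source _ _, by rw [(hUo j).interior_eq]; exact hbU j⟩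
  set y : Q → Plane := fun j => φ j (β j (-α))
  have hyt : ∀ j, y j ∈ (φ j).target := fun j => (φ j).map_source (hbs j)
  set v : Q → Plane := fun j => (Z.field (i j)).inChart (φ j) (y j) with hv
  -- a zero of the field on the arc would make the arc constant
  have hvne : ∀ j, v j ≠ 0 := by
    intro j h0
    have h1 : Z.field (i j) (β j (-α)) = 0 := by
      have h2 := VField.mfderiv_symm_comp_chart (hφ j) (hbs j) (Z.field (i j) (β j (-α)))
      rw [← h2]
      have h3 : mfderiv (𝓡 2) (𝓡 2) (φ j) (β j (-α)) (Z.field (i j) (β j (-α))) = (0 : Plane) := by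
        rw [← VField.inChart_apply _ (hbs j)]; exact h0
      rw [h3]; exact map_zero _
    have h4 : IsMIntegralCurveOn (fun _ : ℝ => β j (-α)) (fun p => Z.field (i j) p)
        (Ioo (-α) 0) := by
      rw [VField.isMIntegralCurveOn_Ioo_iff]
      intro t ht
      rw [h1]
      have h5 := hasMFDerivAt_const (I := 𝓘(ℝ, ℝ)) (I' := 𝓡 2) (β j (-α)) t
      have h6 : (1 : ℝ →L[ℝ] ℝ).smulRight (0 : Plane) = 0 := by ext; simp
      exact HasMFDerivAt.congr_mfderiv h5 h6.symm
    have h6 := (harc j).mono hαmem.1 le_rfl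
    have h7 := VField.eqOn_Icc_of_left hr h6.1 continuousOn_const h6.2.2 h4 rfl
      (right_mem_Icc.2 hαmem.2.le)
    have h8 := hreg j _ hαmem
    have h7' : β j 0 = β j (-α) := h7
    rw [← h7'] at h8
    exact notMem_of_mem_region (Z := Z) h8 (Or.inr (hβu j))
  choose w hw1 hw2 using fun j => Plane.exists_orthogonal (hvne j)
  -- the disc and the constants
  have hRLC : ∀ j, ∃ R > 0, ∃ L : ℝ, 0 ≤ L ∧ Metric.closedBall (y j) R ⊆ (φ j).target ∧
      (∀ x ∈ Metric.closedBall (y j) R, ∀ z ∈ Metric.closedBall (y j) R,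
        ‖(Z.field (i j)).inChart (φ j) x - (Z.field (i j)).inChart (φ j) z‖ ≤ L * ‖x - z‖) ∧
      ∀ x ∈ Metric.closedBall (y j) R, ‖(Z.field (i j)).inChart (φ j) x - v j‖ ≤ ‖v j‖ / 16 := by
    intro j
    have hcd : ContDiffAt ℝ 1 ((Z.field (i j)).inChart (φ j)) (y j) :=
      (Z.field (i j)).contDiffAt_inChart (m := 1) (hφ j) (hyt j) (by exact_mod_cast hr)
    obtain ⟨K, s, hs, hK⟩ := hcd.exists_lipschitzOnWith
    have hnear : ∀ᶠ x in 𝓝 (y j), ‖(Z.field (i j)).inChart (φ j) x - v j‖ < ‖v j‖ / 16 := by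
      have h1 : ContinuousAt (fun x => ‖(Z.field (i j)).inChart (φ j) x - v j‖) (y j) :=
        (hcd.continuousAt.sub continuousAt_const).norm
      refine h1.eventually_lt_const ?_
      have h2 : ‖(Z.field (i j)).inChart (φ j) (y j) - v j‖ = 0 := norm_eq_zero.2 (sub_self _)
      exact h2.trans_lt (div_pos (norm_pos_iff.2 (hvne j)) (by norm_num))
    obtain ⟨R, hR, hRs⟩ := Metric.nhds_basis_closedBall.mem_iff.1
      (inter_mem (inter_mem hs ((φ j).open_target.mem_nhds (hyt j))) hnear)
    refine ⟨R, hR, K, K.2, fun x hx => (hRs hx).1.2, fun x hx z hz => ?_, fun x hx => ?_⟩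
    · have := hK.dist_le_mul x (hRs hx).1.1 z (hRs hz).1.1
      rwa [dist_eq_norm, dist_eq_norm] at this
    · exact (hRs hx).2.le
  choose R hR L hL hRt hLip hnear using hRLC
  set C : Q → ℝ := fun j => ‖v j‖ + ‖v j‖ / 16
  have hC : ∀ j, 0 ≤ C j := fun j => by positivity
  -- the unit of time
  obtain ⟨κ, ⟨hκα, hκ⟩, hκpos⟩ : ∃ κ : ℝ, (2 * κ ≤ α ∧ ∀ j, (∀ x ∈ Icc 0 (2 * κ),
      β j (-α - x) ∈ (φ j).source ∧ φ j (β j (-α - x)) ∈ Metric.ball (y j) (R j / 2)) ∧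
      (L j + 1) * (3 * κ) ≤ 1 / 9 ∧ (C j + 1) * (3 * κ) < R j / 2) ∧ 0 < κ := by
    have hlin : ∀ A B : ℝ, 0 < B → ∀ᶠ κ : ℝ in 𝓝[>] 0, A * κ < B := by
      intro A B hB
      have h : Continuous (fun κ : ℝ => A * κ) := by fun_prop
      have : Tendsto (fun κ : ℝ => A * κ) (𝓝[>] 0) (𝓝 0) := by
        simpa using (h.tendsto 0).mono_left nhdsWithin_le_nhds
      exact this.eventually_lt_const hB
    have hev : ∀ᶠ κ : ℝ in 𝓝[>] 0, 2 * κ ≤ α ∧ ∀ j, (∀ x ∈ Icc 0 (2 * κ),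
        β j (-α - x) ∈ (φ j).source ∧ φ j (β j (-α - x)) ∈ Metric.ball (y j) (R j / 2)) ∧
        (L j + 1) * (3 * κ) ≤ 1 / 9 ∧ (C j + 1) * (3 * κ) < R j / 2 := by
      refine ((hlin 2 α hα).mono fun _ h => h.le).and (eventually_all.2 fun j => ?_)
      refine Eventually.and ?_ (Eventually.and ?_ ?_)
      · have hc : ContinuousAt (β j) (-α) :=
          (harc j).1.continuousAt (Icc_mem_nhds (by linarith) (by linarith))
        have h1 : ∀ᶠ s in 𝓝 (-α), β j s ∈ (φ j).source ∧
            φ j (β j s) ∈ Metric.ball (y j) (R j / 2) := by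
          refine (hc.eventually ((φ j).open_source.mem_nhds (hbs j))).and ?_
          have h2 : ContinuousAt (fun s => φ j (β j s)) (-α) :=
            ContinuousAt.comp (f := β j) (g := φ j) ((φ j).continuousAt (hbs j)) hc
          exact h2.eventually (Metric.ball_mem_nhds _ (half_pos (hR j)))
        obtain ⟨δ, hδ, hδs⟩ := Metric.eventually_nhds_iff.1 h1
        filter_upwards [hlin 2 δ hδ, self_mem_nhdsWithin] with κ hκ hκ0 x hx
        refine hδs ?_
        rw [Real.dist_eq, show -α - x - -α = -x by ring, abs_neg, abs_of_nonneg hx.1]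
        exact hx.2.trans_lt hκ
      · filter_upwards [hlin ((L j + 1) * 3) (1 / 9) (by norm_num)] with κ hκ
        linarith
      · filter_upwards [hlin ((C j + 1) * 3) (R j / 2) (half_pos (hR j))] with κ hκ
        linarith
    exact (hev.and self_mem_nhdsWithin).exists
  -- the bound for the modifications
  obtain ⟨ε, ⟨hε1, hεv⟩, hε⟩ : ∃ ε : ℝ, (ε ≤ 1 ∧ ∀ j, ε ≤ ‖v j‖ / 16) ∧ 0 < ε := by
    have hlt : ∀ B : ℝ, 0 < B → ∀ᶠ ε : ℝ in 𝓝[>] 0, ε ≤ B := fun B hB =>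
      mem_nhdsWithin_of_mem_nhds (Iic_mem_nhds hB)
    exact (((hlt 1 one_pos).and (eventually_all.2 fun j => hlt _
      (div_pos (norm_pos_iff.2 (hvne j)) (by norm_num)))).and self_mem_nhdsWithin).exists
  refine ⟨Q, hQf, ⟨{
    i := i, β := β, φ := φ, v := v, w := w, R := R, L := L, C := C, α := α, κ := κ, ε := ε
    α_pos := hα, κ_pos := hκpos, ε_pos := hε, two_κ_le := hκα, ε_le_one := hε1, ε_le := hεv
    isArcOf := harc, mem_region := hreg, mem_unstableSet := hβu
    exists_eq := ?_
    mem_atlas := hφ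
    source_subset := fun j => (hφs j).trans fun p hp => hp.1.2
    disjoint_source := ?_
    notMem_source := ?_
    mem_source := fun j => (hκ j).1
    R_pos := hR, ball_subset := hRt, v_ne_zero := hvne, norm_w := hw1, inner_eq_zero := hw2
    L_nonneg := hL, C_nonneg := hC, norm_sub_le := hLip, norm_sub_v_le := hnear
    norm_le := ?_
    L_mul_le := fun j => (hκ j).2.1
    C_mul_lt := fun j => (hκ j).2.2 }⟩⟩
  · intro k c s hs hc hcu hcr
    refine ⟨⟨c 0, hcu, k, c, s, hs, hc, rfl, hcr⟩, hβ0 _, ?_⟩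
    set j : Q := ⟨c 0, hcu, k, c, s, hs, hc, rfl, hcr⟩
    obtain ⟨l, hl, h1⟩ := hc.mem_unstableSet_right hs hcu
    obtain ⟨l', hl', h2⟩ := (hβ j).mem_unstableSet_right (ha j) (hβu j)
    have hjc : β j 0 = c 0 := hβ0 j
    rw [hjc] at hl' h2
    obtain rfl := SwitchingManifold.eq_of_γ_eq_zero hl hl'
    rcases h1 with ⟨h1, h3⟩ | ⟨h1, h3⟩ <;> rcases h2 with ⟨h2, h4⟩ | ⟨h2, h4⟩
    · rw [h1, h2]
    · exact absurd h4 (hZ l _ hl h3)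
    · exact absurd h3 (hZ l _ hl h4)
    · rw [h1, h2]
  · intro j j' hjj
    have hne : β j (-α) ≠ β j' (-α) := hdisj j j' hjj _ hαmem _ (Ico_subset_Icc_self hαmem)
    exact (hU₀d (mem_range_self j) (mem_range_self j') hne).mono ((hφs j).trans fun p hp => hp.1.1)
      ((hφs j').trans fun p hp => hp.1.1)
  · intro j j' hjj t ht hmem
    have := mem_iInter₂.1 (hφs j hmem).2 j' hjj.symm
    exact this ⟨t, ht, rfl⟩
  · intro j x hx
    have := norm_add_le ((Z.field (i j)).inChart (φ j) x - v j) (v j)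
    rw [sub_add_cancel] at this
    have h2 := hnear j x hx
    simp only [C]
    linarith

end PSVF

/-! ### The modified fields -/

namespace VField

variable {M : Type*} [TopologicalSpace M] [ChartedSpace Plane M] [IsManifold (𝓡 2) ∞ M] {r : ℕ∞}

open Classical in
/-- The vector field that is expressed by `fun x => g x • w` in the chart `e` and vanishes outside
its domain (or `0`, if there is no such field). -/
noncomputable def chartField (e : OpenPartialHomeomorph M Plane) (w : Plane) (g : Plane → ℝ) :
    VField M r :=
  if h : ∃ Y : VField M r, IsChartField Y e (fun x => g x • w) then h.choose else 0

lemma isChartField_chartField [T2Space M] {e : OpenPartialHomeomorph M Plane}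
    (he : e ∈ IsManifold.maximalAtlas (𝓡 2) ∞ M) {g : Plane → ℝ} (hg : ContDiff ℝ ∞ g)
    {B : Set Plane} (hB : IsCompact B) (hgB : ∀ x ∉ B, g x = 0) (hBe : B ⊆ e.target) (w : Plane) :
    IsChartField (chartField e w g : VField M r) e (fun x => g x • w) := by
  have h : ∃ Y : VField M r, IsChartField Y e (fun x => g x • w) :=
    exists_isChartField he hg hB hgB hBe w
  rw [chartField, dif_pos h]
  exact h.choose_spec

lemma IsChartField.eq_of_eq {e : OpenPartialHomeomorph M Plane}
    (he : e ∈ IsManifold.maximalAtlas (𝓡 2) ∞ M) {Y Y' : VField M r} {G G' : Plane → Plane}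
    (h : IsChartField Y e G) (h' : IsChartField Y' e G') {p : M}
    (hp : p ∈ e.source → G (e p) = G' (e p)) : Y p = Y' p := by
  by_cases hs : p ∈ e.source
  · have h1 := h.1 p hs
    have h2 := h'.1 p hs
    rw [← hp hs, ← h1] at h2
    rw [← mfderiv_symm_comp_chart he hs (Y p), ← mfderiv_symm_comp_chart he hs (Y' p)]
    exact congrArg (mfderiv (𝓡 2) (𝓡 2) e.symm (e p)) h2.symm
  · rw [h.2 p hs, h'.2 p hs]

lemma coe_finset_sum {ι : Type*} (s : Finset ι) (Y : ι → VField M r) (p : M) :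
    (∑ j ∈ s, Y j : VField M r) p = ∑ j ∈ s, Y j p := by
  have h := map_sum (ContMDiffSection.coeAddHom (𝓡 2) Plane (r : WithTop ℕ∞)
    (TangentSpace (𝓡 2) : M → Type _)) Y s
  have h2 := congrFun h p
  rw [Finset.sum_apply] at h2
  exact h2

lemma inChart_zero (e : OpenPartialHomeomorph M Plane) : (0 : VField M r).inChart e = 0 := by
  ext1 y
  simp only [inChart, Pi.zero_apply]
  rw [ContMDiffSection.coe_zero, Pi.zero_apply, map_zero]
  rfl

lemma inChart_sum {ι : Type*} (s : Finset ι) (Y : ι → VField M r)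
    (e : OpenPartialHomeomorph M Plane) :
    (∑ j ∈ s, Y j : VField M r).inChart e = ∑ j ∈ s, (Y j).inChart e := by
  classical
  induction s using Finset.induction_on with
  | empty => simp [inChart_zero]
  | insert j s hj ih => rw [Finset.sum_insert hj, Finset.sum_insert hj, inChart_add, ih]

end VField

namespace PSVF

variable {M : Type*} [TopologicalSpace M] [ChartedSpace Plane M] [IsManifold (𝓡 2) ∞ M]
  {n : ℕ} {S : SwitchingManifold M n} {r : ℕ∞} {Z : PSVF S r}

lemma IsRegionTrajectory.hasMFDerivAt {c : ℝ → M} {a b t : ℝ} (h : Z.IsRegionTrajectory c a b)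
    (ht : t ∈ Ioo a b) {i : Fin (n + 1)} (hi : c t ∈ S.region i) :
    HasMFDerivAt 𝓘(ℝ, ℝ) (𝓡 2) c t ((1 : ℝ →L[ℝ] ℝ).smulRight (Z.field i (c t))) := by
  have hca : ContinuousAt c t := h.1.continuousAt (Icc_mem_nhds ht.1 ht.2)
  have h1 : ∀ᶠ s in 𝓝 t, s ∈ Ioo a b ∧ c s ∈ S.region i :=
    Filter.Eventually.and (Ioo_mem_nhds ht.1 ht.2)
      (hca.eventually ((S.isOpen_region i).mem_nhds hi))
  obtain ⟨δ, hδ, hδs⟩ := Metric.eventually_nhds_iff.1 h1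
  have h2 : ∀ s ∈ Ioo (t - δ) (t + δ), s ∈ Ioo a b ∧ c s ∈ S.region i := fun s hs =>
    hδs (by rw [Real.dist_eq, abs_lt]; constructor <;> linarith [hs.1, hs.2])
  have h3 := h2 (t - δ / 2) ⟨by linarith, by linarith⟩
  have h4 := h2 (t + δ / 2) ⟨by linarith, by linarith⟩
  have h5 := (h.mono h3.1.1.le h4.1.2.le).isLocalTrajectory.isArcOf (i := i) (by linarith)
    fun s hs => (h2 s ⟨by linarith [hs.1], by linarith [hs.2]⟩).2
  exact VField.hasMFDerivAt_of_isMIntegralCurveOn h5.2.2 ⟨by linarith, by linarith⟩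

namespace BreakData

variable {ι : Type*} (D : BreakData Z ι)

/-- The centre of the disc in which the field is modified. -/
noncomputable def y (j : ι) : Plane := D.φ j (D.β j (-D.α))

/-- The functions `g j` are nonnegative, smooth, supported in the discs of `D`, and `δ`-small
together with their first derivatives. -/
structure IsAdmissible (δ : ℝ) (g : ι → Plane → ℝ) : Prop where
  contDiff : ∀ j, ContDiff ℝ ∞ (g j)
  nonneg : ∀ j x, 0 ≤ g j x
  eq_zero : ∀ j, ∀ x ∉ Metric.closedBall (D.y j) (D.R j), g j x = 0
  norm_le : ∀ j, ∀ l ≤ 1, ∀ x, ‖iteratedFDeriv ℝ l (g j) x‖ ≤ δ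

/-- The functions `g` and `g'` have the same values at the point `p` of the surface. -/
def AgreeAt (g g' : ι → Plane → ℝ) (p : M) : Prop :=
  ∀ j, p ∈ (D.φ j).source → g j (D.φ j p) = g' j (D.φ j p)

variable {D} {g g' : ι → Plane → ℝ} {δ δ' : ℝ}

lemma AgreeAt.symm {p : M} (h : D.AgreeAt g g' p) : D.AgreeAt g' g p := fun j hj => (h j hj).symm

lemma isAdmissible_zero : D.IsAdmissible 0 0 where
  contDiff _ := contDiff_const
  nonneg _ _ := le_rfl
  eq_zero _ _ _ := rfl
  norm_le j l _ x := by simp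

lemma isClosed_setOf_agreeAt (hg : D.IsAdmissible δ g) (hg' : D.IsAdmissible δ' g') :
    IsClosed {p | D.AgreeAt g g' p} := by
  rw [← isOpen_compl_iff, isOpen_iff_mem_nhds]
  intro p hp
  have hp' : ¬ D.AgreeAt g g' p := hp
  simp only [AgreeAt, not_forall] at hp'
  obtain ⟨j, hj, hne⟩ := hp'
  have hc : ContinuousAt (fun q => g j (D.φ j q) - g' j (D.φ j q)) p :=
    ((((hg.contDiff j).continuous.sub (hg'.contDiff j).continuous)).continuousAt).comp
      ((D.φ j).continuousAt hj)
  filter_upwards [hc.eventually_ne (sub_ne_zero.2 hne), (D.φ j).open_source.mem_nhds hj]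
    with q hq1 hq2 h
  exact hq1 (sub_eq_zero.2 (h j hq2))

/-- Away from the domains of the charts any two admissible families agree, because their supports
are compact subsets of these domains. -/
lemma eventually_agreeAt [T2Space M] [Finite ι] (hg : D.IsAdmissible δ g)
    (hg' : D.IsAdmissible δ' g') {p : M} (hp : ∀ j, p ∉ (D.φ j).source) :
    ∀ᶠ q in 𝓝 p, D.AgreeAt g g' q := by
  refine eventually_all.2 fun j => ?_
  have hK : IsClosed ((D.φ j).symm '' Metric.closedBall (D.y j) (D.R j)) :=
    ((isCompact_closedBall _ _).image_of_continuousOn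
      ((D.φ j).continuousOn_symm.mono (D.ball_subset j))).isClosed
  have hpK : p ∉ (D.φ j).symm '' Metric.closedBall (D.y j) (D.R j) := by
    rintro ⟨x, hx, rfl⟩
    exact hp j ((D.φ j).map_target (D.ball_subset j hx))
  filter_upwards [hK.isOpen_compl.mem_nhds hpK] with q hq hqs
  have hx : D.φ j q ∉ Metric.closedBall (D.y j) (D.R j) := fun hx =>
    hq ⟨_, hx, (D.φ j).left_inv hqs⟩
  rw [hg.eq_zero j _ hx, hg'.eq_zero j _ hx]

lemma notMem_source_of_γ_eq_zero {k : Fin n} {p : M} (hp : S.γ k p = 0) (j : ι) :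
    p ∉ (D.φ j).source := fun h => S.region_subset _ (D.source_subset j h) k hp

section Perturb

variable [Fintype ι]

variable (D) in
/-- The modification of `Z`: the fields `g j • w j`, read in the charts of `D`, are added to all its
components. -/
noncomputable def perturb (g : ι → Plane → ℝ) : PSVF S r :=
  ⟨fun i => Z.field i + ∑ j, VField.chartField (D.φ j) (D.w j) (g j)⟩

variable [T2Space M]

lemma IsAdmissible.isChartField (hg : D.IsAdmissible δ g) (j : ι) :
    VField.IsChartField (VField.chartField (D.φ j) (D.w j) (g j) : VField M r) (D.φ j)
      (fun x => g j x • D.w j) :=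
  VField.isChartField_chartField (D.mem_atlas j) (hg.contDiff j) (isCompact_closedBall _ _)
    (hg.eq_zero j) (D.ball_subset j) _

lemma AgreeAt.field_eq {p : M} (h : D.AgreeAt g g' p) (hg : D.IsAdmissible δ g)
    (hg' : D.IsAdmissible δ' g') (i : Fin (n + 1)) :
    (D.perturb g).field i p = (D.perturb g').field i p := by
  simp only [perturb]
  rw [ContMDiffSection.coe_add, ContMDiffSection.coe_add, Pi.add_apply, Pi.add_apply,
    VField.coe_finset_sum, VField.coe_finset_sum]
  refine congrArg _ (Finset.sum_congr rfl fun j _ => ?_)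
  exact (hg.isChartField j).eq_of_eq (D.mem_atlas j) (hg'.isChartField j) fun hp => by
    simp only [h j hp]

lemma perturb_zero : D.perturb 0 = Z := by
  ext i p
  simp only [perturb]
  rw [ContMDiffSection.coe_add, Pi.add_apply, VField.coe_finset_sum, Finset.sum_eq_zero, add_zero]
  intro j _
  refine (isAdmissible_zero.isChartField j).eq_of_eq (Y' := 0) (G' := 0) (D.mem_atlas j) ?_ ?_
  · exact ⟨fun q _ => by rw [ContMDiffSection.coe_zero, Pi.zero_apply, map_zero]; rfl,
      fun q _ => rfl⟩
  · simp

lemma agreeOnCurves (hg : D.IsAdmissible δ g) (hg' : D.IsAdmissible δ' g') :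
    AgreeOnCurves (D.perturb g) (D.perturb g') := fun _ _ hp i =>
  AgreeAt.field_eq (fun j hj => absurd hj (notMem_source_of_γ_eq_zero hp j)) hg hg' i

lemma agreeOnCurves_perturb (hg : D.IsAdmissible δ g) : AgreeOnCurves Z (D.perturb g) := by
  have h := agreeOnCurves (D := D) isAdmissible_zero hg
  rwa [perturb_zero] at h

lemma inChart_perturb (hg : D.IsAdmissible δ g) (j : ι) (i : Fin (n + 1)) {x : Plane}
    (hx : x ∈ (D.φ j).target) : ((D.perturb g).field i).inChart (D.φ j) x =
      (Z.field i).inChart (D.φ j) x + g j x • D.w j := by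
  simp only [perturb]
  rw [VField.inChart_add, Pi.add_apply, VField.inChart_sum, Finset.sum_apply,
    Finset.sum_eq_single j]
  · rw [(hg.isChartField j).inChart_eq hx]
  · intro j' _ hj
    have h0 : (VField.chartField (D.φ j') (D.w j') (g j') : VField M r) ((D.φ j).symm x) = 0 :=
      (hg.isChartField j').2 _ fun h =>
        disjoint_left.1 (D.disjoint_source j' j hj) h ((D.φ j).map_target hx)
    rw [VField.inChart, h0]
    exact map_zero _
  · simp

end Perturb

section Bounds

lemma IsAdmissible.abs_le (hg : D.IsAdmissible δ g) (j : ι) (x : Plane) : |g j x| ≤ δ := by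
  have := hg.norm_le j 0 (by norm_num) x
  rwa [norm_iteratedFDeriv_zero, Real.norm_eq_abs] at this

lemma IsAdmissible.lipschitz (hg : D.IsAdmissible δ g) (j : ι) (x z : Plane) :
    |g j x - g j z| ≤ δ * ‖x - z‖ := by
  refine Convex.norm_image_sub_le_of_norm_fderiv_le (𝕜 := ℝ) (s := univ) (f := g j)
    (fun t _ => ((hg.contDiff j).differentiable (by simp)).differentiableAt) (fun t _ => ?_)
    convex_univ (mem_univ z) (mem_univ x)
  have := hg.norm_le j 1 le_rfl t
  rwa [← norm_iteratedFDeriv_fderiv, norm_iteratedFDeriv_zero] at this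

variable [Fintype ι] [T2Space M]

lemma norm_inChart_perturb_sub_le (hg : D.IsAdmissible δ g) (hδ : δ ≤ D.ε) (j : ι) {x z : Plane}
    (hx : x ∈ Metric.closedBall (D.y j) (D.R j)) (hz : z ∈ Metric.closedBall (D.y j) (D.R j)) :
    ‖((D.perturb g).field (D.i j)).inChart (D.φ j) x -
      ((D.perturb g).field (D.i j)).inChart (D.φ j) z‖ ≤ (D.L j + 1) * ‖x - z‖ := by
  rw [inChart_perturb hg j _ (D.ball_subset j hx), inChart_perturb hg j _ (D.ball_subset j hz),
    add_sub_add_comm, ← sub_smul]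
  refine (norm_add_le _ _).trans ?_
  rw [norm_smul, D.norm_w, mul_one, add_mul]
  refine add_le_add (D.norm_sub_le j x hx z hz) ((hg.lipschitz j x z).trans ?_)
  exact mul_le_mul_of_nonneg_right (hδ.trans D.ε_le_one) (norm_nonneg _)

lemma norm_inChart_perturb_sub_v_le (hg : D.IsAdmissible δ g) (hδ : δ ≤ D.ε) (j : ι) {x : Plane}
    (hx : x ∈ Metric.closedBall (D.y j) (D.R j)) :
    ‖((D.perturb g).field (D.i j)).inChart (D.φ j) x - D.v j‖ ≤ ‖D.v j‖ / 8 := by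
  rw [inChart_perturb hg j _ (D.ball_subset j hx), add_sub_right_comm]
  refine (norm_add_le _ _).trans ?_
  rw [norm_smul, D.norm_w, mul_one, Real.norm_eq_abs]
  linarith [D.norm_sub_v_le j x hx, hg.abs_le j x, D.ε_le j]

lemma norm_inChart_perturb_le (hg : D.IsAdmissible δ g) (hδ : δ ≤ D.ε) (j : ι) {x : Plane}
    (hx : x ∈ Metric.closedBall (D.y j) (D.R j)) :
    ‖((D.perturb g).field (D.i j)).inChart (D.φ j) x‖ ≤ D.C j + 1 := by
  rw [inChart_perturb hg j _ (D.ball_subset j hx)]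
  refine (norm_add_le _ _).trans ?_
  rw [norm_smul, D.norm_w, mul_one, Real.norm_eq_abs]
  linarith [D.norm_le j x hx, hg.abs_le j x, D.ε_le_one]

end Bounds

end BreakData

end PSVF

/-! ### The effect of one more modification on the connections -/

namespace PSVF

variable {M : Type*} [TopologicalSpace M] [ChartedSpace Plane M] [IsManifold (𝓡 2) ∞ M]
  {n : ℕ} {S : SwitchingManifold M n} {r : ℕ∞} {Z : PSVF S r}

namespace BreakData

variable {ι : Type*} [Fintype ι] [T2Space M] {D : BreakData Z ι} {g g' : ι → Plane → ℝ} {δ δ' : ℝ}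

/-- The end of the arc `β j` is an arc of a modification that vanishes along it. -/
lemma isArcOf_perturb (hg : D.IsAdmissible δ g) {j : ι} {s : ℝ} (hs : s ≤ 2 * D.α)
    (h : ∀ x ∈ Icc 0 s, D.AgreeAt g 0 (D.β j (-x))) :
    (D.perturb g).IsArcOf (D.i j) (D.β j) (-s) 0 := by
  refine ((D.isArcOf j).mono (neg_le_neg hs) le_rfl).of_field_eq fun t ht => ?_
  have := (h (-t) ⟨by linarith [ht.2], by linarith [ht.1]⟩).field_eq hg isAdmissible_zero (D.i j)
  rw [neg_neg, perturb_zero] at this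
  exact this.symm

/-- The connections of a modification of `Z` end with one of the arcs of `D`. -/
lemma exists_eq_of_isConnection (hZ : Z.IsRegular) (hg : D.IsAdmissible δ g) {c : ℝ → M} {a : ℝ}
    (hc : (D.perturb g).IsConnection c a) : 0 < a ∧ ∃ j, c a = D.β j 0 ∧
      ∃ s ∈ Ico 0 a, (D.perturb g).IsArcOf (D.i j) c s a := by
  obtain ⟨ha, i, s, hs, hi, hreg⟩ := hc.exists_isArcOf ((agreeOnCurves_perturb hg).isRegular hZ)
  refine ⟨ha, ?_⟩
  have hu : c a ∈ Z.unstableSet := by rw [(agreeOnCurves_perturb hg).unstableSet_eq]; exact hc.2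
  -- near its end, the connection is away from the support of the modification
  have h1 : ∀ᶠ t in 𝓝[<] a, s < t ∧ D.AgreeAt g 0 (c t) := by
    have h2 : Tendsto c (𝓝[<] a) (𝓝 (c a)) :=
      (hi.1 a ⟨hs.2.le, le_rfl⟩).mono_left (nhdsWithin_le_of_mem (Icc_mem_nhdsLT hs.2))
    obtain ⟨k, hk, -⟩ := hu
    exact (eventually_nhdsWithin_of_eventually_nhds (eventually_gt_nhds hs.2)).and (h2.eventually
      (eventually_agreeAt hg isAdmissible_zero (notMem_source_of_γ_eq_zero hk)))
  obtain ⟨u, hua, hu1⟩ := (mem_nhdsLT_iff_exists_Ioo_subset).1 h1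
  have hua : u < a := hua
  obtain ⟨s', hs1, hs2⟩ := exists_between hua
  have hsub : ∀ t ∈ Ico s' a, s < t ∧ D.AgreeAt g 0 (c t) := fun t ht =>
    hu1 ⟨hs1.trans_le ht.1, ht.2⟩
  have hss' := (hsub s' ⟨le_rfl, hs2⟩).1
  have harc : Z.IsArcOf i c s' a := by
    refine (hi.mono hss'.le le_rfl).of_field_eq fun t ht => ?_
    have := (hsub t ⟨ht.1.le, ht.2⟩).2.field_eq hg isAdmissible_zero i
    rwa [perturb_zero] at this
  have harc' := harc.comp_add a
  rw [sub_self] at harc'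
  obtain ⟨j, hj, rfl⟩ := D.exists_eq i _ (s' - a) (by linarith) harc' (by simpa using hu)
    fun t ht => hreg _ ⟨by linarith [ht.1], by linarith [ht.2]⟩
  exact ⟨j, by simpa using hj.symm, s, hs, hi⟩

/-- A connection that ends with the arc `β j` has followed this arc for as long as the modification
vanishes along it. -/
lemma eq_of_isConnection (hr : 1 ≤ r) (hZ : Z.IsRegular) (hg : D.IsAdmissible δ g) {c : ℝ → M}
    {a s : ℝ} (hc : (D.perturb g).IsConnection c a) (hs0 : 0 ≤ s) (hs : s ≤ 2 * D.α)
    (h : ∀ j, ∀ x ∈ Icc 0 s, D.AgreeAt g 0 (D.β j (-x))) :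
    s < a ∧ ∃ j, ∀ x ∈ Icc 0 s, c (a - x) = D.β j (-x) := by
  obtain ⟨ha, j, hj, u, hu, hi⟩ := exists_eq_of_isConnection hZ hg hc
  have h1 := (isArcOf_perturb hg hs (h j)).comp_add (-a)
  rw [show -s - -a = a - s by ring, show 0 - -a = a by ring] at h1
  obtain ⟨h2, h3⟩ := hc.1.eqOn_of_isArcOf hr ha hs0 h1
    (fun t ht => D.mem_region j _ ⟨by linarith [ht.1], by linarith [ht.2]⟩)
    (by simpa using hj) (Or.inr ⟨u, hu, hi⟩)
  refine ⟨h2, j, fun x hx => ?_⟩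
  have h4 := h3 (x := a - x) ⟨by linarith [hx.2], by linarith [hx.1]⟩
  simp only at h4
  rw [h4]
  congr 1; ring

/-- A free path that arrives on one of the arcs of `D` can be continued to a connection. -/
lemma exists_isConnection (hg : D.IsAdmissible δ g) {c : ℝ → M} {τ s : ℝ} {j : ι}
    (hc : (D.perturb g).IsFreePath c τ) (hs0 : 0 < s) (hs : s ≤ 2 * D.α)
    (h : ∀ x ∈ Icc 0 s, D.AgreeAt g 0 (D.β j (-x))) (he : c τ = D.β j (-s)) :
    ∃ c', (D.perturb g).IsConnection c' (τ + s) := by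
  have h1 := (isArcOf_perturb hg hs h).comp_add (-(τ + s))
  rw [show -s - -(τ + s) = τ by ring, show 0 - -(τ + s) = τ + s by ring] at h1
  refine ⟨_, hc.extend (by linarith) h1 (fun t ht => D.mem_region j _
    ⟨by linarith [ht.1], by linarith [ht.2]⟩) (by rw [he]; congr 1; ring), ?_⟩
  have h2 : ¬ τ + s ≤ τ := by linarith
  rw [← (agreeOnCurves_perturb hg).unstableSet_eq]
  simpa [h2] using D.mem_unstableSet j

/-- A trajectory of a larger modification that starts on the arc `β j`, shortly before the base
point, and that arrives shortly after at one of the base points has followed the arc: the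
modification pushes it away from the arc, always to the same side. -/
lemma eq_arc_of_le (hg : D.IsAdmissible δ g) (hδ : δ ≤ D.ε) (hg' : D.IsAdmissible δ' g')
    (hδ' : δ' ≤ D.ε) (hle : ∀ j x, g j x ≤ g' j x) {c : ℝ → M} {τ T u : ℝ} {j j' : ι}
    (hc : (D.perturb g').IsRegionTrajectory c τ (τ + T)) (hT : 0 ≤ T) (hTκ : T ≤ 3 * D.κ)
    (hu : 0 < u) (huκ : u ≤ 2 * D.κ) (hc0 : c τ = D.β j (-D.α - u))
    (hcT : c (τ + T) = D.β j' (-D.α)) (h : ∀ x ∈ Icc 0 u, D.AgreeAt g 0 (D.β j (-D.α - x))) :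
    T = u ∧ ∀ t ∈ Icc 0 u, g j (D.φ j (D.β j (-D.α - u + t))) =
      g' j (D.φ j (D.β j (-D.α - u + t))) := by
  have hκ := D.κ_pos
  have hκα := D.two_κ_le
  have hbox : ∀ t ∈ Icc τ (τ + T), c t ∈ (D.φ j).source ∧
      D.φ j (c t) ∈ Metric.ball (D.y j) (D.R j) := by
    have h0 := D.mem_source j u ⟨hu.le, huκ⟩
    refine VField.mem_box_of_speed_le (C := D.C j + 1)
      (v := fun t => ((D.perturb g').field (D.i j)).inChart (D.φ j) (D.φ j (c t)))
      (D.ball_subset j) hc.1 (hc0 ▸ h0.1) (fun t ht hst => ?_) (by linarith [D.C_nonneg j]) ?_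
    · have h1 := hst t ⟨ht.1.le, le_rfl⟩
      exact ⟨VField.hasDerivAt_chart (D.mem_atlas j)
        (hc.hasMFDerivAt ht (D.source_subset j h1.1)) h1.1,
        norm_inChart_perturb_le hg' hδ' j (Metric.ball_subset_closedBall h1.2)⟩
    · have h1 : dist (D.φ j (c τ)) (D.y j) < D.R j / 2 := hc0 ▸ h0.2
      have h2 := D.C_mul_lt j
      have h3 : (D.C j + 1) * T ≤ (D.C j + 1) * (3 * D.κ) :=
        mul_le_mul_of_nonneg_left hTκ (by linarith [D.C_nonneg j])
      rw [add_sub_cancel_left]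
      linarith
  obtain rfl : j = j' := by
    by_contra hne
    have h1 := (hbox (τ + T) ⟨by linarith, le_rfl⟩).1
    rw [hcT] at h1
    have h2 := (D.mem_source j' 0 ⟨le_rfl, by linarith⟩).1
    rw [sub_zero] at h2
    exact disjoint_left.1 (D.disjoint_source j j' hne) h1 h2
  have hβbox : ∀ t ∈ Icc 0 u, D.β j (-D.α - u + t) ∈ (D.φ j).source ∧
      D.φ j (D.β j (-D.α - u + t)) ∈ Metric.ball (D.y j) (D.R j / 2) := fun t ht => by
    have := D.mem_source j (u - t) ⟨by linarith [ht.2], by linarith [ht.1]⟩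
    rwa [show -D.α - (u - t) = -D.α - u + t by ring] at this
  have hR := D.R_pos j
  have key := eq_of_pushed_curve (B := Metric.closedBall (D.y j) (D.R j)) (h := 3 * D.κ)
    (F := ((D.perturb g).field (D.i j)).inChart (D.φ j)) (g := fun x => g' j x - g j x)
    (c := fun t => D.φ j (c (t + τ))) (φ := fun t => D.φ j (D.β j (-D.α - u + t)))
    (v := D.v j) (w := D.w j) (L := D.L j + 1) (T := T) (T' := u)
    (fun x hx => norm_inChart_perturb_sub_v_le hg hδ j hx)
    (fun x hx z hz => norm_inChart_perturb_sub_le hg hδ j hx hz)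
    (by linarith [D.L_nonneg j]) (D.L_mul_le j) (D.v_ne_zero j) (D.norm_w j) (D.inner_eq_zero j)
    ((hg'.contDiff j).continuous.sub (hg.contDiff j).continuous) (fun x => sub_nonneg.2 (hle j x))
    hT hTκ hu ?_ ?_ ?_ ?_ ?_ ?_ ?_ ?_
  · refine ⟨key.1, fun t ht => ?_⟩
    have h1 := key.2.1 (x := t) (key.1 ▸ ht)
    have h2 := key.2.2 t (key.1 ▸ ht)
    simp only at h1 h2
    rw [h1] at h2
    linarith
  · have hm : MapsTo (fun t => t + τ) (Icc 0 T) (Icc τ (τ + T)) := fun t ht =>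
      ⟨by linarith [ht.1], by linarith [ht.2]⟩
    exact (D.φ j).continuousOn.comp (hc.1.comp (by fun_prop) hm) fun t ht => (hbox _ (hm ht)).1
  · have hm : MapsTo (fun t => -D.α - u + t) (Icc 0 u) (Icc (-(2 * D.α)) 0) := fun t ht =>
      ⟨by linarith [ht.1], by linarith [ht.2]⟩
    exact (D.φ j).continuousOn.comp ((D.isArcOf j).1.comp (by fun_prop) hm)
      fun t ht => (hβbox _ ht).1
  · intro t ht
    have ht' : t + τ ∈ Ioo τ (τ + T) := ⟨by linarith [ht.1], by linarith [ht.2]⟩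
    have h1 := hbox _ (Ioo_subset_Icc_self ht')
    have h2 := VField.hasDerivAt_chart (D.mem_atlas j)
        (hc.hasMFDerivAt ht' (D.source_subset j h1.1)) h1.1
    have h3 := h2.comp_add_const t τ
    have h4 := D.ball_subset j (Metric.ball_subset_closedBall h1.2)
    rw [inChart_perturb hg' j _ h4] at h3
    refine HasDerivAt.congr_deriv h3 ?_
    rw [inChart_perturb hg j _ h4, sub_smul]
    abel
  · intro t ht
    have h1 := hβbox t (Ioo_subset_Icc_self ht)
    have h2 := VField.hasMFDerivAt_of_isMIntegralCurveOn (D.isArcOf j).2.2 (t := -D.α - u + t)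
      ⟨by linarith [ht.1], by linarith [ht.2]⟩
    have h3 := (VField.hasDerivAt_chart (D.mem_atlas j) h2 h1.1).comp_const_add (-D.α - u) t
    refine HasDerivAt.congr_deriv h3 ?_
    have h4 := D.ball_subset j (Metric.ball_subset_closedBall
      (Metric.ball_subset_ball (by linarith) h1.2))
    have h5 := h (u - t) ⟨by linarith [ht.2], by linarith [ht.1]⟩ j
    rw [show -D.α - (u - t) = -D.α - u + t by ring] at h5
    rw [inChart_perturb hg j _ h4, h5 h1.1]
    simp
  · intro t ht
    exact Metric.ball_subset_closedBall
      (hbox (t + τ) ⟨by linarith [ht.1], by linarith [ht.2]⟩).2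
  · intro t ht
    exact Metric.ball_subset_closedBall
      (Metric.ball_subset_ball (by linarith) (hβbox t ht).2)
  · simp [hc0]
  · simp only [add_comm T τ, hcT]
    congr 2; ring

variable (D) in
/-- The modification `g` breaks the connections of duration at most `N * κ`, and it vanishes along
the arcs of `D` from the time `-α - 3/2 * κ / 2 ^ N` on. -/
structure IsStage (N : ℕ) (δ : ℝ) (g : ι → Plane → ℝ) : Prop where
  isAdmissible : D.IsAdmissible δ g
  agreeAt : ∀ j, ∀ x ∈ Icc 0 (D.α + 3 / 2 * (D.κ / 2 ^ N)), D.AgreeAt g 0 (D.β j (-x))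
  not_isConnection : ∀ c a, a ≤ N * D.κ → ¬ (D.perturb g).IsConnection c a

lemma isStage_zero (hZ : Z.IsRegular) : D.IsStage 0 0 0 where
  isAdmissible := isAdmissible_zero
  agreeAt _ _ _ _ _ := rfl
  not_isConnection c a ha hc := by
    rw [perturb_zero] at hc
    have := (hc.exists_isArcOf hZ).1
    simp at ha
    linarith

lemma κ_div_pos (N : ℕ) : 0 < D.κ / 2 ^ N := div_pos D.κ_pos (by positivity)

lemma κ_div_le (N : ℕ) : D.κ / 2 ^ N ≤ D.κ :=
  div_le_self D.κ_pos.le (one_le_pow₀ (by norm_num))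

/-- The step of the construction. The increment `g' - g` is supported in a set `B` that is visited
by the free paths of duration at most `(N + 1) * κ` only along the arcs of `D`, at times close to
`-α - κ / 2 ^ N`, and it does not vanish at the points of the arcs at these times. -/
lemma IsStage.not_isConnection_succ (hr : 1 ≤ r) (hZ : Z.IsRegular) {N : ℕ}
    (h : D.IsStage N δ g) (hδ : δ ≤ D.ε) (hg' : D.IsAdmissible δ' g') (hδ' : δ' ≤ D.ε)
    (hle : ∀ j x, g j x ≤ g' j x) {B : Set M} (hB : IsClosed B)
    (hBa : ∀ p ∉ B, D.AgreeAt g g' p)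
    (hBb : ∀ j, D.β j (-D.α - D.κ / 2 ^ N) ∈ B ∧ g j (D.φ j (D.β j (-D.α - D.κ / 2 ^ N))) ≠
      g' j (D.φ j (D.β j (-D.α - D.κ / 2 ^ N))))
    (hBβ : ∀ j, ∀ x ∈ Icc 0 (D.α + 3 / 4 * (D.κ / 2 ^ N)), D.β j (-x) ∉ B)
    (hBc : ∀ e ∈ B, ∀ c τ, (D.perturb g).IsFreePath c τ → τ ≤ (N + 1) * D.κ → c τ = e →
      ∃ j x, |x| < D.κ / 2 ^ N / 2 ∧ e = D.β j (-D.α - D.κ / 2 ^ N + x))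
    (c : ℝ → M) (a : ℝ) (ha : a ≤ (N + 1) * D.κ) : ¬ (D.perturb g').IsConnection c a := by
  intro hc
  have hK := κ_div_pos (D := D) N
  have hKκ := κ_div_le (D := D) N
  set K := D.κ / 2 ^ N with hKdef
  have hκα := D.two_κ_le
  have hg := h.isAdmissible
  have hZg := agreeOnCurves hg hg'
  have hvan : ∀ j, ∀ x ∈ Icc 0 (D.α + 3 / 4 * K), D.AgreeAt g' 0 (D.β j (-x)) := by
    intro j x hx l hl
    rw [← hBa _ (hBβ j x hx) l hl]
    exact h.agreeAt j x ⟨hx.1, by linarith [hx.2]⟩ l hl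
  obtain ⟨hya, j₀, hj₀⟩ := eq_of_isConnection hr hZ hg' hc
    (by linarith [D.α_pos]) (by linarith) hvan
  have hca : ContinuousOn c (Icc 0 a) := hc.1.isRegionTrajectory.1
  have hcomp : IsCompact (Icc 0 a ∩ c ⁻¹' B) := isCompact_Icc.of_isClosed_subset
    (hca.preimage_isClosed_of_isClosed isClosed_Icc hB) inter_subset_left
  have hfree : ∀ τ, 0 ≤ τ → τ ≤ a → (∀ t ∈ Ioo 0 τ, c t ∉ B) → (D.perturb g).IsFreePath c τ :=
    fun τ h0 hτa hτ => (hc.1.mono h0 hτa).of_field_eq hZg.symm fun t ht i =>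
      ((hBa _ (hτ t ht)).symm).field_eq hg' hg i
  -- the connection visits `B`, because it would otherwise be a connection of the former field
  have hne : (Icc 0 a ∩ c ⁻¹' B).Nonempty := by
    by_contra hemp
    rw [not_nonempty_iff_eq_empty] at hemp
    have h1 : ∀ t ∈ Icc 0 a, c t ∉ B := fun t ht hB => by
      have : t ∈ Icc 0 a ∩ c ⁻¹' B := ⟨ht, hB⟩
      rw [hemp] at this; exact this
    have h2 : (D.perturb g).IsConnection c a :=
      ⟨hfree a hc.1.nonneg le_rfl fun t ht => h1 t (Ioo_subset_Icc_self ht),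
        hZg.unstableSet_eq ▸ hc.2⟩
    obtain ⟨h3, j, hj⟩ := eq_of_isConnection hr hZ hg h2 (by linarith [D.α_pos])
      (by linarith) h.agreeAt
    refine h1 (a - (D.α + K)) ⟨by linarith, by linarith [D.α_pos]⟩ ?_
    rw [hj _ ⟨by linarith [D.α_pos], by linarith⟩, neg_add']
    exact (hBb j).1
  obtain ⟨τ, ⟨hτI, hτB⟩, hτmin⟩ := hcomp.exists_isLeast hne
  have hτB : c τ ∈ B := hτB
  have hbefore : ∀ t, 0 ≤ t → t < τ → c t ∉ B := fun t h0 ht hB =>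
    (hτmin ⟨⟨h0, ht.le.trans hτI.2⟩, hB⟩).not_gt ht
  have hτf := hfree τ hτI.1 hτI.2 fun t ht => hbefore t ht.1.le ht.2
  obtain ⟨j, x, hx, he⟩ := hBc _ hτB c τ hτf (hτI.2.trans ha) rfl
  rw [abs_lt] at hx
  have hαpos := D.α_pos
  -- the visit takes place shortly before the connection arrives at the base point
  have hlate : N * D.κ < τ + (D.α + K - x) := by
    by_contra! hcon
    obtain ⟨c', hc'⟩ := exists_isConnection (s := D.α + K - x) hg hτf (by linarith) (by linarith)
      (fun z hz => h.agreeAt j z ⟨hz.1, by linarith [hz.2]⟩) (by rw [he]; congr 1; ring)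
    exact h.not_isConnection _ _ hcon hc'
  have hearly : τ < a - (D.α + 3 / 4 * K) := by
    by_contra! hcon
    refine hBβ j₀ (a - τ) ⟨by linarith [hτI.2], by linarith⟩ ?_
    rw [← hj₀ (a - τ) ⟨by linarith [hτI.2], by linarith⟩, sub_sub_cancel]
    exact hτB
  have hcT : c (τ + (a - D.α - τ)) = D.β j₀ (-D.α) := by
    rw [← hj₀ D.α ⟨hαpos.le, by linarith⟩]
    congr 1; ring
  have key := eq_arc_of_le (τ := τ) (T := a - D.α - τ) (u := K - x) hg hδ hg' hδ' hle
    (hc.1.isRegionTrajectory.mono hτI.1 (by linarith)) (by linarith) (by linarith) (by linarith)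
    (by linarith) (by rw [he]; congr 1; ring) hcT (fun z hz => by
      have := h.agreeAt j (D.α + z) ⟨by linarith [hz.1], by linarith [hz.2]⟩
      rwa [neg_add'] at this)
  rcases le_or_gt x 0 with hx0 | hx0
  · -- the trajectory follows the arc, and meets the support of the increment
    refine (hBb j).2 ?_
    have := key.2 (-x) ⟨by linarith, by linarith⟩
    rwa [show -D.α - (K - x) + -x = -D.α - K by ring] at this
  · -- the free path has already visited `B`
    have hd := (isArcOf_perturb (s := D.α + K) (j := j) hg (by linarith) fun z hz =>
      h.agreeAt j z ⟨hz.1, by linarith [hz.2]⟩).comp_add (-D.α - K + x - τ)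
    have hd' := hd.mono (a' := τ - x) (b' := τ) (by linarith) (by linarith)
    have hτ0 : 0 < τ := by
      refine lt_of_le_of_ne hτI.1 fun h0 => ?_
      have h1 := D.mem_region j (-D.α - K + x) ⟨by linarith, by linarith⟩
      rw [← he, ← h0] at h1
      exact hc.1.notMem_region_zero h1
    have heτ : c τ = D.β j (τ + (-D.α - K + x - τ)) := by rw [he]; congr 1; ring
    have hreg : ∀ t ∈ Icc (τ - x) τ, D.β j (t + (-D.α - K + x - τ)) ∈ S.region (D.i j) :=
      fun t ht => D.mem_region j _ ⟨by linarith [ht.1], by linarith [ht.2]⟩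
    obtain ⟨h1, h2⟩ := hτf.eqOn_of_isArcOf hr hτ0 hx0.le hd'
      (fun t ht => hreg t (Ico_subset_Icc_self ht)) heτ (Or.inl (hreg τ ⟨by linarith, le_rfl⟩))
    refine hbefore (τ - x) (by linarith) (by linarith) ?_
    have h3 := h2 (x := τ - x) ⟨le_rfl, by linarith⟩
    simp only at h3
    rw [h3, show τ - x + (-D.α - K + x - τ) = -D.α - K by ring]
    exact (hBb j).1

end BreakData

end PSVF

/-! ### Existence of the next modification -/

/-- The derivatives of order at most `m` of a compactly supported smooth function have a common
bound. -/
lemma exists_bound_iteratedFDeriv {E : Type*} [NormedAddCommGroup E] [NormedSpace ℝ E]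
    {f : E → ℝ} (hf : ContDiff ℝ ∞ f) (hs : HasCompactSupport f) (m : ℕ) :
    ∃ C, 0 ≤ C ∧ ∀ l ≤ m, ∀ x, ‖iteratedFDeriv ℝ l f x‖ ≤ C := by
  have h : ∀ l : ℕ, ∃ C, ∀ x, ‖iteratedFDeriv ℝ l f x‖ ≤ C := fun l =>
    (hf.continuous_iteratedFDeriv (m := l)
      (by exact_mod_cast le_top)).bounded_above_of_compact_support (hs.iteratedFDeriv l)
  choose C hC using h
  refine ⟨∑ l ∈ Finset.range (m + 1), |C l|, Finset.sum_nonneg fun _ _ => abs_nonneg _,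
    fun l hl x => (hC l x).trans ((le_abs_self _).trans ?_)⟩
  exact Finset.single_le_sum (f := fun l => |C l|) (fun _ _ => abs_nonneg _)
    (Finset.mem_range.2 (by omega))

/-- Bump functions that are small together with their derivatives. -/
lemma Plane.exists_small_bump (b : Plane) {ρ θ : ℝ} (hρ : 0 < ρ) (hθ : 0 < θ) (m : ℕ) :
    ∃ f : Plane → ℝ, ContDiff ℝ ∞ f ∧ (∀ x, 0 ≤ f x) ∧ 0 < f b ∧
      (∀ x ∉ Metric.closedBall b ρ, f x = 0) ∧ ∀ l ≤ m, ∀ x, ‖iteratedFDeriv ℝ l f x‖ ≤ θ := by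
  let f : ContDiffBump b := ⟨ρ / 2, ρ, by linarith, by linarith⟩
  have hf : ContDiff ℝ ∞ f := f.contDiff
  obtain ⟨C, hC0, hC⟩ := exists_bound_iteratedFDeriv hf f.hasCompactSupport m
  have hs : 0 < θ / (C + 1) := by positivity
  refine ⟨fun x => (θ / (C + 1)) • f x, hf.const_smul (θ / (C + 1)),
    fun x => mul_nonneg hs.le f.nonneg, ?_, fun x hx => ?_, fun l hl x => ?_⟩
  · exact mul_pos hs (f.pos_of_mem_ball (Metric.mem_ball_self hρ))
  · have : f x = 0 := f.zero_of_le_dist (by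
      rw [Metric.mem_closedBall, not_le] at hx; exact hx.le)
    simp [this]
  · have h1 : iteratedFDeriv ℝ l (fun x => (θ / (C + 1)) • f x) x =
        (θ / (C + 1)) • iteratedFDeriv ℝ l f x := by
      change iteratedFDeriv ℝ l ((θ / (C + 1)) • (f : Plane → ℝ)) x = _
      exact iteratedFDeriv_const_smul_apply (hf.of_le (by exact_mod_cast le_top)).contDiffAt
    rw [h1, norm_smul, Real.norm_eq_abs, abs_of_pos hs, div_mul_eq_mul_div,
      div_le_iff₀ (by linarith)]
    exact mul_le_mul_of_nonneg_left ((hC l hl x).trans (by linarith)) hθ.le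

namespace PSVF

variable {M : Type*} [TopologicalSpace M] [ChartedSpace Plane M] [IsManifold (𝓡 2) ∞ M]
  {n : ℕ} {S : SwitchingManifold M n} {r : ℕ∞} {Z : PSVF S r}

namespace BreakData

variable {ι : Type*} [Fintype ι] [T2Space M] {D : BreakData Z ι} {g g' : ι → Plane → ℝ} {δ δ' : ℝ}

/-- The point `β j (-α - x)` is on none of the arcs after the time `-α - x`. -/
lemma β_ne (hr : 1 ≤ r) (j j' : ι) {x : ℝ} (hx : x ∈ Ioc 0 D.κ) {t : ℝ}
    (ht : t ∈ Icc (-(2 * D.α)) 0) (hxt : -D.α - x < t) : D.β j (-D.α - x) ≠ D.β j' t := by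
  intro h
  have hκ := D.κ_pos
  have hκα := D.two_κ_le
  by_cases hj : j = j'
  · subst hj
    have := (IsArcOf.eq_of_eq hr (D.isArcOf j) (D.isArcOf j) (D.mem_region j)
      (D.mem_unstableSet j) (by linarith [hx.2]) hxt.le ht.2 h.symm).1
    linarith
  · have h1 := (D.mem_source j x ⟨hx.1.le, by linarith [hx.2]⟩).1
    rw [h] at h1
    exact D.notMem_source j j' hj t ht h1

/-- The small discs around the points `β j (-α - κ / 2 ^ N)` that support the next increment. -/
lemma IsStage.exists_radius (hr : 1 ≤ r) (hZ : Z.IsRegular) (ht : Z.tangencySet.Finite) {N : ℕ}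
    (h : D.IsStage N δ g) (j : ι) : ∃ ρ > 0,
      Metric.closedBall (D.φ j (D.β j (-D.α - D.κ / 2 ^ N))) ρ ⊆
        Metric.closedBall (D.y j) (D.R j) ∧
      ∀ e ∈ (D.φ j).symm '' Metric.closedBall (D.φ j (D.β j (-D.α - D.κ / 2 ^ N))) ρ,
        (∀ j', ∀ x ∈ Icc 0 (D.α + 3 / 4 * (D.κ / 2 ^ N)), D.β j' (-x) ≠ e) ∧
        ∀ c τ, (D.perturb g).IsFreePath c τ → τ ≤ (N + 1) * D.κ → c τ = e →
          ∃ x, |x| < D.κ / 2 ^ N / 2 ∧ e = D.β j (-D.α - D.κ / 2 ^ N + x) := by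
  have hK := κ_div_pos (D := D) N
  have hKκ := κ_div_le (D := D) N
  set K := D.κ / 2 ^ N
  have hα := D.α_pos
  have hκα := D.two_κ_le
  have hg := h.isAdmissible
  set b := D.β j (-D.α - K)
  have hb := D.mem_source j K ⟨hK.le, by linarith⟩
  have hbr : b ∈ S.region (D.i j) := D.source_subset j hb.1
  -- the free paths
  have h1 : ∀ᶠ e in 𝓝 b, ∀ c τ, (D.perturb g).IsFreePath c τ → τ ≤ (N + 1) * D.κ → c τ = e →
      ∃ x, |x| < K / 2 ∧ e = D.β j (-D.α - K + x) := by
    have harc := (isArcOf_perturb (s := D.α + 3 / 2 * K) hg (by linarith) (h.agreeAt j)).comp_add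
      (-D.α - K)
    have hint : IsMIntegralCurveOn (fun x => D.β j (x + (-D.α - K)))
        (fun p => (D.perturb g).field (D.i j) p) (Ioo (-(K / 2)) (K / 2)) :=
      harc.2.2.mono fun x hx => ⟨by linarith [hx.1], by linarith [hx.2]⟩
    have h2 := eventually_eq_arc hr ((agreeOnCurves_perturb hg).isRegular hZ)
      ((agreeOnCurves_perturb hg).tangencySet_eq ▸ ht) (half_pos hK) hint
      (by rw [zero_add]; exact hbr) ((N + 1) * D.κ) (half_pos hK)
    simp only [zero_add] at h2
    filter_upwards [h2] with e he c τ hc hτ hce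
    obtain ⟨x, hx, rfl⟩ := he c τ hc hτ hce
    exact ⟨x, hx, by rw [add_comm x]⟩
  -- the ends of the arcs
  have h2 : ∀ᶠ e in 𝓝 b, ∀ j', ∀ x ∈ Icc 0 (D.α + 3 / 4 * K), D.β j' (-x) ≠ e := by
    refine eventually_all.2 fun j' => ?_
    have hm : MapsTo (fun x => -x) (Icc 0 (D.α + 3 / 4 * K)) (Icc (-(2 * D.α)) 0) := fun x hx =>
      ⟨by linarith [hx.2], by linarith [hx.1]⟩
    have hcl : IsClosed ((fun x => D.β j' (-x)) '' Icc 0 (D.α + 3 / 4 * K)) :=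
      (isCompact_Icc.image_of_continuousOn
        ((D.isArcOf j').1.comp (by fun_prop) hm)).isClosed
    have hnot : b ∉ (fun x => D.β j' (-x)) '' Icc 0 (D.α + 3 / 4 * K) := by
      rintro ⟨x, hx, hxb⟩
      exact β_ne hr j j' ⟨hK, hKκ⟩ (hm hx) (by linarith [hx.2]) hxb.symm
    filter_upwards [hcl.isOpen_compl.mem_nhds hnot] with e he x hx hxe
    exact he ⟨x, hx, hxe⟩
  have hbt := (D.φ j).map_source hb.1
  have hsymm : Tendsto (D.φ j).symm (𝓝 (D.φ j b)) (𝓝 b) := by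
    have := (D.φ j).continuousAt_symm hbt
    rwa [ContinuousAt, (D.φ j).left_inv hb.1] at this
  have hball : Metric.closedBall (D.y j) (D.R j) ∈ 𝓝 (D.φ j b) :=
    Filter.mem_of_superset (Metric.isOpen_ball.mem_nhds hb.2)
      (Metric.ball_subset_closedBall.trans
        (Metric.closedBall_subset_closedBall (by linarith [D.R_pos j])))
  obtain ⟨ρ, hρ, hρs⟩ := Metric.nhds_basis_closedBall.mem_iff.1
    (inter_mem hball (hsymm.eventually (h2.and h1)))
  refine ⟨ρ, hρ, fun x hx => (hρs hx).1, ?_⟩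
  rintro e ⟨x, hx, rfl⟩
  exact (hρs hx).2

/-- The step of the construction: one more unit of time is taken care of by a small increment,
which does not affect the free paths that are too short to be continued to a connection. -/
lemma IsStage.exists_succ (hr : 1 ≤ r) (hZ : Z.IsRegular) (ht : Z.tangencySet.Finite) {N : ℕ}
    (h : D.IsStage N δ g) {θ : ℝ} (hθ : 0 < θ) (hδ : δ + θ ≤ D.ε) (m : ℕ) :
    ∃ g', D.IsStage (N + 1) (δ + θ) g' ∧ (∀ j x, g j x ≤ g' j x) ∧
      (∀ j, ∀ l ≤ m, ∀ x, ‖iteratedFDeriv ℝ l (fun z => g' j z - g j z) x‖ ≤ θ) ∧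
      ∀ c τ, (D.perturb g).IsFreePath c τ → τ + 2 * D.α ≤ N * D.κ → D.AgreeAt g g' (c τ) := by
  have hK := κ_div_pos (D := D) N
  have hKκ := κ_div_le (D := D) N
  have hα := D.α_pos
  have hκ := D.κ_pos
  have hκα := D.two_κ_le
  have hg := h.isAdmissible
  choose ρ hρ hρR hρe using h.exists_radius hr hZ ht
  choose f hf hf0 hfb hfz hfl using fun j => Plane.exists_small_bump
    (D.φ j (D.β j (-D.α - D.κ / 2 ^ N))) (hρ j) hθ (max m 1)
  set g' : ι → Plane → ℝ := fun j x => g j x + f j x with hg'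
  have hadm : D.IsAdmissible (δ + θ) g' := by
    refine ⟨fun j => (hg.contDiff j).add (hf j), fun j x => add_nonneg (hg.nonneg j x) (hf0 j x),
      fun j x hx => ?_, fun j l hl x => ?_⟩
    · simp only [hg', hg.eq_zero j x hx, hfz j x fun h => hx (hρR j h), add_zero]
    · have h1 : iteratedFDeriv ℝ l (g' j) x = iteratedFDeriv ℝ l (g j) x +
          iteratedFDeriv ℝ l (f j) x :=
        iteratedFDeriv_add_apply ((hg.contDiff j).of_le (by exact_mod_cast le_top)).contDiffAt
          ((hf j).of_le (by exact_mod_cast le_top)).contDiffAt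
      rw [h1]
      exact (norm_add_le _ _).trans (add_le_add (hg.norm_le j l hl x)
        (hfl j l (hl.trans (le_max_right _ _)) x))
  have hle : ∀ j x, g j x ≤ g' j x := fun j x => le_add_of_nonneg_right (hf0 j x)
  set B : Set M := ⋃ j, (D.φ j).symm ''
    Metric.closedBall (D.φ j (D.β j (-D.α - D.κ / 2 ^ N))) (ρ j) with hBdef
  have hB : IsClosed B := isClosed_iUnion_of_finite fun j =>
    ((isCompact_closedBall _ _).image_of_continuousOn
      ((D.φ j).continuousOn_symm.mono ((hρR j).trans (D.ball_subset j)))).isClosed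
  have hBa : ∀ p ∉ B, D.AgreeAt g g' p := by
    intro p hp j hj
    have : f j (D.φ j p) = 0 := hfz j _ fun h1 =>
      hp (mem_iUnion.2 ⟨j, D.φ j p, h1, (D.φ j).left_inv hj⟩)
    simp only [hg', this, add_zero]
  have hBβ : ∀ j, ∀ x ∈ Icc 0 (D.α + 3 / 4 * (D.κ / 2 ^ N)), D.β j (-x) ∉ B := by
    intro j x hx hxB
    obtain ⟨j', hj'⟩ := mem_iUnion.1 hxB
    exact (hρe j' _ hj').1 j x hx rfl
  have hBc : ∀ e ∈ B, ∀ c τ, (D.perturb g).IsFreePath c τ → τ ≤ (N + 1) * D.κ → c τ = e →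
      ∃ j x, |x| < D.κ / 2 ^ N / 2 ∧ e = D.β j (-D.α - D.κ / 2 ^ N + x) := by
    intro e he c τ hc hτ hce
    obtain ⟨j, hj⟩ := mem_iUnion.1 he
    exact ⟨j, (hρe j e hj).2 c τ hc hτ hce⟩
  have hBb : ∀ j, D.β j (-D.α - D.κ / 2 ^ N) ∈ B ∧
      g j (D.φ j (D.β j (-D.α - D.κ / 2 ^ N))) ≠
        g' j (D.φ j (D.β j (-D.α - D.κ / 2 ^ N))) := by
    intro j
    have h1 := (D.mem_source j (D.κ / 2 ^ N) ⟨hK.le, by linarith⟩).1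
    exact ⟨mem_iUnion.2 ⟨j, _, Metric.mem_closedBall_self (hρ j).le, (D.φ j).left_inv h1⟩,
      (lt_add_of_pos_right _ (hfb j)).ne⟩
  refine ⟨g', ⟨hadm, fun j x hx => ?_, ?_⟩, hle, fun j l hl x => ?_, fun c τ hc hτ => ?_⟩
  · have e1 : 3 / 2 * (D.κ / 2 ^ (N + 1)) = 3 / 4 * (D.κ / 2 ^ N) := by
      rw [pow_succ]; field_simp; norm_num
    rw [e1] at hx
    intro l hl
    rw [← hBa _ (hBβ j x hx) l hl]
    exact h.agreeAt j x ⟨hx.1, by linarith [hx.2]⟩ l hl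
  · push_cast
    exact h.not_isConnection_succ hr hZ (by linarith) hadm hδ hle hB hBa hBb hBβ hBc
  · simp only [hg', add_sub_cancel_left]
    exact hfl j l (hl.trans (le_max_left _ _)) x
  -- a free path that ended in `B` this early would continue to a connection of duration `≤ N * κ`
  · by_contra hne
    have hB' : c τ ∈ B := by
      by_contra h1
      exact hne (hBa _ h1)
    obtain ⟨j, x, hx, he⟩ := hBc _ hB' c τ hc (by linarith) rfl
    rw [_root_.abs_lt] at hx
    obtain ⟨c', hc'⟩ := exists_isConnection (s := D.α + D.κ / 2 ^ N - x) hg hc (by linarith)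
      (by linarith) (fun z hz => h.agreeAt j z ⟨hz.1, by linarith [hz.2]⟩)
      (by rw [he]; congr 1; ring)
    exact h.not_isConnection _ _ (by linarith) hc'

end BreakData

end PSVF

/-! ### The limit of the modifications -/

/-- A sequence with a property and a relation between successive terms, by dependent choice. -/
lemma exists_seq_of_forall_exists {X : Type*} {P : ℕ → X → Prop} {Q : ℕ → X → X → Prop} {x₀ : X}
    (h0 : P 0 x₀) (h : ∀ N x, P N x → ∃ x', P (N + 1) x' ∧ Q N x x') :
    ∃ x : ℕ → X, x 0 = x₀ ∧ (∀ N, P N (x N)) ∧ ∀ N, Q N (x N) (x (N + 1)) := by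
  let f : (N : ℕ) → {x // P N x} := fun N =>
    Nat.rec ⟨x₀, h0⟩ (fun N x => ⟨(h N x x.2).choose, (h N x x.2).choose_spec.1⟩) N
  exact ⟨fun N => (f N).1, rfl, fun N => (f N).2, fun N => (h N _ (f N).2).choose_spec.2⟩

/-- The limit of a sequence of smooth functions with fast decreasing increments. -/
lemma exists_contDiff_limit {E : Type*} [NormedAddCommGroup E] [NormedSpace ℝ E]
    {B : Set E} (hB : IsCompact B) {G : ℕ → E → ℝ} (h0 : G 0 = 0)
    (hG : ∀ N, ContDiff ℝ ∞ (G N)) (hGB : ∀ N, ∀ x ∉ B, G N x = 0) {θ : ℝ} {m : ℕ}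
    (hGθ : ∀ N, ∀ l ≤ N + m, ∀ x,
      ‖iteratedFDeriv ℝ l (fun z => G (N + 1) z - G N z) x‖ ≤ θ / 2 / 2 ^ N) :
    ∃ g : E → ℝ, ContDiff ℝ ∞ g ∧ (∀ x, Tendsto (fun N => G N x) atTop (𝓝 (g x))) ∧
      ∀ l ≤ m, ∀ x, ‖iteratedFDeriv ℝ l g x‖ ≤ θ := by
  set d : ℕ → E → ℝ := fun N z => G (N + 1) z - G N z with hd
  have hdc : ∀ N, ContDiff ℝ ∞ (d N) := fun N => (hG (N + 1)).sub (hG N)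
  have hds : ∀ N, HasCompactSupport (d N) := fun N =>
    HasCompactSupport.intro hB fun x hx => by simp [hd, hGB _ x hx]
  have hb : ∀ N k : ℕ, ∃ C, ∀ x, ‖iteratedFDeriv ℝ k (d N) x‖ ≤ C := fun N k => by
    obtain ⟨C, -, hC⟩ := exists_bound_iteratedFDeriv (hdc N) (hds N) k
    exact ⟨C, hC k le_rfl⟩
  choose C hC using hb
  let v : ℕ → ℕ → ℝ := fun k N => if k ≤ N + m then θ / 2 / 2 ^ N else C N k
  have hv : ∀ k, Summable (v k) := fun k => by
    refine Summable.congr_atTop (hasSum_geometric_two' θ).summable ?_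
    filter_upwards [eventually_ge_atTop k] with N hN
    simp only [v]
    rw [if_pos (by omega)]
  have hdv : ∀ (k N : ℕ) (x : E), ‖iteratedFDeriv ℝ k (d N) x‖ ≤ v k N := fun k N x => by
    simp only [v]
    split_ifs with h
    · exact hGθ N k h x
    · exact hC N k x
  refine ⟨fun x => ∑' N, d N x, contDiff_tsum (N := ⊤) hdc (fun k _ => hv k)
    (fun k i x _ => hdv k i x), fun x => ?_, fun l hl x => ?_⟩
  · have hsum : Summable fun N => d N x := by
      refine (hv 0).of_norm_bounded fun N => ?_
      have := hdv 0 N x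
      rwa [norm_iteratedFDeriv_zero] at this
    have := hsum.hasSum.tendsto_sum_nat
    simp only [hd, Finset.sum_range_sub (fun N => G N x), h0, Pi.zero_apply, sub_zero] at this
    exact this
  · rw [iteratedFDeriv_tsum (N := ⊤) hdc (fun k _ => hv k) (fun k i x _ => hdv k i x) le_top]
    exact tsum_of_norm_bounded (hasSum_geometric_two' θ) fun N => hGθ N l (by omega) x

namespace PSVF

variable {M : Type*} [TopologicalSpace M] [ChartedSpace Plane M] [IsManifold (𝓡 2) ∞ M]
  {n : ℕ} {S : SwitchingManifold M n} {r : ℕ∞} {Z : PSVF S r}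

namespace BreakData

variable {ι : Type*} [Fintype ι] [T2Space M] {D : BreakData Z ι} {g g' : ι → Plane → ℝ} {δ δ' : ℝ}

/-- The sequence of modifications, and its limit. -/
lemma exists_seq (hr : 1 ≤ r) (hZ : Z.IsRegular) (ht : Z.tangencySet.Finite) {θ : ℝ} (hθ : 0 < θ)
    (hθε : θ ≤ D.ε) {m : ℕ} (hm : 1 ≤ m) :
    ∃ (G : ℕ → ι → Plane → ℝ) (δ : ℕ → ℝ) (g : ι → Plane → ℝ), (∀ N, D.IsStage N (δ N) (G N)) ∧
      (∀ N c τ, (D.perturb (G N)).IsFreePath c τ → τ + 2 * D.α ≤ N * D.κ →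
        D.AgreeAt (G N) (G (N + 1)) (c τ)) ∧
      (∀ j x, Tendsto (fun N => G N j x) atTop (𝓝 (g j x))) ∧ D.IsAdmissible θ g ∧
      ∀ j, ∀ l ≤ m, ∀ x, ‖iteratedFDeriv ℝ l (g j) x‖ ≤ θ := by
  have hstep : ∀ N g, D.IsStage N (θ - θ / 2 ^ N) g → ∃ g',
      D.IsStage (N + 1) (θ - θ / 2 ^ (N + 1)) g' ∧
      (∀ j, ∀ l ≤ N + m, ∀ x, ‖iteratedFDeriv ℝ l (fun z => g' j z - g j z) x‖ ≤ θ / 2 / 2 ^ N) ∧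
      ∀ c τ, (D.perturb g).IsFreePath c τ → τ + 2 * D.α ≤ N * D.κ →
        D.AgreeAt g g' (c τ) := by
    intro N g hg
    have h2 : θ - θ / 2 ^ N + θ / 2 / 2 ^ N = θ - θ / 2 ^ (N + 1) := by
      rw [pow_succ]; field_simp; ring
    have h3 : 0 < θ / 2 ^ (N + 1) := by positivity
    obtain ⟨g', h4, -, h5, h6⟩ := hg.exists_succ hr hZ ht (θ := θ / 2 / 2 ^ N) (by positivity)
      (by linarith) (N + m)
    exact ⟨g', h2 ▸ h4, h5, h6⟩
  obtain ⟨G, hG0, hG, hGs⟩ := exists_seq_of_forall_exists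
    (P := fun N g => D.IsStage N (θ - θ / 2 ^ N) g) (x₀ := 0)
    (by simpa using isStage_zero (D := D) hZ) hstep
  choose g hg hgl hgθ using fun j => exists_contDiff_limit
    (isCompact_closedBall (D.y j) (D.R j)) (G := fun N => G N j) (by rw [hG0]; rfl)
    (fun N => (hG N).isAdmissible.contDiff j) (fun N => (hG N).isAdmissible.eq_zero j)
    (fun N => (hGs N).1 j)
  refine ⟨G, _, g, hG, fun N => (hGs N).2, hgl, ⟨hg, fun j x => ?_, fun j x hx => ?_,
    fun j l hl x => hgθ j l (hl.trans hm) x⟩, hgθ⟩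
  · exact ge_of_tendsto' (hgl j x) fun N => (hG N).isAdmissible.nonneg j x
  · refine tendsto_nhds_unique (hgl j x) ?_
    simp only [(hG _).isAdmissible.eq_zero j x hx]
    exact tendsto_const_nhds

/-- Agreement with all the later terms of a sequence passes to the limit. -/
lemma AgreeAt.of_tendsto {G : ℕ → ι → Plane → ℝ}
    (hl : ∀ j x, Tendsto (fun N => G N j x) atTop (𝓝 (g j x))) {N : ℕ} {p : M}
    (h : ∀ K ≥ N, D.AgreeAt (G N) (G K) p) : D.AgreeAt (G N) g p := fun j hj =>
  (tendsto_nhds_unique (hl j _) (tendsto_atTop_of_eventually_const (i₀ := N)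
    fun K hK => (h K hK j hj).symm)).symm

/-- A property that holds along `[0, a]` because it can be propagated. -/
lemma _root_.forall_mem_Icc_of_propagates {P : ℝ → Prop} {a : ℝ} (h0 : 0 ≤ a → P 0)
    (hl : ∀ t ∈ Ioc 0 a, (∀ s ∈ Ico 0 t, P s) → P t)
    (hs : ∀ t ∈ Ico 0 a, (∀ s ∈ Icc 0 t, P s) → ∃ u > t, ∀ s ∈ Ioo t u, s ≤ a → P s) :
    ∀ t ∈ Icc 0 a, P t := by
  by_contra! hcon
  obtain ⟨t₀, ht₀, hPt₀⟩ := hcon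
  set A : Set ℝ := {t | t ∈ Icc 0 a ∧ ¬ P t}
  have hne : A.Nonempty := ⟨t₀, ht₀, hPt₀⟩
  have hbdd : BddBelow A := ⟨0, fun t ht => ht.1.1⟩
  have hT0 : 0 ≤ sInf A := le_csInf hne fun t ht => ht.1.1
  have hTa : sInf A ≤ a := (csInf_le hbdd ⟨ht₀, hPt₀⟩).trans ht₀.2
  have hbefore : ∀ s ∈ Ico 0 (sInf A), P s := fun s hs => by
    by_contra h
    exact (csInf_le hbdd (show s ∈ A from ⟨⟨hs.1, hs.2.le.trans hTa⟩, h⟩)).not_gt hs.2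
  have hT : P (sInf A) := by
    rcases hT0.eq_or_lt with h | h
    · rw [← h]; exact h0 (hT0.trans hTa)
    · exact hl _ ⟨h, hTa⟩ hbefore
  have hTa' : sInf A < a := by
    refine hTa.lt_of_ne fun h => hPt₀ ?_
    have h1 : t₀ = sInf A := le_antisymm (h ▸ ht₀.2) (csInf_le hbdd ⟨ht₀, hPt₀⟩)
    rwa [h1]
  obtain ⟨u, hu, hus⟩ := hs _ ⟨hT0, hTa'⟩ fun s hs' => by
    rcases hs'.2.eq_or_lt with h | h
    · rwa [h]
    · exact hbefore s ⟨hs'.1, h⟩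
  obtain ⟨t, htA, htu⟩ := exists_lt_of_csInf_lt hne hu
  have htT : sInf A < t := (csInf_le hbdd htA).lt_of_ne fun h => htA.2 (h ▸ hT)
  exact htA.2 (hus t ⟨htT, htu⟩ htA.1.2)

/-- The limit of the modifications has no connections: a connection of the limit has a bounded
duration, so that it is a connection of one of the modifications. -/
lemma not_isConnection_limit (hr : 1 ≤ r) {G : ℕ → ι → Plane → ℝ} {δ : ℕ → ℝ} {θ : ℝ}
    (hG : ∀ N, D.IsStage N (δ N) (G N))
    (hrel : ∀ N c τ, (D.perturb (G N)).IsFreePath c τ → τ + 2 * D.α ≤ N * D.κ →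
        D.AgreeAt (G N) (G (N + 1)) (c τ))
    (hl : ∀ j x, Tendsto (fun N => G N j x) atTop (𝓝 (g j x))) (hg : D.IsAdmissible θ g)
    (c : ℝ → M) (a : ℝ) : ¬ (D.perturb g).IsConnection c a := by
  intro hc
  have hκ := D.κ_pos
  obtain ⟨N, hN⟩ := exists_nat_ge ((a + 1 + 2 * D.α) / D.κ)
  rw [div_le_iff₀ hκ] at hN
  have hGN := (hG N).isAdmissible
  have hZ := agreeOnCurves hGN hg
  -- the later increments vanish along the free paths of bounded duration; the bound `a + 1` leaves
  -- room for short continuations of `c`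
  have key : ∀ d τ, (D.perturb (G N)).IsFreePath d τ → τ ≤ a + 1 →
      D.AgreeAt (G N) g (d τ) := by
    intro d τ hd hτ
    have h1 : ∀ K ≥ N, (D.perturb (G K)).IsFreePath d τ ∧
        ∀ s ∈ Icc 0 τ, D.AgreeAt (G N) (G K) (d s) := by
      intro K hK
      induction K, hK using Nat.le_induction with
      | base => exact ⟨hd, fun s _ j _ => rfl⟩
      | succ K hK ih =>
        have hK' : (N : ℝ) * D.κ ≤ K * D.κ :=
          mul_le_mul_of_nonneg_right (by exact_mod_cast hK) hκ.le
        have h2 : ∀ s ∈ Icc 0 τ, D.AgreeAt (G K) (G (K + 1)) (d s) := fun s hs =>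
          hrel K d s (ih.1.mono hs.1 hs.2) (by linarith [hs.2])
        refine ⟨ih.1.of_field_eq (agreeOnCurves (hG K).isAdmissible (hG (K + 1)).isAdmissible)
          fun t ht i => (h2 t (Ioo_subset_Icc_self ht)).field_eq (hG K).isAdmissible
            (hG (K + 1)).isAdmissible i, fun s hs j hj => ?_⟩
        rw [ih.2 s hs j hj, h2 s hs j hj]
    exact AgreeAt.of_tendsto hl fun K hK => (h1 K hK).2 τ ⟨hd.nonneg, le_rfl⟩
  have hca : ContinuousOn c (Icc 0 a) := hc.1.isRegionTrajectory.1
  have hfree : ∀ t ∈ Icc 0 a, (∀ s ∈ Icc 0 t, D.AgreeAt (G N) g (c s)) →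
      (D.perturb (G N)).IsFreePath c t := fun t ht h =>
    (hc.1.mono ht.1 ht.2).of_field_eq hZ.symm fun s hs i =>
      ((h s (Ioo_subset_Icc_self hs)).symm).field_eq hg hGN i
  have hmain : ∀ t ∈ Icc 0 a, D.AgreeAt (G N) g (c t) := by
    refine forall_mem_Icc_of_propagates (fun _ => ?_) (fun t ht h => ?_) (fun t ht h => ?_)
    · obtain ⟨k, hk, -⟩ := hc.1.mem_stableSet
      exact fun j hj => absurd hj (notMem_source_of_γ_eq_zero hk j)
    · have h1 : Tendsto c (𝓝[<] t) (𝓝 (c t)) :=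
        ((hca t ⟨ht.1.le, ht.2⟩).mono (Icc_subset_Icc_right ht.2)).mono_left
          (nhdsWithin_le_of_mem (Icc_mem_nhdsLT ht.1))
      refine (isClosed_setOf_agreeAt hGN hg).mem_of_tendsto h1 ?_
      filter_upwards [Ico_mem_nhdsLT ht.1] with s hs using h s hs
    · by_cases hsrc : ∃ j, c t ∈ (D.φ j).source
      · -- in a region, the trajectory of the modification is continued, and followed
        obtain ⟨j, hj⟩ := hsrc
        have hreg := D.source_subset j hj
        obtain ⟨V, hV, η, hη, hflow⟩ := VField.exists_isMIntegralCurveOn_uniform hr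
          ((D.perturb (G N)).field (D.i j)) (c t) ((S.isOpen_region (D.i j)).mem_nhds hreg)
        obtain ⟨d, hd0, hd, hdreg⟩ := hflow (c t) (mem_of_mem_nhds hV)
        obtain ⟨u, hu, i, hi⟩ := hc.1.isRegionTrajectory.2.1 t ht
        obtain rfl := S.eq_of_mem_closure_region (hi.2.1 t ⟨le_rfl, hu.1.le⟩) hreg
        set b := min (min (η / 2) 1) (u - t) with hb
        have hb0 : 0 < b := lt_min (lt_min (half_pos hη) one_pos) (by linarith [hu.1])
        have hbη : b ≤ η / 2 := (min_le_left _ _).trans (min_le_left _ _)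
        have hb1 : b ≤ 1 := (min_le_left _ _).trans (min_le_right _ _)
        have hbu : b ≤ u - t := min_le_right _ _
        have harc : (D.perturb (G N)).IsArcOf (D.i j) d 0 b :=
          ⟨hd.continuousOn.mono fun x hx => ⟨by linarith [hx.1], by linarith [hx.2]⟩,
            fun x hx => subset_closure (hdreg x ⟨by linarith [hx.1], by linarith [hx.2]⟩),
            hd.mono fun x hx => ⟨by linarith [hx.1], by linarith [hx.2]⟩⟩
        have harc' := harc.comp_add (-t)
        rw [show 0 - -t = t by ring, show b - -t = t + b by ring] at harc'
        have hct := hfree t ⟨ht.1, ht.2.le⟩ h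
        have hagree : ∀ s ∈ Ioc t (t + b), D.AgreeAt (G N) g (d (s + -t)) := by
          intro s hs
          have h1 := hct.extend (b := s) hs.1 (harc'.mono le_rfl hs.2)
            (fun x hx => hdreg _ ⟨by linarith [hx.1], by linarith [hx.2, hs.2]⟩) (by simp [hd0])
          have h2 := key _ s h1 (by linarith [hs.2, ht.2])
          simpa [hs.1.not_ge] using h2
        have harcg := harc'.of_field_eq (Z' := D.perturb g) fun s hs =>
          (hagree s ⟨hs.1, hs.2.le⟩).field_eq hGN hg (D.i j)
        have hi' := hi.mono (a' := t) (b' := t + b) le_rfl (by linarith)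
        have heq := VField.eqOn_Icc_of_left hr hi'.1 harcg.1 hi'.2.2 harcg.2.2 (by simp [hd0])
        refine ⟨t + b, by linarith, fun s hs _ => ?_⟩
        have h3 := heq ⟨hs.1.le, hs.2.le⟩
        simp only at h3
        rw [h3]
        exact hagree s ⟨hs.1, hs.2.le⟩
      · push Not at hsrc
        have h1 : Tendsto c (𝓝[>] t) (𝓝 (c t)) :=
          ((hca t ⟨ht.1, ht.2.le⟩).mono (Icc_subset_Icc_left ht.1)).mono_left
            (nhdsWithin_le_of_mem (Icc_mem_nhdsGT ht.2))
        obtain ⟨u, hu, hus⟩ := mem_nhdsGT_iff_exists_Ioo_subset.1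
          (h1.eventually (eventually_agreeAt hGN hg hsrc))
        exact ⟨u, hu, fun s hs _ => hus hs⟩
  refine (hG N).not_isConnection c a (by linarith [D.α_pos])
    ⟨hfree a ⟨hc.1.nonneg, le_rfl⟩ hmain, hZ.unstableSet_eq ▸ hc.2⟩

/-- The modifications by functions that tend to `0` with all their derivatives tend to `Z`. -/
lemma tendsto_perturb {g : ℕ → ι → Plane → ℝ} {θ : ℕ → ℝ} (hg : ∀ N, D.IsAdmissible (θ N) (g N))
    (hθ : Tendsto θ atTop (𝓝 0))
    (hgθ : ∀ N j, ∀ l ≤ N, ∀ x, ‖iteratedFDeriv ℝ l (g N j) x‖ ≤ θ N) :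
    Tendsto (fun N => D.perturb (g N)) atTop (𝓝 Z) := by
  refine tendsto_nhds_of_inChart fun i e K m he hK hKe hm η hη => ?_
  choose C hC0 hC using fun j => VField.exists_bound_inChart (r := r) (D.mem_atlas j) he
    (isCompact_closedBall (D.y j) (D.R j)) (D.ball_subset j) hK hKe (D.w j) m
  have h1 : Tendsto (fun N => ∑ j, C j * θ N) atTop (𝓝 0) := by
    have : Tendsto (fun N => ∑ j, C j * θ N) atTop (𝓝 (∑ j, C j * 0)) :=
      tendsto_finsetSum _ fun j _ => hθ.const_mul (C j)
    simpa using this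
  filter_upwards [h1.eventually_lt_const hη, eventually_ge_atTop m] with N hN hmN p hp
  have h2 : (D.perturb (g N)).field i - Z.field i =
      ∑ j, VField.chartField (D.φ j) (D.w j) (g N j) := by
    simp only [perturb, add_sub_cancel_left]
  have h3 : iteratedFDeriv ℝ m (((D.perturb (g N)).field i - Z.field i).inChart e) (e p) =
      ∑ j, iteratedFDeriv ℝ m
        ((VField.chartField (D.φ j) (D.w j) (g N j) : VField M r).inChart e) (e p) := by
    rw [h2, VField.inChart_sum]
    exact iteratedFDeriv_sum_apply fun j _ =>
      VField.contDiffAt_inChart _ he (e.map_source (hKe hp)) hm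
  rw [h3]
  refine ((norm_sum_le _ _).trans (Finset.sum_le_sum fun j _ => ?_)).trans_lt hN
  exact hC j (g N j) _ (θ N) ((hg N).contDiff j) ((hg N).eq_zero j) ((hg N).isChartField j)
    (fun l hl x => hgθ N j l (hl.trans hmN) x) p hp

end BreakData

/-- The connections of a regular field can be broken by small modifications that do not affect the
switching manifold. -/
lemma frequently_not_isConnection [T2Space M] (hr : 1 ≤ r) (hZ : Z.IsRegular)
    (ht : Z.tangencySet.Finite) :
    ∃ᶠ Z' in 𝓝 Z, AgreeOnCurves Z Z' ∧ ∀ c a, ¬ Z'.IsConnection c a := by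
  obtain ⟨Q, hQ, ⟨D⟩⟩ := exists_breakData hr hZ ht
  have := hQ.fintype
  have hθ : ∀ N : ℕ, 0 < D.ε / 2 ^ N := fun N => div_pos D.ε_pos (by positivity)
  have hθε : ∀ N : ℕ, D.ε / 2 ^ N ≤ D.ε := fun N =>
    div_le_self D.ε_pos.le (one_le_pow₀ (by norm_num))
  choose G δ g hG hrel hl hg hgθ using fun N : ℕ =>
    BreakData.exists_seq (D := D) hr hZ ht (hθ N) (hθε N) (m := N + 1) (by omega)
  have hlim : Tendsto (fun N : ℕ => D.ε / 2 ^ N) atTop (𝓝 0) := by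
    have := (tendsto_pow_atTop_nhds_zero_of_lt_one (r := (1 / 2 : ℝ)) (by norm_num)
      (by norm_num)).const_mul D.ε
    simpa [div_eq_mul_inv] using this
  have htend := BreakData.tendsto_perturb hg hlim fun N j l hl' x => hgθ N j l (by omega) x
  -- `g N` is a limit of stages, and it is at most `ε / 2 ^ N` with its first `N + 1` derivatives
  refine htend.frequently
    (Frequently.of_forall fun N => ⟨BreakData.agreeOnCurves_perturb (hg N), ?_⟩)
  exact BreakData.not_isConnection_limit hr (hG N) (hrel N) (hl N) (hg N)

end PSVF

theorem theoremD {M : Type*} [TopologicalSpace M] [T2Space M] [CompactSpace M]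
    [ChartedSpace Plane M] [IsManifold (𝓡 2) ∞ M] {n : ℕ} (S : SwitchingManifold M n)
    {r : ℕ∞} (hr : 1 ≤ r) (Z : PSVF S r) (hs : Z.slidingRegion.Nonempty)
    (he : Z.escapingRegion.Nonempty) (ht : Z.tangencySet.Finite) :
    ¬ Z.IsRobustlyTransitive := by
  rintro ⟨-, h⟩
  obtain ⟨p, hp⟩ := hs
  -- perturb twice: the first time to make the field regular, the second to break the connections
  obtain ⟨Z₁, ⟨ht₁, hp₁, hZ₁⟩, h₁⟩ := ((PSVF.frequently_isRegular hr _ Z ht hp le_rfl).and_eventually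
    (eventually_eventually_nhds.2 h)).exists
  obtain ⟨Z₂, ⟨hZ₂, hno⟩, h₂⟩ :=
    ((PSVF.frequently_not_isConnection hr hZ₁ ht₁).and_eventually h₁).exists
  exact PSVF.not_isTransitive hr (hZ₂.isRegular hZ₁) (hZ₂.tangencySet_eq ▸ ht₁)
    ⟨p, hZ₂.slidingRegion_subset hp₁⟩ hno h₂
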